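/- **Setting.** For $\rho>0$ let $\mathbb B_\rho=\{\theta\in\mathbb C:|\operatorname{Im}\theta|<\rho\}$, and let $\mathbb W\subset\mathbb C$ be open and bounded. Let $\mathcal B_\rho=\mathcal B(\mathbb B_\rho,\mathbb W)$ be the real Banach space, with the supremum norm, of functions $f(\theta,z)$ that are holomorphic in $\mathbb B_\rho\times\mathbb W$, continuous and bounded on its closure, real for real arguments, and $1$-periodic in $\theta$. For $\rho'\le\rho$, restriction maps $\mathcal B_\rho$ to $\mathcal B_{\rho'}$. Let $\omega\in\mathbb R$ be Diophantine, i.e. there are $\gamma>0$, $\tau\ge1$ with $|q\omega-p|\ge\gamma|q|^{-\tau}$ for all $p\in\mathbb Z$, $q\in\mathbb Z\setminus\{0\}$. Put $f^0(\theta,z)=z$ and $f^{k+1}(\theta,z)=f(\theta+k\omega,f^{k}(\theta,z))$. Fix $K_0>0$. For $n\ge 0$, an *attracting $2^n$-periodic curve* of $f\in\mathcal B_\rho$ is a $1$-periodic function $x:\mathbb B_\rho\to\mathbb W$, holomorphic in $\mathbb B_\rho$, continuous on the closure and real for real $\theta$, such that $f^j(\theta,x(\theta))\in\mathbb W$ for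 $0\le j<2^n$, $x(\theta+2^n\omega)=f^{2^n}(\theta,x(\theta))$, and $$\int_0^1\ln\bigl|D_xf^{2^n}(\theta,x(\theta))\bigr|\,d\theta<-K_0\qquad(\ln 0=-\infty).$$ Let $\Upsilon_n^+(\omega)=\Upsilon_{n}^{+}(\omega,\rho)\subset\mathcal B_\rho$ (respectively $\Upsilon_n^-(\omega)$) be the set of those $f$ that have an attracting $2^n$-periodic curve $x$ with $\min_{\theta\in\mathbb R/\mathbb Z}D_xf^{2^n}(\theta,x(\theta))=0$ (respectively $\max_{\theta\in\mathbb R/\mathbb Z}D_xf^{2^n}(\theta,x(\theta))=0$). A set $S$ in a normed space is a *codimension-one manifold near* $p\in S$ if there are an open neighbourhood $U$ of $p$ and a $C^\infty$ function $\Phi:U\to\mathbb R$ with nowhere vanishing differential such that $S\cap U=\Phi^{-1}(0)$. **Proposition.** For all $K_0,r>0$ and $M\in\mathbb R$ there is $\rho_0\in(0,r]$, depending only on $K_0,r,M$, with the following property. Let $\mathbb W$, $\omega$, $n$ be as above, $\rho\ge r$, $f\in\Upsilon_n^+(\omega,\rho)$ (respectively $f\in\Upsilon_n^-(\omega,\rho)$),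 and let $x$ be a corresponding curve of $f$, with $|D_xf^{2^n}(\theta,x(\theta))|\le M$ for $\theta\in\mathbb B_r$ (such an $M$ exists for every $r<\rho$). Suppose that $\theta\mapsto D_xf^{2^n}(\theta,x(\theta))$ has on $\mathbb R/\mathbb Z$ a unique absolute minimum (respectively maximum), and that it is non-degenerate (second derivative $\neq0$). Then for every $\rho'\in(0,\rho_0]$, near the restriction of $f$ to the band $\mathbb B_{\rho'}$: 1. For all sufficiently small $\varepsilon>0$, the set of those $g\in\mathcal B_{\rho'}$ that satisfy the definition of $\Upsilon_n^{+}(\omega,\rho')$ (respectively $\Upsilon_n^{-}(\omega,\rho')$) with a curve at sup-distance less than $\varepsilon$ from $x$ on $\mathbb B_{\rho'}$ is a codimension-one manifold. 2. If $x$ is *the* $2^n$-periodic curve of $f$, then $\Upsilon_n^{+}(\omega,\rho')$ (respectively $\Upsilon_n^{-}(\omega,\rho')$) itself is a codimension-one manifold. Here "$x$ is the curve of $f$" means: every real analytic $1$-periodic $y:\mathbb R\to\mathbb R$ with $f^j(\theta,y(\theta))\in\overline{\mathbb W}$ for $0\le j<2^n$ and $y(\theta+2^n\omega)=f^{2^n}(\theta,y(\theta))$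 either is one of the iterates of $x$, i.e. $y(\theta+j\omega)=f^j(\theta,x(\theta))$ for some $0\le j<2^n$, or has all $f^j(\theta,y(\theta))$, $0\le j<2^n$, in $\mathbb W$ and fails one of the two conditions $\int_0^1\ln|D_xf^{2^n}(\theta,y(\theta))|\,d\theta\le-K_0$ and $\min_\theta D_xf^{2^n}(\theta,y(\theta))=0$ (respectively $\max_\theta D_xf^{2^n}(\theta,y(\theta))=0$). -/

import Mathlib

open Set MeasureTheory
open scoped ENNReal BoundedContinuousFunction

noncomputable section

namespace QPForced

/-- The open band `𝔹_ρ = {θ ∈ ℂ : |Im θ| < ρ}` around the real axis. -/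
def strip (ρ : ℝ) : Set ℂ := {θ | |θ.im| < ρ}

/-- The closure of `𝔹_ρ × W`, on which the elements of the space `𝓑 ρ W` are defined. -/
abbrev dom (ρ : ℝ) (W : Set ℂ) : Set (ℂ × ℂ) := closure (strip ρ ×ˢ W)

open Classical in
/-- A function on the closure of `𝔹_ρ × W`, extended by `0` to `ℂ × ℂ`. -/
def ev {ρ : ℝ} {W : Set ℂ} (f : dom ρ W →ᵇ ℂ) (p : ℂ × ℂ) : ℂ :=
  if h : p ∈ dom ρ W then f ⟨p, h⟩ else 0

theorem strip_prod_subset_dom {ρ : ℝ} {W : Set ℂ} : strip ρ ×ˢ W ⊆ dom ρ W := subset_closure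

theorem strip_mono {ρ' ρ : ℝ} (h : ρ' ≤ ρ) : strip ρ' ⊆ strip ρ :=
  fun _ hθ => lt_of_lt_of_le hθ h

theorem dom_mono {ρ' ρ : ℝ} (h : ρ' ≤ ρ) (W : Set ℂ) : dom ρ' W ⊆ dom ρ W :=
  closure_mono (prod_mono (strip_mono h) Subset.rfl)

theorem ev_of_mem {ρ : ℝ} {W : Set ℂ} (f : dom ρ W →ᵇ ℂ) {p : ℂ × ℂ} (h : p ∈ dom ρ W) :
    ev f p = f ⟨p, h⟩ := by
  simp only [ev, dif_pos h]

theorem ev_zero {ρ : ℝ} {W : Set ℂ} : ev (0 : dom ρ W →ᵇ ℂ) = 0 := by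
  funext p
  by_cases h : p ∈ dom ρ W <;> simp [ev, h]

theorem ev_add {ρ : ℝ} {W : Set ℂ} (f g : dom ρ W →ᵇ ℂ) : ev (f + g) = ev f + ev g := by
  funext p
  by_cases h : p ∈ dom ρ W <;> simp [ev, h]

theorem ev_smul {ρ : ℝ} {W : Set ℂ} (c : ℝ) (f : dom ρ W →ᵇ ℂ) :
    ev (c • f) = fun p => (c : ℂ) * ev f p := by
  funext p
  by_cases h : p ∈ dom ρ W <;> simp [ev, h]

/-- The space of maps `f(θ, z)` that are holomorphic in `𝔹_ρ × W`, continuous (and bounded) on the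
closure, real on real arguments and `1`-periodic in `θ`. It is a real normed space for the
supremum norm. -/
def 𝓑 (ρ : ℝ) (W : Set ℂ) : Submodule ℝ (dom ρ W →ᵇ ℂ) where
  carrier := {f | DifferentiableOn ℂ (ev f) (strip ρ ×ˢ W) ∧
    (∀ θ x : ℝ, (x : ℂ) ∈ W → (ev f ((θ : ℂ), (x : ℂ))).im = 0) ∧
    ∀ θ ∈ strip ρ, ∀ z ∈ W, ev f (θ + 1, z) = ev f (θ, z)}
  zero_mem' := by
    refine ⟨?_, ?_, ?_⟩
    · rw [ev_zero]
      exact differentiableOn_const 0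
    · intro θ x _
      simp [ev_zero]
    · intro θ _ z _
      simp [ev_zero]
  add_mem' := by
    rintro f g ⟨hf, hf', hf''⟩ ⟨hg, hg', hg''⟩
    refine ⟨?_, ?_, ?_⟩
    · rw [ev_add]
      exact hf.add hg
    · intro θ x hx
      simp [ev_add, hf' θ x hx, hg' θ x hx]
    · intro θ hθ z hz
      simp [ev_add, hf'' θ hθ z hz, hg'' θ hθ z hz]
  smul_mem' := by
    rintro c f ⟨hf, hf', hf''⟩
    refine ⟨?_, ?_, ?_⟩
    · rw [ev_smul]
      exact hf.const_mul _
    · intro θ x hx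
      simp [ev_smul, hf' θ x hx]
    · intro θ hθ z hz
      simp [ev_smul, hf'' θ hθ z hz]

/-- Restriction of a map to a narrower band. -/
def restrict {ρ' ρ : ℝ} {W : Set ℂ} (h : ρ' ≤ ρ) (f : 𝓑 ρ W) : 𝓑 ρ' W :=
  ⟨(f : dom ρ W →ᵇ ℂ).compContinuous ⟨inclusion (dom_mono h W), continuous_inclusion _⟩, by
    have key : ∀ p ∈ dom ρ' W,
        ev ((f : dom ρ W →ᵇ ℂ).compContinuous
          ⟨inclusion (dom_mono h W), continuous_inclusion _⟩) p = ev (f : dom ρ W →ᵇ ℂ) p := by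
      intro p hp
      rw [ev_of_mem _ hp, ev_of_mem _ (dom_mono h W hp)]
      rfl
    obtain ⟨h1, h2, h3⟩ := f.2
    have hsub : strip ρ' ×ˢ W ⊆ strip ρ ×ˢ W := prod_mono (strip_mono h) Subset.rfl
    refine ⟨?_, ?_, ?_⟩
    · exact (h1.mono hsub).congr fun p hp => key p (strip_prod_subset_dom hp)
    · intro θ x hx
      by_cases hp : ((θ : ℂ), (x : ℂ)) ∈ dom ρ' W
      · rw [key _ hp]
        exact h2 θ x hx
      · simp [ev, hp]
    · intro θ hθ z hz
      have hθ' : θ + 1 ∈ strip ρ' := by simpa [strip] using hθ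
      rw [key (θ, z) (strip_prod_subset_dom ⟨hθ, hz⟩),
        key (θ + 1, z) (strip_prod_subset_dom ⟨hθ', hz⟩)]
      exact h3 θ (strip_mono h hθ) z hz⟩

/-- The Diophantine numbers. -/
def IsDiophantine (ω : ℝ) : Prop :=
  ∃ γ τ : ℝ, 0 < γ ∧ 1 ≤ τ ∧
    ∀ p q : ℤ, q ≠ 0 → γ / |(q : ℝ)| ^ τ ≤ |(q : ℝ) * ω - (p : ℝ)|

/-- The second component `f^k(θ, z)` of the `k`-th iterate of
`(θ, z) ↦ (θ + ω, f(θ, z))`: `f^{k+1}(θ, z) = f(θ + k ω, f^k(θ, z))`. -/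
def iter {ρ : ℝ} {W : Set ℂ} (f : 𝓑 ρ W) (ω : ℝ) : ℕ → ℂ → ℂ → ℂ
  | 0, _, z => z
  | k + 1, θ, z => ev (f : dom ρ W →ᵇ ℂ) (θ + (k : ℂ) * (ω : ℂ), iter f ω k θ z)

/-- `D_x f^{2^n}(θ, z)`. -/
def slope {ρ : ℝ} {W : Set ℂ} (f : 𝓑 ρ W) (ω : ℝ) (n : ℕ) (θ z : ℂ) : ℂ :=
  deriv (fun w => iter f ω (2 ^ n) θ w) z

/-- `∫_0^1 ln |a(θ)| dθ` with `ln 0 = -∞`, as an extended real number: the integral of the positive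
part minus the integral of the negative part. -/
def logIntegral (a : ℝ → ℂ) : EReal :=
  ((∫⁻ θ in Icc (0 : ℝ) 1, (ENNReal.log ‖a θ‖ₑ).toENNReal : ℝ≥0∞) : EReal) -
    ((∫⁻ θ in Icc (0 : ℝ) 1, (-ENNReal.log ‖a θ‖ₑ).toENNReal : ℝ≥0∞) : EReal)

/-- `x ∈ RH(𝔹_ρ, W)` is a `2^n`-periodic curve of `f` (all of whose iterates are in the domain
of `f`) with Lyapunov exponent less than `-K₀`. -/
structure IsAttractingCurve {ρ : ℝ} {W : Set ℂ} (K₀ ω : ℝ) (n : ℕ) (f : 𝓑 ρ W) (x : ℂ → ℂ) :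
    Prop where
  continuousOn : ContinuousOn x (closure (strip ρ))
  differentiableOn : DifferentiableOn ℂ x (strip ρ)
  real : ∀ θ : ℝ, (x θ).im = 0
  periodic : ∀ θ ∈ strip ρ, x (θ + 1) = x θ
  mem : ∀ θ ∈ strip ρ, ∀ j : ℕ, j < 2 ^ n → iter f ω j θ (x θ) ∈ W
  invariant : ∀ θ ∈ strip ρ, x (θ + 2 ^ n * (ω : ℂ)) = iter f ω (2 ^ n) θ (x θ)
  exponent : logIntegral (fun θ : ℝ => slope f ω n θ (x θ)) < ((-K₀ : ℝ) : EReal)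

/-- The minimum over `θ ∈ ℝ/ℤ` of `D_x f^{2^n}(θ, x(θ))` is `0`. -/
def MinSlopeZero {ρ : ℝ} {W : Set ℂ} (ω : ℝ) (n : ℕ) (f : 𝓑 ρ W) (x : ℂ → ℂ) : Prop :=
  IsLeast (range fun θ : ℝ => (slope f ω n θ (x θ)).re) 0

/-- The maximum over `θ ∈ ℝ/ℤ` of `D_x f^{2^n}(θ, x(θ))` is `0`. -/
def MaxSlopeZero {ρ : ℝ} {W : Set ℂ} (ω : ℝ) (n : ℕ) (f : 𝓑 ρ W) (x : ℂ → ℂ) : Prop :=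
  IsGreatest (range fun θ : ℝ => (slope f ω n θ (x θ)).re) 0

/-- The set `Υ_n^+(ω)`. -/
def UpsilonPlus (ρ : ℝ) (W : Set ℂ) (K₀ ω : ℝ) (n : ℕ) : Set (𝓑 ρ W) :=
  {f | ∃ x : ℂ → ℂ, IsAttractingCurve K₀ ω n f x ∧ MinSlopeZero ω n f x}

/-- The set `Υ_n^-(ω)`. -/
def UpsilonMinus (ρ : ℝ) (W : Set ℂ) (K₀ ω : ℝ) (n : ℕ) : Set (𝓑 ρ W) :=
  {f | ∃ x : ℂ → ℂ, IsAttractingCurve K₀ ω n f x ∧ MaxSlopeZero ω n f x}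

/-- The part of `Υ_n^+(ω)` given by curves at uniform distance less than `ε` from `x`. -/
def UpsilonPlusNear (ρ : ℝ) (W : Set ℂ) (K₀ ω : ℝ) (n : ℕ) (x : ℂ → ℂ) (ε : ℝ) : Set (𝓑 ρ W) :=
  {f | ∃ y : ℂ → ℂ, IsAttractingCurve K₀ ω n f y ∧ MinSlopeZero ω n f y ∧
    ∃ ε' < ε, ∀ θ ∈ strip ρ, ‖y θ - x θ‖ ≤ ε'}

/-- The part of `Υ_n^-(ω)` given by curves at uniform distance less than `ε` from `x`. -/
def UpsilonMinusNear (ρ : ℝ) (W : Set ℂ) (K₀ ω : ℝ) (n : ℕ) (x : ℂ → ℂ) (ε : ℝ) : Set (𝓑 ρ W) :=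
  {f | ∃ y : ℂ → ℂ, IsAttractingCurve K₀ ω n f y ∧ MaxSlopeZero ω n f y ∧
    ∃ ε' < ε, ∀ θ ∈ strip ρ, ‖y θ - x θ‖ ≤ ε'}

/-- A real analytic `2^n`-periodic curve `y : ℝ/ℤ → ℝ` of `f` in the closure of `W`. -/
structure IsRealPeriodicCurve {ρ : ℝ} {W : Set ℂ} (ω : ℝ) (n : ℕ) (f : 𝓑 ρ W) (y : ℝ → ℝ) :
    Prop where
  analytic : AnalyticOnNhd ℝ y univ
  periodic : ∀ θ, y (θ + 1) = y θ
  mem : ∀ θ : ℝ, ∀ j : ℕ, j < 2 ^ n → iter f ω j θ (y θ) ∈ closure W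
  invariant : ∀ θ : ℝ, ((y (θ + 2 ^ n * ω) : ℝ) : ℂ) = iter f ω (2 ^ n) θ (y θ)

/-- Up to replacing it by its images under the dynamics, `x` is the only `2^n`-periodic curve `y`
of `f` with `P y`; here a curve whose iterates reach the boundary of `W`, where `D_x f` need not
exist, counts as another one. -/
def IsOnlyCurve {ρ : ℝ} {W : Set ℂ} (ω : ℝ) (n : ℕ) (f : 𝓑 ρ W) (x : ℂ → ℂ)
    (P : (ℂ → ℂ) → Prop) : Prop :=
  ∀ y : ℝ → ℝ, IsRealPeriodicCurve ω n f y →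
    (∃ j : ℕ, j < 2 ^ n ∧ ∀ θ : ℝ, ((y (θ + j * ω) : ℝ) : ℂ) = iter f ω j θ (x θ)) ∨
    ((∀ θ : ℝ, ∀ j : ℕ, j < 2 ^ n → iter f ω j θ (y θ) ∈ W) ∧ ¬ P fun θ => (y θ.re : ℂ))

/-- The Lyapunov exponent of the curve `x` is at most `-K₀`. -/
def ExponentLe {ρ : ℝ} {W : Set ℂ} (K₀ ω : ℝ) (n : ℕ) (f : 𝓑 ρ W) (x : ℂ → ℂ) : Prop :=
  logIntegral (fun θ : ℝ => slope f ω n θ (x θ)) ≤ ((-K₀ : ℝ) : EReal)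

/-- The `1`-periodic function `a` has a unique absolute minimum in `ℝ/ℤ`, and this minimum is
non-degenerate. -/
def HasUniqueNondegMin (a : ℝ → ℝ) : Prop :=
  ∃ θ₀ : ℝ, (∀ θ, a θ₀ ≤ a θ) ∧ (∀ θ, a θ = a θ₀ → ∃ k : ℤ, θ = θ₀ + k) ∧
    0 < iteratedDeriv 2 a θ₀

/-- The `1`-periodic function `a` has a unique absolute maximum in `ℝ/ℤ`, and this maximum is
non-degenerate. -/
def HasUniqueNondegMax (a : ℝ → ℝ) : Prop :=
  ∃ θ₀ : ℝ, (∀ θ, a θ ≤ a θ₀) ∧ (∀ θ, a θ = a θ₀ → ∃ k : ℤ, θ = θ₀ + k) ∧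
    iteratedDeriv 2 a θ₀ < 0

/-- The point `p` belongs to `S` and, in a neighbourhood of `p`, the set `S` is a smooth submanifold
of codimension one: the zero set of a smooth real function with nowhere vanishing differential. -/
def IsCodimOneManifoldNear {E : Type*} [NormedAddCommGroup E] [NormedSpace ℝ E]
    (S : Set E) (p : E) : Prop :=
  p ∈ S ∧ ∃ U : Set E, IsOpen U ∧ p ∈ U ∧ ∃ Φ : E → ℝ,
    ContDiffOn ℝ ((⊤ : ℕ∞) : WithTop ℕ∞) Φ U ∧ (∀ g ∈ U, fderiv ℝ Φ g ≠ 0) ∧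
    S ∩ U = {g ∈ U | Φ g = 0}

end QPForced

end

open Set MeasureTheory
open scoped ENNReal BoundedContinuousFunction

noncomputable section

namespace QPForced

/-! Curves on the closed band form a real Banach algebra `RH σ`. With N = 2^n, invariance of a curve
y under g^N is the equation g^N(θ, y(θ)) - y(θ + Nω) = 0 (`defect`). It is analytic in (g, y):
composition is linear in g and, by Cauchy's estimates, a convergent power series in y
(`analyticOnNhd_comp`). Its derivative in y at a solution is η ↦ aη - η(· + Nω), where a is the
multiplier, that is, D_x g^N along the curve. A Neumann series inverts it as soon as some product of
translates of a along the rotation has modulus at most q < 1 on the band.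

The Lyapunov exponent provides such a product. Since ω is irrational, Birkhoff averages converge
uniformly, so the product of m translates is at most exp(-mK₀) on the real axis for large m; off the
axis it is at most M^m. Hadamard's three lines theorem interpolates, and contraction survives on
bands whose width depends only on K₀, r and M (`contracting_of_logIntegral`). The implicit function
theorem then gives a locally unique invariant curve X(g), analytic in g (`exists_isLocalCurve`).

Next, "the extremum of the multiplier is 0" becomes one scalar equation. By uniqueness and
non-degeneracy it means a double zero near θ₀ (`eventually_isLeast_iff`). The multiplier is a
product of factors, one along each curve of the orbit, and some factor A vanishes at θ₀; let B be
the product of the others. A double zero is equivalent to A = 0 together with ∂A = 0, or with B = 0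
if B vanishes at θ₀ as well. The second equation is solved for the position of the zero, and
inserting it into A gives Φ. To see dΦ ≠ 0, f is perturbed by a map vanishing on the whole orbit, to
second order except on one curve: this keeps the curve and changes just the factor A. At θ₀ the
change is nonzero because the orbit curves there do not meet: a crossing would produce a second zero
of the multiplier, at a translate of θ₀ by a nonzero multiple of ω.

For the second claim, suppose maps g → f have attracting curves y with extremum 0 while X(g) does
not have extremum 0. By Montel compactness the y converge on a narrower band to an invariant curve
of f. If that curve satisfies the conditions over W, it contradicts the assumption on x; that the
exponent stays at most -K₀ in the limit is a lower semicontinuity statement, obtained from convexity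
of the mean of log|φ| across lines (`logIntegral_le_of_tendsto`). If it is an iterate of x, then y
is an iterate of X(g) by local uniqueness, and a sign argument (`eventually_isLeast_of_rotated`)
transfers extremum 0 from y to X(g). -/

open Filter Metric
open scoped Topology

/-! ### Geometry of horizontal bands. -/

section Strip

variable {σ : ℝ}

theorem isOpen_strip (σ : ℝ) : IsOpen (strip σ) :=
  isOpen_lt (continuous_abs.comp Complex.continuous_im) continuous_const

theorem ofReal_mem_strip (hσ : 0 < σ) (t : ℝ) : (t : ℂ) ∈ strip σ := by
  simpa [strip] using hσ

theorem add_ofReal_mem_strip {θ : ℂ} (h : θ ∈ strip σ) (c : ℝ) : θ + c ∈ strip σ := by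
  simpa [strip] using h

theorem sub_ofReal_mem_strip {θ : ℂ} (h : θ ∈ strip σ) (c : ℝ) : θ - c ∈ strip σ := by
  simpa [strip] using h

theorem closure_strip_subset (σ : ℝ) : closure (strip σ) ⊆ {θ | |θ.im| ≤ σ} :=
  closure_minimal (fun θ (h : |θ.im| < σ) => h.le)
    (isClosed_le (continuous_abs.comp Complex.continuous_im) continuous_const)

theorem closure_strip_subset_strip {σ ρ : ℝ} (h : σ < ρ) : closure (strip σ) ⊆ strip ρ :=
  fun _ hθ => lt_of_le_of_lt (closure_strip_subset σ hθ) h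

theorem add_ofReal_mem_closure_strip {θ : ℂ} (h : θ ∈ closure (strip σ)) (c : ℝ) :
    θ + c ∈ closure (strip σ) :=
  map_mem_closure (f := fun w : ℂ => w + c) (by fun_prop) h
    fun _ hw => add_ofReal_mem_strip hw c

theorem sub_ofReal_mem_closure_strip {θ : ℂ} (h : θ ∈ closure (strip σ)) (c : ℝ) :
    θ - c ∈ closure (strip σ) := by
  simpa [sub_eq_add_neg] using add_ofReal_mem_closure_strip h (-c)

theorem convex_strip (σ : ℝ) : Convex ℝ (strip σ) := by
  have : strip σ = Complex.imCLM ⁻¹' (Ioo (-σ) σ) := by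
    ext θ
    simp [strip, abs_lt]
  rw [this]
  exact (convex_Ioo _ _).is_linear_preimage Complex.imCLM.isLinear

theorem ball_subset_strip {θ : ℂ} {R : ℝ} (h : |θ.im| + R ≤ σ) : ball θ R ⊆ strip σ := by
  intro w hw
  have h1 : |(w - θ).im| ≤ ‖w - θ‖ := Complex.abs_im_le_norm _
  have h2 : ‖w - θ‖ < R := by simpa [dist_eq_norm] using hw
  have h3 : |w.im| ≤ |(w - θ).im| + |θ.im| := by
    have : w.im = (w - θ).im + θ.im := by simp
    rw [this]
    exact abs_add_le _ _
  have : |w.im| < σ := by linarith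
  exact this

end Strip

/-! ### The real Banach algebra of curves on a closed band. -/

section Curves

variable {σ : ℝ}

open Classical in
/-- A function on the closed band, extended by `0` to `ℂ`. -/
def extend (φ : closure (strip σ) →ᵇ ℂ) (θ : ℂ) : ℂ :=
  if h : θ ∈ closure (strip σ) then φ ⟨θ, h⟩ else 0

theorem extend_of_mem (φ : closure (strip σ) →ᵇ ℂ) {θ : ℂ} (h : θ ∈ closure (strip σ)) :
    extend φ θ = φ ⟨θ, h⟩ := by
  simp only [extend, dif_pos h]

theorem extend_of_notMem (φ : closure (strip σ) →ᵇ ℂ) {θ : ℂ} (h : θ ∉ closure (strip σ)) :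
    extend φ θ = 0 := by
  simp only [extend, dif_neg h]

theorem extend_add (φ ψ : closure (strip σ) →ᵇ ℂ) : extend (φ + ψ) = extend φ + extend ψ := by
  funext θ
  by_cases h : θ ∈ closure (strip σ) <;> simp [extend, h]

theorem extend_mul (φ ψ : closure (strip σ) →ᵇ ℂ) : extend (φ * ψ) = extend φ * extend ψ := by
  funext θ
  by_cases h : θ ∈ closure (strip σ) <;> simp [extend, h]

/-- The algebra of functions on the closed band that are holomorphic in the band, real on the real
axis and `1`-periodic. -/
def rhSubalgebra (σ : ℝ) : Subalgebra ℝ (closure (strip σ) →ᵇ ℂ) where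
  carrier := {φ | DifferentiableOn ℂ (extend φ) (strip σ) ∧ (∀ t : ℝ, (extend φ t).im = 0) ∧
    ∀ θ ∈ strip σ, extend φ (θ + 1) = extend φ θ}
  add_mem' := by
    rintro φ ψ ⟨h1, h2, h3⟩ ⟨k1, k2, k3⟩
    refine ⟨?_, ?_, ?_⟩
    · rw [extend_add]
      exact h1.add k1
    · intro t
      simp [extend_add, h2, k2]
    · intro θ hθ
      simp [extend_add, h3 θ hθ, k3 θ hθ]
  mul_mem' := by
    rintro φ ψ ⟨h1, h2, h3⟩ ⟨k1, k2, k3⟩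
    refine ⟨?_, ?_, ?_⟩
    · rw [extend_mul]
      exact h1.mul k1
    · intro t
      simp [extend_mul, h2, k2]
    · intro θ hθ
      simp [extend_mul, h3 θ hθ, k3 θ hθ]
  algebraMap_mem' := by
    intro c
    have key : ∀ θ ∈ closure (strip σ),
        extend (algebraMap ℝ (closure (strip σ) →ᵇ ℂ) c) θ = c := by
      intro θ hθ
      rw [extend_of_mem _ hθ]
      rfl
    refine ⟨?_, ?_, ?_⟩
    · exact (differentiableOn_const (c : ℂ)).congr fun θ hθ => key θ (subset_closure hθ)
    · intro t
      by_cases ht : (t : ℂ) ∈ closure (strip σ)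
      · rw [key _ ht]
        simp
      · rw [extend_of_notMem _ ht]
        simp
    · intro θ hθ
      rw [key _ (subset_closure hθ), key]
      simpa using subset_closure (add_ofReal_mem_strip hθ 1)

/-- The Banach algebra of curves on the closed band. -/
def RH (σ : ℝ) : Type := rhSubalgebra σ

instance : NormedCommRing (RH σ) := inferInstanceAs (NormedCommRing (rhSubalgebra σ))

instance : NormedAlgebra ℝ (RH σ) := inferInstanceAs (NormedAlgebra ℝ (rhSubalgebra σ))

instance : CoeFun (RH σ) (fun _ => ℂ → ℂ) := ⟨fun φ => extend φ.1⟩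

namespace RH

theorem differentiableOn (φ : RH σ) : DifferentiableOn ℂ φ (strip σ) := φ.2.1

theorem im_eq_zero (φ : RH σ) (t : ℝ) : (φ t).im = 0 := φ.2.2.1 t

/-- Periodicity is imposed on the open band only; density and continuity carry it to the closed
band. -/
theorem apply_add_one (φ : RH σ) {θ : ℂ} (hθ : θ ∈ closure (strip σ)) : φ (θ + 1) = φ θ := by
  have hc : Continuous fun w : closure (strip σ) => φ.1 w := φ.1.continuous
  let T : closure (strip σ) → closure (strip σ) := fun w =>
    ⟨w + 1, by simpa using add_ofReal_mem_closure_strip w.2 1⟩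
  have hT : Continuous T := by fun_prop
  have hcl : IsClosed {w : closure (strip σ) | φ.1 (T w) = φ.1 w} :=
    isClosed_eq (hc.comp hT) hc
  have hd : Dense {w : closure (strip σ) | (w : ℂ) ∈ strip σ} := by
    intro w
    rw [closure_subtype]
    refine closure_mono ?_ w.2
    intro z hz
    exact ⟨⟨z, subset_closure hz⟩, hz, rfl⟩
  have hsub : {w : closure (strip σ) | (w : ℂ) ∈ strip σ} ⊆ {w | φ.1 (T w) = φ.1 w} := by
    intro w hw
    have := φ.2.2.2 w hw
    rw [extend_of_mem _ w.2, extend_of_mem _ (T w).2] at this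
    exact this
  have h := hcl.closure_subset_iff.2 hsub (hd ⟨θ, hθ⟩)
  rw [extend_of_mem _ hθ, extend_of_mem _ (T ⟨θ, hθ⟩).2]
  exact h

theorem continuousOn (φ : RH σ) : ContinuousOn φ (closure (strip σ)) := by
  rw [continuousOn_iff_continuous_domRestrict]
  refine φ.1.continuous.congr fun w => ?_
  rw [domRestrict_apply, extend_of_mem _ w.2]

theorem norm_apply_le (φ : RH σ) (θ : ℂ) : ‖φ θ‖ ≤ ‖φ‖ := by
  by_cases h : θ ∈ closure (strip σ)
  · rw [extend_of_mem _ h]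
    exact φ.1.norm_coe_le_norm _
  · rw [extend_of_notMem _ h]
    simp

theorem norm_le_of_forall {φ : RH σ} {K : ℝ} (hK : 0 ≤ K) (h : ∀ θ ∈ strip σ, ‖φ θ‖ ≤ K) :
    ‖φ‖ ≤ K := by
  refine (BoundedContinuousFunction.norm_le hK).2 fun w => ?_
  have := le_on_closure (s := strip σ) (f := fun θ => ‖φ θ‖) (g := fun _ => K) h
    φ.continuousOn.norm continuousOn_const w.2
  rwa [extend_of_mem _ w.2] at this

theorem ext_of_strip {φ ψ : RH σ} (h : ∀ θ ∈ strip σ, φ θ = ψ θ) : φ = ψ := by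
  apply Subtype.ext
  ext w
  have h2 : ∀ θ ∈ closure (strip σ), ‖φ θ - ψ θ‖ ≤ 0 := fun θ hθ =>
    le_on_closure (s := strip σ) (f := fun θ => ‖φ θ - ψ θ‖) (g := fun _ => 0)
      (fun θ hθ => by simp [h θ hθ]) (φ.continuousOn.sub ψ.continuousOn).norm continuousOn_const hθ
  have h3 := sub_eq_zero.1 (norm_le_zero_iff.1 (h2 w w.2))
  rwa [extend_of_mem _ w.2, extend_of_mem _ w.2] at h3

@[simp] theorem add_apply (φ ψ : RH σ) (θ : ℂ) : (φ + ψ) θ = φ θ + ψ θ :=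
  congrFun (extend_add φ.1 ψ.1) θ

@[simp] theorem mul_apply (φ ψ : RH σ) (θ : ℂ) : (φ * ψ) θ = φ θ * ψ θ :=
  congrFun (extend_mul φ.1 ψ.1) θ

@[simp] theorem smul_apply (c : ℝ) (φ : RH σ) (θ : ℂ) : (c • φ) θ = c * φ θ := by
  change extend (c • φ.1) θ = c * extend φ.1 θ
  by_cases h : θ ∈ closure (strip σ) <;> simp [extend, h]

@[simp] theorem zero_apply (θ : ℂ) : (0 : RH σ) θ = 0 := by
  change extend (0 : closure (strip σ) →ᵇ ℂ) θ = 0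
  by_cases h : θ ∈ closure (strip σ) <;> simp [extend, h]

theorem one_apply {θ : ℂ} (h : θ ∈ closure (strip σ)) : (1 : RH σ) θ = 1 := by
  change extend (1 : closure (strip σ) →ᵇ ℂ) θ = 1
  simp [extend, h]

/-- Evaluation at a point. -/
def eval (θ : ℂ) : RH σ →L[ℝ] ℂ :=
  LinearMap.mkContinuous
    { toFun := fun φ => φ θ
      map_add' := fun φ ψ => add_apply φ ψ θ
      map_smul' := fun c φ => by simp } 1 fun φ => by
      rw [one_mul]
      exact norm_apply_le φ θ

@[simp] theorem sub_apply (φ ψ : RH σ) (θ : ℂ) : (φ - ψ) θ = φ θ - ψ θ :=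
  (eval θ).map_sub φ ψ

theorem pow_apply (φ : RH σ) (k : ℕ) {θ : ℂ} (h : θ ∈ closure (strip σ)) :
    (φ ^ k) θ = φ θ ^ k := by
  induction k with
  | zero => simpa using one_apply h
  | succ k ih => rw [pow_succ, mul_apply, ih, pow_succ]

theorem prod_apply {ι : Type*} (s : Finset ι) (φ : ι → RH σ) {θ : ℂ}
    (h : θ ∈ closure (strip σ)) : (∏ i ∈ s, φ i) θ = ∏ i ∈ s, φ i θ := by
  classical
  induction s using Finset.induction_on with
  | empty => simpa using one_apply h
  | insert i s hi ih => rw [Finset.prod_insert hi, Finset.prod_insert hi, mul_apply, ih]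

theorem exists_of (hσ : 0 < σ) {u : ℂ → ℂ} {K : ℝ} (hc : ContinuousOn u (closure (strip σ)))
    (hd : DifferentiableOn ℂ u (strip σ)) (hr : ∀ t : ℝ, (u t).im = 0)
    (hp : ∀ θ ∈ strip σ, u (θ + 1) = u θ) (hK : ∀ θ ∈ strip σ, ‖u θ‖ ≤ K) :
    ∃ φ : RH σ, ∀ θ ∈ closure (strip σ), φ θ = u θ := by
  have hb : ∀ θ ∈ closure (strip σ), ‖u θ‖ ≤ K := fun θ hθ =>
    le_on_closure (f := fun θ => ‖u θ‖) (g := fun _ => K) hK hc.norm continuousOn_const hθ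
  let φ : closure (strip σ) →ᵇ ℂ := BoundedContinuousFunction.ofNormedAddCommGroup
    (fun w => u w) (continuousOn_iff_continuous_domRestrict.1 hc) K fun w => hb w w.2
  have key : ∀ θ ∈ closure (strip σ), extend φ θ = u θ := fun θ hθ => by
    rw [extend_of_mem _ hθ]
    rfl
  refine ⟨⟨φ, ?_, ?_, ?_⟩, key⟩
  · exact hd.congr fun θ hθ => key θ (subset_closure hθ)
  · intro t
    rw [key _ (subset_closure (ofReal_mem_strip hσ t)), hr]
  · intro θ hθ
    rw [key _ (subset_closure hθ), key, hp θ hθ]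
    simpa using subset_closure (add_ofReal_mem_strip hθ 1)

/-- Uniform limits of holomorphic functions are holomorphic. The resulting completeness is needed
for the Neumann series and for limits of difference quotients. -/
theorem isClosed (σ : ℝ) : IsClosed (rhSubalgebra σ : Set (closure (strip σ) →ᵇ ℂ)) := by
  refine isClosed_of_closure_subset fun φ hφ => ?_
  obtain ⟨u, hu, hlim⟩ := mem_closure_iff_seq_limit.1 hφ
  have hunif : TendstoUniformly (fun n => extend (u n)) (extend φ) atTop := by
    rw [Metric.tendstoUniformly_iff]
    intro ε hε
    filter_upwards [(Metric.tendsto_nhds.1 hlim) ε hε] with n hn θ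
    by_cases h : θ ∈ closure (strip σ)
    · rw [extend_of_mem _ h, extend_of_mem _ h, dist_comm]
      exact lt_of_le_of_lt (BoundedContinuousFunction.dist_coe_le_dist _) hn
    · simpa [extend_of_notMem _ h] using hε
  have hpt : ∀ θ, Tendsto (fun n => extend (u n) θ) atTop (𝓝 (extend φ θ)) := fun θ =>
    hunif.tendsto_at θ
  refine ⟨?_, ?_, ?_⟩
  · exact hunif.tendstoUniformlyOn.tendstoLocallyUniformlyOn.differentiableOn
      (Eventually.of_forall fun n => (hu n).1) (isOpen_strip σ)
  · intro t
    refine tendsto_nhds_unique ((Complex.continuous_im.tendsto _).comp (hpt t)) ?_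
    simp only [Function.comp_def, (hu _).2.1 t]
    exact tendsto_const_nhds
  · intro θ hθ
    refine tendsto_nhds_unique (hpt (θ + 1)) ?_
    simp only [(hu _).2.2 θ hθ]
    exact hpt θ

instance : CompleteSpace (RH σ) := (isClosed σ).completeSpace_coe

/-- Translation by a real number. -/
def tr (c : ℝ) : RH σ →L[ℝ] RH σ := by
  let T : C(closure (strip σ), closure (strip σ)) :=
    ⟨fun w => ⟨w + c, add_ofReal_mem_closure_strip w.2 c⟩, by fun_prop⟩
  have key : ∀ (φ : RH σ) (θ : ℂ), extend (φ.1.compContinuous T) θ = φ (θ + c) := by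
    intro φ θ
    by_cases h : θ ∈ closure (strip σ)
    · rw [extend_of_mem _ h, extend_of_mem _ (add_ofReal_mem_closure_strip h c)]
      rfl
    · rw [extend_of_notMem _ h, extend_of_notMem]
      intro h'
      exact h (by simpa using sub_ofReal_mem_closure_strip h' c)
  refine LinearMap.mkContinuous
    { toFun := fun φ => ⟨φ.1.compContinuous T, ?_, ?_, ?_⟩
      map_add' := fun φ ψ => rfl
      map_smul' := fun r φ => rfl } 1 fun φ => ?_
  · have : extend (φ.1.compContinuous T) = fun θ => φ (θ + c) := funext (key φ)
    rw [this]
    exact φ.differentiableOn.comp (by fun_prop) fun θ hθ => add_ofReal_mem_strip hθ c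
  · intro t
    rw [key]
    simpa using φ.im_eq_zero (t + c)
  · intro θ hθ
    rw [key, key, add_right_comm]
    exact φ.apply_add_one (subset_closure (add_ofReal_mem_strip hθ c))
  · rw [one_mul]
    exact (BoundedContinuousFunction.norm_le (norm_nonneg _)).2 fun w => φ.1.norm_coe_le_norm _

@[simp] theorem tr_apply (c : ℝ) (φ : RH σ) (θ : ℂ) : tr c φ θ = φ (θ + c) := by
  change extend (φ.1.compContinuous _) θ = φ (θ + c)
  by_cases h : θ ∈ closure (strip σ)
  · rw [extend_of_mem _ h, extend_of_mem _ (add_ofReal_mem_closure_strip h c)]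
    rfl
  · rw [extend_of_notMem _ h, extend_of_notMem]
    intro h'
    exact h (by simpa using sub_ofReal_mem_closure_strip h' c)

theorem tr_tr (c d : ℝ) (φ : RH σ) : tr c (tr d φ) = tr (c + d) φ :=
  ext_of_strip fun θ _ => by simp [add_assoc]

theorem tr_zero (φ : RH σ) : tr 0 φ = φ :=
  ext_of_strip fun θ _ => by simp

theorem ofReal_re_apply (φ : RH σ) (t : ℝ) : (((φ t).re : ℝ) : ℂ) = φ t :=
  Complex.ext (by simp) (by simp [φ.im_eq_zero t])

end RH

end Curves

/-! ### Power series in a Banach algebra. -/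

section PowerSeries

/-- The terms T_k(y^k) come from multilinear maps whose norms are controlled by ‖T_k‖. It is applied
with A = `RH σ` for composition and with A = ℝ for evaluation at real points. -/
theorem exists_analyticOnNhd_hasSum {A V : Type*} [NormedRing A] [NormedAlgebra ℝ A]
    [NormedAddCommGroup V] [NormedSpace ℝ V] [CompleteSpace V] (T : ℕ → A →L[ℝ] V) {R K : ℝ}
    (hR : 0 < R) (hT : ∀ k, ‖T k‖ * R ^ k ≤ K) :
    ∃ F : A → V, AnalyticOnNhd ℝ F (ball 0 R) ∧
      ∀ y ∈ ball (0 : A) R, HasSum (fun k => T k (y ^ k)) (F y) := by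
  let p : FormalMultilinearSeries ℝ A V := fun k =>
    (T k).compContinuousMultilinearMap (ContinuousMultilinearMap.mkPiAlgebraFin ℝ k A)
  have hK : 0 ≤ K := le_trans (by positivity) (hT 0)
  lift R to NNReal using hR.le
  have hrad : (R : ℝ≥0∞) ≤ p.radius := by
    refine p.le_radius_of_bound (K * max 1 ‖(1 : A)‖) fun k => ?_
    have h1 : ‖p k‖ ≤ ‖T k‖ * max 1 ‖(1 : A)‖ :=
      ((T k).norm_compContinuousMultilinearMap_le _).trans
        (mul_le_mul_of_nonneg_left ContinuousMultilinearMap.norm_mkPiAlgebraFin_le (norm_nonneg _))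
    calc ‖p k‖ * (R : ℝ) ^ k ≤ ‖T k‖ * max 1 ‖(1 : A)‖ * (R : ℝ) ^ k := by gcongr
      _ = (‖T k‖ * (R : ℝ) ^ k) * max 1 ‖(1 : A)‖ := by ring
      _ ≤ _ := by gcongr; exact hT k
  have hpos : 0 < p.radius := lt_of_lt_of_le (by exact_mod_cast hR) hrad
  have hF := p.hasFPowerSeriesOnBall hpos
  have hball : ball (0 : A) R ⊆ Metric.eball 0 p.radius := by
    rw [← Metric.eball_coe]
    exact Metric.eball_subset_eball hrad
  refine ⟨p.sum, hF.analyticOnNhd.mono hball, fun y hy => ?_⟩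
  have := hF.hasSum (hball hy)
  simpa [p, List.prod_ofFn] using this

end PowerSeries

/-! ### Cauchy estimates and the Weierstrass limit theorem. -/

section Cauchy

/-- The bound holds on an open ball, so Cauchy's estimate is used on the circle of half the radius;
hence the factor 2. -/
theorem norm_deriv_le_of_ball {q : ℂ → ℂ} {c : ℂ} {R K : ℝ} (hR : 0 < R)
    (hq : DifferentiableOn ℂ q (ball c R)) (hK : ∀ z ∈ ball c R, ‖q z‖ ≤ K) :
    ‖deriv q c‖ ≤ 2 * K / R := by
  have hsub : closedBall c (R / 2) ⊆ ball c R := closedBall_subset_ball (by linarith)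
  have := Complex.norm_deriv_le_of_forall_mem_sphere_norm_le (half_pos hR)
    (hq.diffContOnCl_ball hsub)
    fun z hz => hK z (hsub (sphere_subset_closedBall hz))
  calc ‖deriv q c‖ ≤ K / (R / 2) := this
    _ = 2 * K / R := by field_simp

/-- Two Cauchy estimates give |q'| ≤ 4K/R on the half ball and |q''| ≤ 32K/R² on the quarter ball;
the mean value inequality does the rest. -/
theorem norm_sub_sub_mul_deriv_le {q : ℂ → ℂ} {c : ℂ} {R K : ℝ} (hR : 0 < R)
    (hq : DifferentiableOn ℂ q (ball c R)) (hK : ∀ z ∈ ball c R, ‖q z‖ ≤ K) {s : ℂ}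
    (hs : ‖s‖ < R / 4) : ‖q (c + s) - q c - s * deriv q c‖ ≤ 32 * K / R ^ 2 * ‖s‖ ^ 2 := by
  have hK0 : 0 ≤ K := (norm_nonneg _).trans (hK c (mem_ball_self hR))
  have hd1 : ∀ z ∈ ball c (R / 2), ‖deriv q z‖ ≤ 4 * K / R := by
    intro z hz
    have hsub : ball z (R / 2) ⊆ ball c R := ball_subset_ball' (by
      have := mem_ball.1 hz
      linarith)
    have := norm_deriv_le_of_ball (half_pos hR) (hq.mono hsub) fun w hw => hK w (hsub hw)
    calc _ ≤ 2 * K / (R / 2) := this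
      _ = 4 * K / R := by field_simp; ring
  have hdq : DifferentiableOn ℂ (deriv q) (ball c R) := hq.deriv isOpen_ball
  have hd2 : ∀ z ∈ ball c (R / 4), ‖deriv (deriv q) z‖ ≤ 32 * K / R ^ 2 := by
    intro z hz
    have hsub : ball z (R / 4) ⊆ ball c (R / 2) := ball_subset_ball' (by
      have := mem_ball.1 hz
      linarith)
    have hsub' : ball c (R / 2) ⊆ ball c R := ball_subset_ball (by linarith)
    have := norm_deriv_le_of_ball (by positivity : 0 < R / 4) (hdq.mono (hsub.trans hsub'))
      fun w hw => hd1 w (hsub hw)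
    calc _ ≤ 2 * (4 * K / R) / (R / 4) := this
      _ = 32 * K / R ^ 2 := by field_simp; ring
  have hlip : ∀ z ∈ ball c (R / 4), ‖deriv q z - deriv q c‖ ≤ 32 * K / R ^ 2 * ‖z - c‖ := by
    intro z hz
    refine (convex_ball c (R / 4)).norm_image_sub_le_of_norm_deriv_le (𝕜 := ℂ) (f := deriv q)
      (fun w hw => hdq.differentiableAt (isOpen_ball.mem_nhds
        (ball_subset_ball (by linarith) hw))) hd2 (mem_ball_self (by positivity)) hz
  have hcl : closedBall c ‖s‖ ⊆ ball c (R / 4) := closedBall_subset_ball hs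
  have hcl' : closedBall c ‖s‖ ⊆ ball c R := hcl.trans (ball_subset_ball (by linarith))
  have key := (convex_closedBall c ‖s‖).norm_image_sub_le_of_norm_hasDerivWithin_le (𝕜 := ℂ)
    (f := fun z => q z - z * deriv q c) (f' := fun z => deriv q z - 1 * deriv q c)
    (C := 32 * K / R ^ 2 * ‖s‖) (x := c) (y := c + s)
    (fun z hz => ((hq.hasDerivAt (isOpen_ball.mem_nhds (hcl' hz))).sub
      ((hasDerivAt_id z).mul_const _)).hasDerivWithinAt)
    (fun z hz => by
      rw [one_mul]
      refine (hlip z (hcl hz)).trans ?_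
      have : ‖z - c‖ ≤ ‖s‖ := by simpa [dist_eq_norm] using hz
      gcongr) (mem_closedBall_self (norm_nonneg _)) (by simp)
  calc ‖q (c + s) - q c - s * deriv q c‖
      = ‖(q (c + s) - (c + s) * deriv q c) - (q c - c * deriv q c)‖ := by congr 1; ring
    _ ≤ 32 * K / R ^ 2 * ‖s‖ * ‖c + s - c‖ := key
    _ = _ := by rw [add_sub_cancel_left]; ring

/-- Restriction to the complex line c + tv reduces this to one variable. -/
theorem norm_fderiv_le_of_ball {E : Type*} [NormedAddCommGroup E] [NormedSpace ℂ E] {q : E → ℂ}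
    {c : E} {R K : ℝ} (hR : 0 < R) (hq : DifferentiableOn ℂ q (ball c R))
    (hK : ∀ z ∈ ball c R, ‖q z‖ ≤ K) : ‖fderiv ℂ q c‖ ≤ 2 * K / R := by
  have hK0 : 0 ≤ K := (norm_nonneg _).trans (hK c (mem_ball_self hR))
  refine ContinuousLinearMap.opNorm_le_bound _ (by positivity) fun v => ?_
  rcases eq_or_ne v 0 with rfl | hv
  · simp
  have hv' : 0 < ‖v‖ := norm_pos_iff.2 hv
  have hmaps : MapsTo (fun t : ℂ => c + t • v) (ball 0 (R / ‖v‖)) (ball c R) := by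
    intro t ht
    have h : ‖t‖ < R / ‖v‖ := by simpa using ht
    simpa [norm_smul] using (lt_div_iff₀ hv').1 h
  have hd : HasDerivAt (fun t : ℂ => q (c + t • v)) (fderiv ℂ q c v) 0 := by
    have h1 : HasDerivAt (fun t : ℂ => c + t • v) v 0 := by
      simpa using ((hasDerivAt_id (0 : ℂ)).smul_const v).const_add c
    have h2 : HasFDerivAt q (fderiv ℂ q c) (c + (0 : ℂ) • v) := by
      simpa using (hq.differentiableAt (isOpen_ball.mem_nhds (mem_ball_self hR))).hasFDerivAt
    exact h2.comp_hasDerivAt 0 h1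
  have := norm_deriv_le_of_ball (q := fun t : ℂ => q (c + t • v)) (div_pos hR hv')
    (hq.comp (by fun_prop) hmaps) fun t ht => hK _ (hmaps ht)
  rw [hd.deriv] at this
  calc _ ≤ 2 * K / (R / ‖v‖) := this
    _ = _ := by field_simp

/-- By Cauchy's estimate the derivatives form a uniform Cauchy sequence on smaller balls. This is
needed in two complex variables, for completeness of the space of maps. -/
theorem differentiableOn_of_tendstoUniformlyOn {E : Type*} [NormedAddCommGroup E]
    [NormedSpace ℂ E] {u : ℕ → E → ℂ} {q : E → ℂ} {s : Set E} (hs : IsOpen s)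
    (hu : ∀ n, DifferentiableOn ℂ (u n) s) (h : TendstoUniformlyOn u q atTop s) :
    DifferentiableOn ℂ q s := by
  intro p hp
  obtain ⟨R, hR, hRs⟩ := Metric.isOpen_iff.1 hs p hp
  have hsub : ∀ z ∈ ball p (R / 2), ball z (R / 2) ⊆ s := fun z hz =>
    (ball_subset_ball' (by have := mem_ball.1 hz; linarith)).trans hRs
  have hat : ∀ n, ∀ z ∈ ball p (R / 2), DifferentiableAt ℂ (u n) z := fun n z hz =>
    (hu n).differentiableAt (hs.mem_nhds (hsub z hz (mem_ball_self (half_pos hR))))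
  have hcau : UniformCauchySeqOn (fun n => fderiv ℂ (u n)) atTop (ball p (R / 2)) := by
    rw [Metric.uniformCauchySeqOn_iff]
    intro ε hε
    obtain ⟨N, hN⟩ := Metric.uniformCauchySeqOn_iff.1 h.uniformCauchySeqOn (ε * R / 8)
      (by positivity)
    refine ⟨N, fun m hm n hn z hz => ?_⟩
    rw [dist_eq_norm, ← fderiv_sub (hat m z hz) (hat n z hz)]
    have := norm_fderiv_le_of_ball (q := u m - u n) (half_pos hR)
      (((hu m).sub (hu n)).mono (hsub z hz)) (K := ε * R / 8) fun w hw => by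
        have := (hN m hm n hn w (hsub z hz hw)).le
        rwa [dist_eq_norm] at this
    calc _ ≤ 2 * (ε * R / 8) / (R / 2) := this
      _ = ε / 2 := by field_simp; ring
      _ < ε := by linarith
  have hlim : ∀ z, ∃ L, z ∈ ball p (R / 2) → Tendsto (fun n => fderiv ℂ (u n) z) atTop (𝓝 L) := by
    intro z
    by_cases hz : z ∈ ball p (R / 2)
    · obtain ⟨L, hL⟩ := cauchySeq_tendsto_of_complete (hcau.cauchySeq hz)
      exact ⟨L, fun _ => hL⟩
    · exact ⟨0, fun h => absurd h hz⟩
  choose L hL using hlim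
  exact (hasFDerivAt_of_tendstoUniformlyOn isOpen_ball
    (hcau.tendstoUniformlyOn_of_tendsto fun z hz => hL z hz)
    (fun n z hz => (hat n z hz).hasFDerivAt)
    (fun z hz => h.tendsto_at (hsub z hz (mem_ball_self (half_pos hR))))
    (mem_ball_self (half_pos hR))).differentiableAt.differentiableWithinAt

end Cauchy

/-! ### The Banach space of maps. -/

section MapSpace

variable {σ : ℝ} {W : Set ℂ}

/-- The space `𝓑 σ W`, as a type of its own. -/
def Maps (σ : ℝ) (W : Set ℂ) : Type := 𝓑 σ W

instance : NormedAddCommGroup (Maps σ W) := inferInstanceAs (NormedAddCommGroup (𝓑 σ W))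

instance : NormedSpace ℝ (Maps σ W) := inferInstanceAs (NormedSpace ℝ (𝓑 σ W))

theorem norm_ev_le (g : Maps σ W) (p : ℂ × ℂ) : ‖ev g.1 p‖ ≤ ‖g‖ := by
  by_cases h : p ∈ dom σ W
  · rw [ev_of_mem _ h]
    exact g.1.norm_coe_le_norm _
  · rw [ev, dif_neg h, norm_zero]
    exact norm_nonneg g

theorem dom_eq (σ : ℝ) (W : Set ℂ) : dom σ W = closure (strip σ) ×ˢ closure W :=
  closure_prod_eq

theorem continuousOn_ev (g : Maps σ W) : ContinuousOn (ev g.1) (dom σ W) := by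
  rw [continuousOn_iff_continuous_domRestrict]
  refine g.1.continuous.congr fun w => ?_
  rw [domRestrict_apply, ev_of_mem _ w.2]

theorem differentiableOn_ev (g : Maps σ W) :
    DifferentiableOn ℂ (ev g.1) (strip σ ×ˢ W) := g.2.1

theorem differentiableOn_ev_snd (g : Maps σ W) {θ : ℂ} (hθ : θ ∈ strip σ) :
    DifferentiableOn ℂ (fun z => ev g.1 (θ, z)) W :=
  (differentiableOn_ev g).comp (by fun_prop) fun _ hz => ⟨hθ, hz⟩

theorem ev_coe_add (f g : Maps σ W) (p : ℂ × ℂ) :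
    ev (f + g).1 p = ev f.1 p + ev g.1 p :=
  congrFun (ev_add f.1 g.1) p

theorem ev_coe_smul (c : ℝ) (g : Maps σ W) (p : ℂ × ℂ) :
    ev (c • g).1 p = c * ev g.1 p :=
  congrFun (ev_smul c g.1) p

theorem ev_coe_sub (f g : Maps σ W) (p : ℂ × ℂ) :
    ev (f - g).1 p = ev f.1 p - ev g.1 p := by
  have := ev_coe_add (f - g) g p
  rw [sub_add_cancel] at this
  rw [this, add_sub_cancel_right]

theorem completeSpace_maps (hW : IsOpen W) : CompleteSpace (Maps σ W) := by
  suffices h : IsClosed (𝓑 σ W : Set (dom σ W →ᵇ ℂ)) from h.completeSpace_coe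
  refine isClosed_of_closure_subset fun φ hφ => ?_
  obtain ⟨u, hu, hlim⟩ := mem_closure_iff_seq_limit.1 hφ
  have hunif : TendstoUniformly (fun n => ev (u n)) (ev φ) atTop := by
    rw [Metric.tendstoUniformly_iff]
    intro ε hε
    filter_upwards [(Metric.tendsto_nhds.1 hlim) ε hε] with n hn p
    by_cases h : p ∈ dom σ W
    · rw [ev_of_mem _ h, ev_of_mem _ h, dist_comm]
      exact lt_of_le_of_lt (BoundedContinuousFunction.dist_coe_le_dist _) hn
    · simpa [ev, h] using hε
  have hpt : ∀ p, Tendsto (fun n => ev (u n) p) atTop (𝓝 (ev φ p)) := fun p =>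
    hunif.tendsto_at p
  refine ⟨?_, ?_, ?_⟩
  · exact differentiableOn_of_tendstoUniformlyOn ((isOpen_strip σ).prod hW) (fun n => (hu n).1)
      hunif.tendstoUniformlyOn
  · intro t x hx
    refine tendsto_nhds_unique ((Complex.continuous_im.tendsto _).comp (hpt _)) ?_
    simp only [Function.comp_def, (hu _).2.1 t x hx]
    exact tendsto_const_nhds
  · intro θ hθ z hz
    refine tendsto_nhds_unique (hpt _) ?_
    simp only [(hu _).2.2 θ hθ z hz]
    exact hpt _

end MapSpace

/-! ### Holomorphic families of curves and their derivatives. -/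

section Family

variable {σ : ℝ}

/-- A holomorphic family `Q θ w`, `|w| < R`, of functions on the band, bounded by `K`, that belongs
to `RH σ` for real `w`. -/
structure IsFamily (σ R K : ℝ) (Q : ℂ → ℂ → ℂ) : Prop where
  diff : ∀ θ ∈ strip σ, DifferentiableOn ℂ (Q θ) (ball 0 R)
  bound : ∀ θ ∈ strip σ, ∀ w ∈ ball (0 : ℂ) R, ‖Q θ w‖ ≤ K
  mem : ∀ t : ℝ, |t| < R → ∃ φ : RH σ, ∀ θ ∈ strip σ, φ θ = Q θ t

theorem RH.exists_of_tendsto {u : ℕ → RH σ} {q : ℂ → ℂ} {b : ℕ → ℝ}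
    (hb : Tendsto b atTop (𝓝 0)) (h : ∀ n, ∀ θ ∈ strip σ, ‖u n θ - q θ‖ ≤ b n) :
    ∃ φ : RH σ, ∀ θ ∈ strip σ, φ θ = q θ := by
  rcases (strip σ).eq_empty_or_nonempty with he | ⟨θ₀, hθ₀⟩
  · exact ⟨0, fun θ hθ => by simp [he] at hθ⟩
  have hb0 : ∀ n, 0 ≤ b n := fun n => (norm_nonneg _).trans (h n θ₀ hθ₀)
  have hc : CauchySeq u := by
    refine Metric.cauchySeq_iff.2 fun ε hε => ?_
    obtain ⟨N, hN⟩ := eventually_atTop.1 ((tendsto_order.1 hb).2 (ε / 3) (by positivity))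
    refine ⟨N, fun m hm n hn => ?_⟩
    rw [dist_eq_norm]
    refine lt_of_le_of_lt (RH.norm_le_of_forall (K := b m + b n)
      (add_nonneg (hb0 m) (hb0 n)) fun θ hθ => ?_) (by linarith [hN m hm, hN n hn])
    rw [RH.sub_apply]
    calc ‖u m θ - u n θ‖ = ‖(u m θ - q θ) - (u n θ - q θ)‖ := by congr 1; ring
      _ ≤ _ := (norm_sub_le _ _).trans (add_le_add (h m θ hθ) (h n θ hθ))
  obtain ⟨φ, hφ⟩ := cauchySeq_tendsto_of_complete hc
  refine ⟨φ, fun θ hθ => ?_⟩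
  have h1 : Tendsto (fun n => u n θ) atTop (𝓝 (φ θ)) :=
    ((RH.eval θ).continuous.tendsto φ).comp hφ
  refine tendsto_nhds_unique h1 ?_
  exact tendsto_iff_norm_sub_tendsto_zero.2
    (squeeze_zero (fun n => norm_nonneg _) (fun n => h n θ hθ) hb)

/-- For real increments the difference quotients belong to `RH σ`. They converge uniformly in θ by
the quadratic remainder estimate, so the derivative at a real parameter belongs to `RH σ` too. -/
theorem IsFamily.deriv {R K : ℝ} {Q : ℂ → ℂ → ℂ} (hR : 0 < R) (h : IsFamily σ R K Q) :
    IsFamily σ (R / 2) (4 * K / R) fun θ w => deriv (Q θ) w := by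
  have hsub : ∀ w ∈ ball (0 : ℂ) (R / 2), ball w (R / 2) ⊆ ball 0 R := fun w hw =>
    ball_subset_ball' (by have := mem_ball.1 hw; linarith)
  refine ⟨fun θ hθ => ((h.diff θ hθ).deriv isOpen_ball).mono (ball_subset_ball (by linarith)),
    fun θ hθ w hw => ?_, fun t ht => ?_⟩
  · have := norm_deriv_le_of_ball (half_pos hR) ((h.diff θ hθ).mono (hsub w hw))
      fun z hz => h.bound θ hθ z (hsub w hw hz)
    calc _ ≤ 2 * K / (R / 2) := this
      _ = _ := by field_simp; ring
  · have htR : (t : ℂ) ∈ ball (0 : ℂ) (R / 2) := by simpa using ht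
    obtain ⟨φ₀, hφ₀⟩ := h.mem t (by linarith)
    -- Increments at most R/16 keep t + s n within radius R and below (R/2)/4, as the remainder
    -- estimate on balls of radius R/2 demands.
    let s : ℕ → ℝ := fun n => (R / 16) * (1 / ((n : ℝ) + 1))
    have hs0 : ∀ n, 0 < s n := fun n => by positivity
    have hs1 : ∀ n, s n ≤ R / 16 := fun n =>
      mul_le_of_le_one_right (by positivity) (by
        rw [div_le_one (by positivity)]
        linarith [(Nat.cast_nonneg n : (0 : ℝ) ≤ n)])
    have hex : ∀ n, ∃ φ : RH σ, ∀ θ ∈ strip σ, φ θ = Q θ ((t + s n : ℝ) : ℂ) := fun n =>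
      h.mem _ (by
        have := abs_add_le t (s n)
        rw [abs_of_pos (hs0 n)] at this
        linarith [hs1 n])
    choose φ hφ using hex
    have hlim : Tendsto (fun n => 32 * K / (R / 2) ^ 2 * s n) atTop (𝓝 0) := by
      have : Tendsto s atTop (𝓝 0) := by
        simpa [s] using (tendsto_one_div_add_atTop_nhds_zero_nat (𝕜 := ℝ)).const_mul (R / 16)
      simpa using this.const_mul (32 * K / (R / 2) ^ 2)
    refine RH.exists_of_tendsto (u := fun n => (s n)⁻¹ • (φ n - φ₀)) hlim fun n θ hθ => ?_
    have h1 := norm_sub_sub_mul_deriv_le (half_pos hR) ((h.diff θ hθ).mono (hsub t htR))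
      (fun z hz => h.bound θ hθ z (hsub t htR hz)) (s := (s n : ℂ)) (by
        rw [Complex.norm_real, Real.norm_of_nonneg (hs0 n).le]
        linarith [hs1 n])
    rw [Complex.norm_real, Real.norm_of_nonneg (hs0 n).le] at h1
    have hne : (s n : ℂ) ≠ 0 := by exact_mod_cast (hs0 n).ne'
    have h2 : ((s n)⁻¹ • (φ n - φ₀)) θ - _root_.deriv (Q θ) t
        = (s n : ℂ)⁻¹ * (Q θ (t + s n) - Q θ t - s n * _root_.deriv (Q θ) t) := by
      rw [RH.smul_apply, RH.sub_apply, hφ n θ hθ, hφ₀ θ hθ]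
      push_cast
      field_simp
    rw [h2, norm_mul, norm_inv, Complex.norm_real, Real.norm_of_nonneg (hs0 n).le]
    calc (s n)⁻¹ * _ ≤ (s n)⁻¹ * (32 * K / (R / 2) ^ 2 * s n ^ 2) :=
          mul_le_mul_of_nonneg_left h1 (inv_nonneg.2 (hs0 n).le)
      _ = _ := by have := (hs0 n).ne'; field_simp

theorem IsFamily.exists_iteratedDeriv (k : ℕ) : ∀ {R K : ℝ} {Q : ℂ → ℂ → ℂ}, 0 < R →
    IsFamily σ R K Q → ∃ φ : RH σ, ∀ θ ∈ strip σ, φ θ = iteratedDeriv k (Q θ) 0 := by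
  induction k with
  | zero =>
    intro R K Q hR h
    simpa using h.mem 0 (by simpa using hR)
  | succ k ih =>
    intro R K Q hR h
    simp only [iteratedDeriv_succ']
    exact ih (half_pos hR) (h.deriv hR)

end Family

/-! ### Analyticity of the composition operator. -/

section Composition

variable {σ : ℝ} {W : Set ℂ}

/-- The curves that stay in `W`, at a positive distance from the boundary. -/
def inner (σ : ℝ) (W : Set ℂ) : Set (RH σ) :=
  {y | ∃ R > 0, ∀ θ ∈ closure (strip σ), ball (y θ) R ⊆ W}

theorem mem_of_mem_inner {y : RH σ} (hy : y ∈ inner σ W) {θ : ℂ} (hθ : θ ∈ closure (strip σ)) :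
    y θ ∈ W := by
  obtain ⟨R, hR, h⟩ := hy
  exact h θ hθ (mem_ball_self hR)

theorem ball_subset_of_norm_sub_lt {y₀ y : RH σ} {R : ℝ}
    (h : ∀ θ ∈ closure (strip σ), ball (y₀ θ) R ⊆ W) {r : ℝ} (hy : ‖y - y₀‖ ≤ r) {θ : ℂ}
    (hθ : θ ∈ closure (strip σ)) : ball (y θ) (R - r) ⊆ W := by
  refine (ball_subset_ball' ?_).trans (h θ hθ)
  have := (RH.norm_apply_le (y - y₀) θ).trans hy
  rw [RH.sub_apply] at this
  rw [dist_eq_norm]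
  linarith

theorem isOpen_inner : IsOpen (inner σ W) := by
  rw [Metric.isOpen_iff]
  rintro y ⟨R, hR, h⟩
  refine ⟨R / 2, half_pos hR, fun z hz => ⟨R - R / 2, by linarith, fun θ hθ => ?_⟩⟩
  rw [mem_ball, dist_eq_norm] at hz
  exact ball_subset_of_norm_sub_lt h hz.le hθ

theorem exists_comp (hσ : 0 < σ) {y : RH σ} (hy : y ∈ inner σ W) (g : Maps σ W) :
    ∃ φ : RH σ, ∀ θ ∈ closure (strip σ), φ θ = ev g.1 (θ, y θ) := by
  refine RH.exists_of hσ (u := fun θ => ev g.1 (θ, y θ)) (K := ‖g‖) ?_ ?_ ?_ ?_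
    fun θ _ => norm_ev_le g _
  · refine (continuousOn_ev g).comp (continuousOn_id.prodMk y.continuousOn) fun θ hθ => ?_
    rw [dom_eq]
    exact ⟨hθ, subset_closure (mem_of_mem_inner hy hθ)⟩
  · exact (differentiableOn_ev g).comp (differentiableOn_id.prodMk y.differentiableOn)
      fun θ hθ => ⟨hθ, mem_of_mem_inner hy (subset_closure hθ)⟩
  · intro t
    have := g.2.2.1 t (y t).re (by
      rw [y.ofReal_re_apply]
      exact mem_of_mem_inner hy (subset_closure (ofReal_mem_strip hσ t)))
    rwa [y.ofReal_re_apply] at this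
  · intro θ hθ
    rw [y.apply_add_one (subset_closure hθ)]
    exact g.2.2.2 θ hθ _ (mem_of_mem_inner hy (subset_closure hθ))

open Classical in
/-- The composition `θ ↦ g(θ, y(θ))`, as a linear operator acting on `g`. -/
def comp (y : RH σ) : Maps σ W →L[ℝ] RH σ :=
  if h : 0 < σ ∧ y ∈ inner σ W then
    LinearMap.mkContinuous
      { toFun := fun g => (exists_comp h.1 h.2 g).choose
        map_add' := fun f g => RH.ext_of_strip fun θ hθ => by
          rw [RH.add_apply, (exists_comp h.1 h.2 _).choose_spec θ (subset_closure hθ),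
            (exists_comp h.1 h.2 _).choose_spec θ (subset_closure hθ),
            (exists_comp h.1 h.2 _).choose_spec θ (subset_closure hθ), ev_coe_add]
        map_smul' := fun c g => RH.ext_of_strip fun θ hθ => by
          rw [RingHom.id_apply, RH.smul_apply,
            (exists_comp h.1 h.2 _).choose_spec θ (subset_closure hθ),
            (exists_comp h.1 h.2 _).choose_spec θ (subset_closure hθ), ev_coe_smul] } 1
      fun g => by
        rw [one_mul]
        refine RH.norm_le_of_forall (norm_nonneg g) fun θ hθ => ?_
        change ‖extend (exists_comp h.1 h.2 g).choose.1 θ‖ ≤ _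
        rw [(exists_comp h.1 h.2 g).choose_spec θ (subset_closure hθ)]
        exact norm_ev_le g _
  else 0

theorem comp_apply (hσ : 0 < σ) {y : RH σ} (hy : y ∈ inner σ W) (g : Maps σ W) {θ : ℂ}
    (hθ : θ ∈ closure (strip σ)) : comp y g θ = ev g.1 (θ, y θ) := by
  have h : 0 < σ ∧ y ∈ inner σ W := ⟨hσ, hy⟩
  rw [comp, dif_pos h]
  exact (exists_comp h.1 h.2 g).choose_spec θ hθ

theorem isFamily_ev (hσ : 0 < σ) {y : RH σ} {R : ℝ}
    (h : ∀ θ ∈ closure (strip σ), ball (y θ) R ⊆ W) (g : Maps σ W) :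
    IsFamily σ R ‖g‖ fun θ w => ev g.1 (θ, y θ + w) := by
  refine ⟨fun θ hθ => ?_, fun θ _ w _ => norm_ev_le g _, fun t ht => ?_⟩
  · refine (differentiableOn_ev_snd g hθ).comp (by fun_prop) fun w hw => ?_
    exact h θ (subset_closure hθ) (by simpa using hw)
  · let z : RH σ := y + t • (1 : RH σ)
    have hz : ∀ θ ∈ closure (strip σ), z θ = y θ + t := fun θ hθ => by
      simp [z, RH.one_apply hθ]
    have hzi : z ∈ inner σ W := by
      refine ⟨R - |t|, by linarith, fun θ hθ => ?_⟩
      refine (ball_subset_ball' ?_).trans (h θ hθ)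
      rw [hz θ hθ, dist_eq_norm, add_sub_cancel_left, Complex.norm_real, Real.norm_eq_abs]
      linarith
    exact ⟨comp z g, fun θ hθ => by
      rw [comp_apply hσ hzi g (subset_closure hθ), hz θ (subset_closure hθ)]⟩

/-- These are the Taylor coefficients of w ↦ g(θ, y(θ) + w), as bounded operators in g; Cauchy's
estimate on radius R/2 bounds their norms uniformly in θ. -/
theorem exists_taylorCoeff (hσ : 0 < σ) {y : RH σ} {R : ℝ} (hR : 0 < R)
    (h : ∀ θ ∈ closure (strip σ), ball (y θ) R ⊆ W) (k : ℕ) :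
    ∃ c : Maps σ W →L[ℝ] RH σ, ‖c‖ ≤ 1 / (R / 2) ^ k ∧ ∀ g, ∀ θ ∈ strip σ,
      c g θ = (k.factorial : ℂ)⁻¹ *
        iteratedDeriv k (fun w => ev g.1 (θ, y θ + w)) 0 := by
  have hex := fun g : Maps σ W => (isFamily_ev hσ h g).exists_iteratedDeriv k hR
  choose d hd using hex
  have hcd : ∀ g : Maps σ W, ∀ θ ∈ strip σ,
      ContDiffAt ℂ k (fun w => ev g.1 (θ, y θ + w)) 0 := fun g θ hθ =>
    (((isFamily_ev hσ h g).diff θ hθ).contDiffOn isOpen_ball).contDiffAt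
      (isOpen_ball.mem_nhds (mem_ball_self hR))
  refine ⟨LinearMap.mkContinuous
    { toFun := fun g => (k.factorial : ℝ)⁻¹ • d g
      map_add' := fun f g => RH.ext_of_strip fun θ hθ => ?_
      map_smul' := fun r g => RH.ext_of_strip fun θ hθ => ?_ } (1 / (R / 2) ^ k) fun g => ?_,
    LinearMap.mkContinuous_norm_le _ (by positivity) _, fun g θ hθ => ?_⟩
  · simp only [RH.smul_apply, RH.add_apply, hd _ θ hθ, ev_coe_add]
    rw [iteratedDeriv_fun_add (hcd f θ hθ) (hcd g θ hθ)]
    ring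
  · simp only [RingHom.id_apply, RH.smul_apply, hd _ θ hθ, ev_coe_smul]
    rw [iteratedDeriv_const_mul_field]
    ring
  · refine RH.norm_le_of_forall (by positivity) fun θ hθ => ?_
    have hsub : closedBall (0 : ℂ) (R / 2) ⊆ ball 0 R := closedBall_subset_ball (by linarith)
    have := Complex.norm_iteratedDeriv_le_of_forall_mem_sphere_norm_le k (half_pos hR)
      (((isFamily_ev hσ h g).diff θ hθ).diffContOnCl_ball hsub) (C := ‖g‖)
      fun z _ => norm_ev_le g _
    change ‖((k.factorial : ℝ)⁻¹ • d g) θ‖ ≤ _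
    rw [RH.smul_apply, hd g θ hθ, norm_mul]
    have hk : (0 : ℝ) < k.factorial := by exact_mod_cast k.factorial_pos
    calc _ ≤ ‖(((k.factorial : ℝ)⁻¹ : ℝ) : ℂ)‖ * (k.factorial * ‖g‖ / (R / 2) ^ k) := by gcongr
      _ = _ := by
        rw [Complex.norm_real, Real.norm_of_nonneg (by positivity)]
        field_simp
  · change ((k.factorial : ℝ)⁻¹ • d g) θ = _
    rw [RH.smul_apply, hd g θ hθ]
    push_cast
    rfl

/-- Near y the operator is the sum of the series ∑ (z - y)^k c_k in operator norm. Convergence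
follows from the coefficient bounds, and pointwise the sum is the Taylor expansion of g(θ, ·) at
y(θ). -/
theorem analyticOnNhd_comp (hσ : 0 < σ) :
    AnalyticOnNhd ℝ (comp : RH σ → Maps σ W →L[ℝ] RH σ) (inner σ W) := by
  rintro y ⟨R, hR, h⟩
  choose c hc hcv using exists_taylorCoeff hσ hR h
  obtain ⟨T, hTv⟩ : ∃ T : ℕ → RH σ →L[ℝ] (Maps σ W →L[ℝ] RH σ), ∀ k η g,
      T k η g = η * c k g :=
    ⟨fun k => ((ContinuousLinearMap.compL ℝ (Maps σ W) (RH σ) (RH σ)).flip (c k)).comp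
      (ContinuousLinearMap.mul ℝ (RH σ)), fun k η g => rfl⟩
  have hT : ∀ k, ‖T k‖ * (R / 2) ^ k ≤ 1 := by
    intro k
    have h1 : ‖T k‖ ≤ 1 / (R / 2) ^ k := by
      refine ContinuousLinearMap.opNorm_le_bound _ (by positivity) fun η => ?_
      refine ContinuousLinearMap.opNorm_le_bound _ (by positivity) fun g => ?_
      rw [hTv]
      calc ‖η * c k g‖ ≤ ‖η‖ * (‖c k‖ * ‖g‖) :=
            (norm_mul_le _ _).trans (by gcongr; exact (c k).le_opNorm g)
        _ ≤ ‖η‖ * (1 / (R / 2) ^ k * ‖g‖) := by gcongr; exact hc k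
        _ = _ := by ring
    calc _ ≤ 1 / (R / 2) ^ k * (R / 2) ^ k := by gcongr
      _ = 1 := by field_simp
  obtain ⟨F, hF, hFs⟩ := exists_analyticOnNhd_hasSum T (half_pos hR) hT
  have heq : (fun z => F (z - y)) =ᶠ[𝓝 y] comp := by
    filter_upwards [ball_mem_nhds y (half_pos hR)] with z hz
    have hz0 : z - y ∈ ball (0 : RH σ) (R / 2) := by
      rw [mem_ball, dist_eq_norm] at hz
      rwa [mem_ball_zero_iff]
    have hzn : ‖z - y‖ < R / 2 := by rwa [mem_ball_zero_iff] at hz0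
    have hzi : z ∈ inner σ W := ⟨R - R / 2, by linarith, fun θ hθ =>
      ball_subset_of_norm_sub_lt h hzn.le hθ⟩
    ext1 g
    refine RH.ext_of_strip fun θ hθ => ?_
    rw [comp_apply hσ hzi g (subset_closure hθ)]
    have hs : HasSum (fun k => T k ((z - y) ^ k) g θ) (F (z - y) g θ) :=
      (RH.eval θ).hasSum ((ContinuousLinearMap.apply ℝ (RH σ) g).hasSum (hFs _ hz0))
    have hmem : z θ - y θ ∈ ball (0 : ℂ) R := by
      rw [mem_ball_zero_iff, ← RH.sub_apply]
      exact lt_of_le_of_lt (RH.norm_apply_le _ _) (by linarith)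
    have hs' := Complex.hasSum_taylorSeries_on_ball
      ((isFamily_ev hσ h g).diff θ hθ) hmem
    rw [add_sub_cancel] at hs'
    have hterm : (fun k => T k ((z - y) ^ k) g θ) = fun k : ℕ => (k.factorial : ℂ)⁻¹ •
        (z θ - y θ - 0) ^ k • iteratedDeriv k (fun w => ev g.1 (θ, y θ + w)) 0 := by
      funext k
      rw [hTv, RH.mul_apply, hcv k g θ hθ, RH.pow_apply _ _ (subset_closure hθ), RH.sub_apply]
      simp only [smul_eq_mul, sub_zero]
      ring
    rw [hterm] at hs
    exact hs.unique hs'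
  refine AnalyticAt.congr ?_ heq
  have h0 : AnalyticAt ℝ F (y - y) := by
    rw [sub_self]
    exact hF 0 (mem_ball_self (half_pos hR))
  exact h0.comp_of_eq (analyticAt_id.sub analyticAt_const) rfl

/-- The derivative `θ ↦ D_z g(θ, y(θ))`. -/
def compDeriv (g : Maps σ W) (y : RH σ) : RH σ := fderiv ℝ comp y 1 g

theorem hasDerivAt_ev (g : Maps σ W) (hW : IsOpen W) {θ z : ℂ} (hθ : θ ∈ strip σ) (hz : z ∈ W) :
    HasDerivAt (fun w => ev g.1 (θ, w))
      (deriv (fun w => ev g.1 (θ, w)) z) z :=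
  (differentiableOn_ev_snd g hθ).hasDerivAt (hW.mem_nhds hz)

/-- Moving y by real constants, that is, in the direction of the unit of the algebra, differentiates
g(θ, ·) at y(θ). -/
theorem compDeriv_apply (hσ : 0 < σ) (hW : IsOpen W) {y : RH σ} (hy : y ∈ inner σ W) (g : Maps σ W)
    {θ : ℂ} (hθ : θ ∈ strip σ) :
    compDeriv g y θ = deriv (fun w => ev g.1 (θ, w)) (y θ) := by
  have hcl := subset_closure hθ
  have h1 : HasFDerivAt (comp : RH σ → Maps σ W →L[ℝ] RH σ) (fderiv ℝ comp y) y :=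
    (analyticOnNhd_comp hσ y hy).differentiableAt.hasFDerivAt
  have h2 : HasDerivAt (fun t : ℝ => y + t • (1 : RH σ)) 1 0 := by
    simpa using ((hasDerivAt_id (0 : ℝ)).smul_const (1 : RH σ)).const_add y
  have h3 : HasDerivAt (fun t : ℝ => comp (W := W) (y + t • (1 : RH σ))) (fderiv ℝ comp y 1) 0 := by
    have h1' : HasFDerivAt (comp : RH σ → Maps σ W →L[ℝ] RH σ) (fderiv ℝ comp y)
        (y + (0 : ℝ) • (1 : RH σ)) := by simpa using h1
    exact h1'.comp_hasDerivAt 0 h2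
  have h4 : HasDerivAt (fun t : ℝ => comp (y + t • (1 : RH σ)) g θ) (compDeriv g y θ) 0 :=
    ((RH.eval θ).comp (ContinuousLinearMap.apply ℝ (RH σ) g)).hasFDerivAt.comp_hasDerivAt 0 h3
  have h5 : HasDerivAt (fun t : ℝ => ev g.1 (θ, y θ + t))
      (deriv (fun w => ev g.1 (θ, w)) (y θ)) 0 := by
    have ha : HasDerivAt (fun w => ev g.1 (θ, w))
        (deriv (fun w => ev g.1 (θ, w)) (y θ)) (y θ + ((0 : ℝ) : ℂ)) := by
      simpa using hasDerivAt_ev g hW hθ (mem_of_mem_inner hy hcl)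
    have hb : HasDerivAt (fun t : ℝ => y θ + (t : ℂ)) 1 0 :=
      (Complex.ofRealCLM.hasDerivAt (x := (0 : ℝ))).const_add (y θ)
    have := ha.comp (0 : ℝ) hb
    rw [mul_one] at this
    exact this
  refine h4.unique (h5.congr_of_eventuallyEq ?_)
  have hc : ContinuousAt (fun t : ℝ => y + t • (1 : RH σ)) 0 := h2.continuousAt
  have : ∀ᶠ t : ℝ in 𝓝 0, y + t • (1 : RH σ) ∈ inner σ W :=
    hc.eventually (isOpen_inner.mem_nhds (by simpa using hy))
  filter_upwards [this] with t ht
  rw [comp_apply hσ ht g hcl, RH.add_apply, RH.smul_apply, RH.one_apply hcl, mul_one]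

/-- The exponent `⊤` of `WithTop ℕ∞` means analyticity, here and below; it is not lowered by taking
`fderiv`. -/
theorem contDiffAt_comp (hσ : 0 < σ) {y : RH σ} (hy : y ∈ inner σ W) (g : Maps σ W) :
    ContDiffAt ℝ ⊤ (fun p : Maps σ W × RH σ => comp p.2 p.1) (g, y) :=
  ((analyticOnNhd_comp hσ y hy).contDiffAt.comp (g, y) contDiffAt_snd).clm_apply contDiffAt_fst

theorem contDiffAt_compDeriv (hσ : 0 < σ) {y : RH σ} (hy : y ∈ inner σ W) (g : Maps σ W) :
    ContDiffAt ℝ ⊤ (fun p : Maps σ W × RH σ => compDeriv p.1 p.2) (g, y) := by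
  have h1 : ContDiffAt ℝ ⊤ (fderiv ℝ (comp : RH σ → Maps σ W →L[ℝ] RH σ)) y :=
    (analyticOnNhd_comp hσ y hy).contDiffAt.fderiv_right le_rfl
  exact ((h1.comp (g, y) contDiffAt_snd).clm_apply contDiffAt_const).clm_apply contDiffAt_fst

end Composition

/-! ### Compactness of a period of the closed band. -/

section Inner

variable {σ : ℝ} {W : Set ℂ}

theorem mem_closure_strip_iff (hσ : 0 < σ) {θ : ℂ} : θ ∈ closure (strip σ) ↔ |θ.im| ≤ σ := by
  refine ⟨fun h => closure_strip_subset σ h, fun h => ?_⟩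
  have h0 : (θ.re : ℂ) ∈ strip σ := ofReal_mem_strip hσ _
  have hlim : Tendsto (fun n : ℕ => (θ.re : ℂ) + ((1 - 1 / ((n : ℝ) + 1) : ℝ) : ℂ) * (θ.im * Complex.I))
      atTop (𝓝 θ) := by
    have h1 : Tendsto (fun n : ℕ => 1 - 1 / ((n : ℝ) + 1)) atTop (𝓝 (1 - 0)) :=
      tendsto_const_nhds.sub tendsto_one_div_add_atTop_nhds_zero_nat
    have h2 := ((Complex.continuous_ofReal.tendsto _).comp h1).mul_const (θ.im * Complex.I)
    have h3 := h2.const_add (θ.re : ℂ)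
    convert! h3 using 2
    rw [sub_zero, Complex.ofReal_one, one_mul, Complex.re_add_im]
  refine mem_closure_of_tendsto hlim (Eventually.of_forall fun n => ?_)
  have hn : (0 : ℝ) < 1 / ((n : ℝ) + 1) := by positivity
  have hn1 : 1 / ((n : ℝ) + 1) ≤ 1 := by
    rw [div_le_one (by positivity)]
    linarith [(Nat.cast_nonneg n : (0 : ℝ) ≤ n)]
  change |_| < σ
  have : ((θ.re : ℂ) + ((1 - 1 / ((n : ℝ) + 1) : ℝ) : ℂ) * (θ.im * Complex.I)).im
      = (1 - 1 / ((n : ℝ) + 1)) * θ.im := by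
    rw [Complex.add_im, Complex.ofReal_im, zero_add, Complex.im_ofReal_mul]
    simp
  rw [this, abs_mul, abs_of_nonneg (by linarith)]
  nlinarith [abs_nonneg θ.im]

theorem RH.apply_add_int (φ : RH σ) {θ : ℂ} (hθ : θ ∈ closure (strip σ)) (n : ℤ) :
    φ (θ + n) = φ θ := by
  have hz : ∀ n : ℤ, θ + n ∈ closure (strip σ) := fun n => by
    simpa using add_ofReal_mem_closure_strip hθ (n : ℝ)
  induction n using Int.induction_on with
  | zero => simp
  | succ i ih =>
    rw [← ih, ← φ.apply_add_one (hz i)]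
    push_cast
    ring_nf
  | pred i ih =>
    rw [← ih, ← φ.apply_add_one (hz (-i - 1))]
    push_cast
    ring_nf

/-- A fundamental domain of the closed band. -/
def fundamental (σ : ℝ) : Set ℂ := closure (strip σ) ∩ Complex.re ⁻¹' Icc 0 1

theorem isCompact_fundamental (σ : ℝ) : IsCompact (fundamental σ) := by
  refine Metric.isCompact_of_isClosed_isBounded
    (isClosed_closure.inter (isClosed_Icc.preimage Complex.continuous_re)) ?_
  refine isBounded_iff_forall_norm_le.2 ⟨1 + σ, fun θ hθ => ?_⟩
  have h1 := closure_strip_subset σ hθ.1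
  have h2 : |θ.re| ≤ 1 := abs_le.2 ⟨by linarith [hθ.2.1], hθ.2.2⟩
  exact (Complex.norm_le_abs_re_add_abs_im θ).trans (add_le_add h2 h1)

theorem exists_fundamental {θ : ℂ} (hθ : θ ∈ closure (strip σ)) :
    ∃ θ' ∈ fundamental σ, θ = θ' + (⌊θ.re⌋ : ℤ) := by
  refine ⟨θ - (⌊θ.re⌋ : ℤ), ⟨?_, ?_⟩, by ring⟩
  · simpa using sub_ofReal_mem_closure_strip hθ (⌊θ.re⌋ : ℝ)
  · have h1 := Int.floor_le θ.re
    have h2 := Int.lt_floor_add_one θ.re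
    constructor
    · simp
    · have : (θ - (⌊θ.re⌋ : ℤ)).re = θ.re - ⌊θ.re⌋ := by simp
      rw [this]
      linarith

/-- By periodicity the curve has the same values as on a compact fundamental domain, so staying in
the open set W already gives a uniform distance to its boundary. -/
theorem mem_inner_iff (hW : IsOpen W) {y : RH σ} :
    y ∈ inner σ W ↔ ∀ θ ∈ closure (strip σ), y θ ∈ W := by
  refine ⟨fun h θ hθ => mem_of_mem_inner h hθ, fun h => ?_⟩
  have hK : IsCompact (y '' fundamental σ) :=
    (isCompact_fundamental σ).image_of_continuousOn (y.continuousOn.mono inter_subset_left)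
  have hKW : y '' fundamental σ ⊆ W := by
    rintro _ ⟨θ, hθ, rfl⟩
    exact h θ hθ.1
  obtain ⟨δ, hδ, hsub⟩ := hK.exists_thickening_subset_open hW hKW
  refine ⟨δ, hδ, fun θ hθ => ?_⟩
  obtain ⟨θ', hθ', he⟩ := exists_fundamental hθ
  rw [he, y.apply_add_int hθ'.1]
  exact (ball_subset_thickening (mem_image_of_mem _ hθ') δ).trans hsub

end Inner

/-! ### Orbits and multipliers of a curve. -/

section Iterates

variable {σ : ℝ} {W : Set ℂ} {ω : ℝ}

theorem iter_succ (g : Maps σ W) (ω : ℝ) (k : ℕ) (θ z : ℂ) :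
    iter g ω (k + 1) θ z = ev g.1 (θ + k * ω, iter g ω k θ z) := rfl

theorem iter_zero (g : Maps σ W) (ω : ℝ) (θ z : ℂ) : iter g ω 0 θ z = z := rfl

theorem iter_add (g : Maps σ W) (ω : ℝ) (i j : ℕ) (θ z : ℂ) :
    iter g ω (i + j) θ z = iter g ω i (θ + j * ω) (iter g ω j θ z) := by
  induction i with
  | zero => simp [iter_zero]
  | succ i ih =>
    rw [Nat.succ_add, Nat.succ_eq_add_one, iter_succ, ih, iter_succ]
    push_cast
    ring_nf

/-- The derivative of the `l`-th map along the orbit of `(θ, z)`. -/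
def factor (g : Maps σ W) (ω : ℝ) (l : ℕ) (θ z : ℂ) : ℂ :=
  deriv (fun w => ev g.1 (θ + l * ω, w)) (iter g ω l θ z)

theorem add_mul_mem_strip {θ : ℂ} (hθ : θ ∈ strip σ) (l : ℕ) (ω : ℝ) : θ + l * ω ∈ strip σ := by
  simpa using add_ofReal_mem_strip hθ (l * ω)

theorem add_mul_mem_closure_strip {θ : ℂ} (hθ : θ ∈ closure (strip σ)) (l : ℕ) (ω : ℝ) :
    θ + l * ω ∈ closure (strip σ) := by
  simpa using add_ofReal_mem_closure_strip hθ (l * ω)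

theorem hasDerivAt_iter (g : Maps σ W) (hW : IsOpen W) {θ z : ℂ} (hθ : θ ∈ strip σ) (k : ℕ)
    (h : ∀ l < k, iter g ω l θ z ∈ W) :
    HasDerivAt (fun w => iter g ω k θ w) (∏ l ∈ Finset.range k, factor g ω l θ z) z := by
  induction k with
  | zero => simpa [iter_zero] using hasDerivAt_id' z
  | succ k ih =>
    have h1 := ih fun l hl => h l (by omega)
    have h2 : HasDerivAt (fun w => ev g.1 (θ + k * ω, w)) (factor g ω k θ z)
        (iter g ω k θ z) := hasDerivAt_ev g hW (add_mul_mem_strip hθ k ω) (h k (by omega))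
    rw [Finset.prod_range_succ, mul_comm]
    exact h2.comp z h1

theorem slope_eq_prod (g : Maps σ W) (hW : IsOpen W) {θ z : ℂ} (hθ : θ ∈ strip σ) (n : ℕ)
    (h : ∀ l < 2 ^ n, iter g ω l θ z ∈ W) :
    slope g ω n θ z = ∏ l ∈ Finset.range (2 ^ n), factor g ω l θ z :=
  (hasDerivAt_iter g hW hθ _ h).deriv

/-- The orbit of a curve: `orb g ω y l θ = g^l(θ, y θ)`. -/
def orb (g : Maps σ W) (ω : ℝ) (y : RH σ) : ℕ → RH σ
  | 0 => y
  -- The l-th map acts at θ + lω, whereas `comp` evaluates map and curve at the same argument; hence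
  -- a translation back, composition, and a translation forth.
  | l + 1 => RH.tr (l * ω) (comp (RH.tr (-(l * ω)) (orb g ω y l)) g)

/-- The first `N` iterates of the curve `y` stay well inside `W`. -/
def IsGood (N : ℕ) (ω : ℝ) (g : Maps σ W) (y : RH σ) : Prop :=
  ∀ l < N, RH.tr (-(l * ω)) (orb g ω y l) ∈ inner σ W

theorem orb_apply (hσ : 0 < σ) {N : ℕ} {g : Maps σ W} {y : RH σ} (h : IsGood N ω g y) {l : ℕ}
    (hl : l ≤ N) {θ : ℂ} (hθ : θ ∈ closure (strip σ)) : orb g ω y l θ = iter g ω l θ (y θ) := by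
  induction l with
  | zero => rfl
  | succ l ih =>
    have h1 : θ + ((l * ω : ℝ) : ℂ) ∈ closure (strip σ) := add_ofReal_mem_closure_strip hθ _
    rw [orb, RH.tr_apply, comp_apply hσ (h l hl) g h1, RH.tr_apply, iter_succ, ← ih (by omega)]
    push_cast
    ring_nf

theorem IsGood.mem (hσ : 0 < σ) {N : ℕ} {g : Maps σ W} {y : RH σ} (h : IsGood N ω g y) {l : ℕ}
    (hl : l < N) {θ : ℂ} (hθ : θ ∈ closure (strip σ)) : iter g ω l θ (y θ) ∈ W := by
  have := mem_of_mem_inner (h l hl) (add_mul_mem_closure_strip hθ l ω)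
  rw [RH.tr_apply] at this
  rw [← orb_apply hσ h hl.le hθ]
  convert! this using 2
  push_cast
  ring

theorem isGood_iff (hσ : 0 < σ) (hW : IsOpen W) {N : ℕ} {g : Maps σ W} {y : RH σ} :
    IsGood N ω g y ↔ ∀ θ ∈ closure (strip σ), ∀ l < N, iter g ω l θ (y θ) ∈ W := by
  refine ⟨fun h θ hθ l hl => h.mem hσ hl hθ, fun h => ?_⟩
  induction N with
  | zero => exact fun l hl => absurd hl (by omega)
  | succ N ih =>
    have h1 : IsGood N ω g y := ih fun θ hθ l hl => h θ hθ l (by omega)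
    intro l hl
    refine (mem_inner_iff hW).2 fun θ hθ => ?_
    have h2 : θ + ((-(l * ω) : ℝ) : ℂ) ∈ closure (strip σ) := add_ofReal_mem_closure_strip hθ _
    rw [RH.tr_apply, orb_apply hσ h1 (by omega) h2]
    exact h _ h2 l hl

/-- The derivative of the `l`-th map along the orbit of the curve `y`. -/
def orbFactor (g : Maps σ W) (ω : ℝ) (y : RH σ) (l : ℕ) : RH σ :=
  RH.tr (l * ω) (compDeriv g (RH.tr (-(l * ω)) (orb g ω y l)))

theorem orbFactor_apply (hσ : 0 < σ) (hW : IsOpen W) {N : ℕ} {g : Maps σ W} {y : RH σ}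
    (h : IsGood N ω g y) {l : ℕ} (hl : l < N) {θ : ℂ} (hθ : θ ∈ strip σ) :
    orbFactor g ω y l θ = factor g ω l θ (y θ) := by
  rw [orbFactor, RH.tr_apply, compDeriv_apply hσ hW (h l hl) g (add_ofReal_mem_strip hθ _),
    RH.tr_apply, factor, ← orb_apply hσ h hl.le (subset_closure hθ)]
  push_cast
  ring_nf

/-- The multiplier `θ ↦ D_x g^N(θ, y(θ))` of a curve. -/
def multiplier (N : ℕ) (ω : ℝ) (g : Maps σ W) (y : RH σ) : RH σ :=
  ∏ l ∈ Finset.range N, orbFactor g ω y l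

theorem multiplier_apply (hσ : 0 < σ) (hW : IsOpen W) {N : ℕ} {g : Maps σ W} {y : RH σ}
    (h : IsGood N ω g y) {θ : ℂ} (hθ : θ ∈ strip σ) :
    multiplier N ω g y θ = ∏ l ∈ Finset.range N, factor g ω l θ (y θ) := by
  rw [multiplier, RH.prod_apply _ _ (subset_closure hθ)]
  exact Finset.prod_congr rfl fun l hl => orbFactor_apply hσ hW h (Finset.mem_range.1 hl) hθ

theorem multiplier_eq_slope (hσ : 0 < σ) (hW : IsOpen W) {n : ℕ} {g : Maps σ W} {y : RH σ}
    (h : IsGood (2 ^ n) ω g y) {θ : ℂ} (hθ : θ ∈ strip σ) :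
    multiplier (2 ^ n) ω g y θ = slope g ω n θ (y θ) := by
  rw [multiplier_apply hσ hW h hθ,
    slope_eq_prod g hW hθ n fun l hl => h.mem hσ hl (subset_closure hθ)]

theorem contDiffAt_orb (hσ : 0 < σ) {N : ℕ} {g : Maps σ W} {y : RH σ} (h : IsGood N ω g y) {l : ℕ}
    (hl : l ≤ N) : ContDiffAt ℝ ⊤ (fun p : Maps σ W × RH σ => orb p.1 ω p.2 l) (g, y) := by
  induction l with
  | zero => exact contDiffAt_snd
  | succ l ih =>
    have h1 := (contDiffAt_comp hσ (h l hl) g).comp (g, y) (f := fun p : Maps σ W × RH σ =>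
      (p.1, RH.tr (-(l * ω)) (orb p.1 ω p.2 l)))
      (contDiffAt_fst.prodMk ((RH.tr _).contDiff.contDiffAt.comp (g, y) (ih (by omega))))
    exact (RH.tr (l * ω)).contDiff.contDiffAt.comp (g, y) h1

end Iterates

/-! ### Persistence of an invariant curve. -/

section ImplicitCurve

variable {σ : ℝ} {W : Set ℂ} {ω : ℝ}

theorem contDiffAt_orbFactor (hσ : 0 < σ) {N : ℕ} {g : Maps σ W} {y : RH σ} (h : IsGood N ω g y)
    {l : ℕ} (hl : l < N) :
    ContDiffAt ℝ ⊤ (fun p : Maps σ W × RH σ => orbFactor p.1 ω p.2 l) (g, y) := by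
  have h1 := (contDiffAt_compDeriv hσ (h l hl) g).comp (g, y) (f := fun p : Maps σ W × RH σ =>
    (p.1, RH.tr (-(l * ω)) (orb p.1 ω p.2 l)))
    (contDiffAt_fst.prodMk ((RH.tr _).contDiff.contDiffAt.comp (g, y) (contDiffAt_orb hσ h hl.le)))
  exact (RH.tr (l * ω)).contDiff.contDiffAt.comp (g, y) h1

theorem contDiffAt_multiplier (hσ : 0 < σ) {N : ℕ} {g : Maps σ W} {y : RH σ} (h : IsGood N ω g y) :
    ContDiffAt ℝ ⊤ (fun p : Maps σ W × RH σ => multiplier N ω p.1 p.2) (g, y) :=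
  contDiffAt_prod fun _ hl => contDiffAt_orbFactor hσ h (Finset.mem_range.1 hl)

theorem eventually_isGood (hσ : 0 < σ) {N : ℕ} {g : Maps σ W} {y : RH σ} (h : IsGood N ω g y) :
    ∀ᶠ p : Maps σ W × RH σ in 𝓝 (g, y), IsGood N ω p.1 p.2 := by
  have : ∀ l ∈ Finset.range N, ∀ᶠ p : Maps σ W × RH σ in 𝓝 (g, y),
      RH.tr (-(l * ω)) (orb p.1 ω p.2 l) ∈ inner σ W := fun l hl => by
    have hl := Finset.mem_range.1 hl
    have hc : ContinuousAt (fun p : Maps σ W × RH σ => RH.tr (-(l * ω)) (orb p.1 ω p.2 l)) (g, y) :=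
      (RH.tr (-(l * ω))).continuous.continuousAt.comp (contDiffAt_orb hσ h hl.le).continuousAt
    exact hc.eventually (isOpen_inner.mem_nhds (h l hl))
  filter_upwards [(Finset.eventually_all _).2 this] with p hp l hl
  exact hp l (Finset.mem_range.2 hl)

/-- The equation for the invariance of the curve `y` under the `N`-th iterate of `g`. -/
def defect (N : ℕ) (ω : ℝ) (p : Maps σ W × RH σ) : RH σ :=
  orb p.1 ω p.2 N - RH.tr (N * ω) p.2

theorem contDiffAt_defect (hσ : 0 < σ) {N : ℕ} {g : Maps σ W} {y : RH σ} (h : IsGood N ω g y) :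
    ContDiffAt ℝ ⊤ (defect N ω : Maps σ W × RH σ → RH σ) (g, y) :=
  (contDiffAt_orb hσ h le_rfl).sub ((RH.tr _).contDiff.contDiffAt.comp (g, y) contDiffAt_snd)

theorem defect_eq_zero_iff (hσ : 0 < σ) {N : ℕ} {g : Maps σ W} {y : RH σ} (h : IsGood N ω g y) :
    defect N ω (g, y) = 0 ↔ ∀ θ ∈ strip σ, y (θ + N * ω) = iter g ω N θ (y θ) := by
  have key : ∀ θ ∈ strip σ,
      defect N ω (g, y) θ = iter g ω N θ (y θ) - y (θ + N * ω) := fun θ hθ => by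
    rw [defect, RH.sub_apply, RH.tr_apply, orb_apply hσ h le_rfl (subset_closure hθ)]
    push_cast
    rfl
  constructor
  · intro h0 θ hθ
    have := key θ hθ
    rw [h0, RH.zero_apply] at this
    exact (sub_eq_zero.1 this.symm).symm
  · intro h0
    refine RH.ext_of_strip fun θ hθ => ?_
    rw [key θ hθ, h0 θ hθ, sub_self, RH.zero_apply]

/-- Computed at each θ along y + tη, where the chain rule for the iterates produces the multiplier.
-/
theorem fderiv_defect_inr (hσ : 0 < σ) (hW : IsOpen W) {N : ℕ} {g : Maps σ W} {y : RH σ}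
    (h : IsGood N ω g y) (η : RH σ) :
    (fderiv ℝ (defect N ω) (g, y) ∘L .inr ℝ (Maps σ W) (RH σ)) η
      = multiplier N ω g y * η - RH.tr (N * ω) η := by
  refine RH.ext_of_strip fun θ hθ => ?_
  have hcl := subset_closure hθ
  have h2 : HasDerivAt (fun t : ℝ => y + t • η) η 0 := by
    simpa using ((hasDerivAt_id (0 : ℝ)).smul_const η).const_add y
  have h2' : HasDerivAt (fun t : ℝ => (g, y + t • η)) ((0 : Maps σ W), η) 0 :=
    (hasDerivAt_const _ _).prodMk h2
  have h1 : HasFDerivAt (defect N ω) (fderiv ℝ (defect N ω) (g, y)) (g, y + (0 : ℝ) • η) := by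
    rw [zero_smul, add_zero]
    exact ((contDiffAt_defect hσ h).differentiableAt (by simp)).hasFDerivAt
  have h3 : HasDerivAt (fun t : ℝ => defect N ω (g, y + t • η))
      (fderiv ℝ (defect N ω) (g, y) (0, η)) 0 :=
    HasFDerivAt.comp_hasDerivAt (f := fun t : ℝ => (g, y + t • η)) (0 : ℝ) h1 h2'
  have h4 : HasDerivAt (fun t : ℝ => defect N ω (g, y + t • η) θ)
      (fderiv ℝ (defect N ω) (g, y) (0, η) θ) 0 :=
    (RH.eval θ).hasFDerivAt.comp_hasDerivAt 0 h3
  have h5 : HasDerivAt (fun t : ℝ => iter g ω N θ (y θ + t * η θ))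
      (multiplier N ω g y θ * η θ) 0 := by
    have ha := hasDerivAt_iter g hW hθ N (z := y θ) fun l hl => h.mem hσ hl hcl
    rw [← multiplier_apply hσ hW h hθ] at ha
    have ha' : HasDerivAt (fun w => iter g ω N θ w) (multiplier N ω g y θ)
        (y θ + ((0 : ℝ) : ℂ) * η θ) := by simpa using ha
    have hb : HasDerivAt (fun t : ℝ => y θ + (t : ℂ) * η θ) (1 * η θ) 0 :=
      ((Complex.ofRealCLM.hasDerivAt (x := (0 : ℝ))).mul_const (η θ)).const_add (y θ)
    have := ha'.comp (0 : ℝ) hb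
    rw [one_mul] at this
    exact this
  have h6 : HasDerivAt (fun t : ℝ => y (θ + N * ω) + (t : ℂ) * η (θ + N * ω))
      (1 * η (θ + N * ω)) 0 :=
    ((Complex.ofRealCLM.hasDerivAt (x := (0 : ℝ))).mul_const _).const_add _
  have h7 := h5.sub h6
  have hN : (((N * ω : ℝ)) : ℂ) = N * ω := by push_cast; rfl
  rw [RH.sub_apply, RH.mul_apply, RH.tr_apply, hN]
  rw [one_mul] at h7
  refine h4.unique (h7.congr_of_eventuallyEq ?_)
  have : ∀ᶠ t : ℝ in 𝓝 0, IsGood N ω g (y + t • η) := by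
    have hc : Tendsto (fun t : ℝ => (g, y + t • η)) (𝓝 0) (𝓝 (g, y)) := by
      simpa using h2'.continuousAt.tendsto
    exact hc.eventually (eventually_isGood hσ h)
  filter_upwards [this] with t ht
  rw [defect, RH.sub_apply, RH.tr_apply, orb_apply hσ ht le_rfl hcl, hN]
  simp

/-- The multiplier `a` is contracting over the rotation by `α`: some product of its iterates is less
than one on the whole band. -/
def IsContracting (α : ℝ) (a : RH σ) : Prop :=
  ∃ (m : ℕ) (q : ℝ), q < 1 ∧ ∀ θ ∈ strip σ, ‖∏ k ∈ Finset.range m, a (θ + k * α)‖ ≤ q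

theorem pow_tr_mul_apply (α : ℝ) (a η : RH σ) (m : ℕ) (θ : ℂ) :
    ((RH.tr (-α) ∘L ContinuousLinearMap.mul ℝ (RH σ) a) ^ m) η (θ + m * α)
      = (∏ k ∈ Finset.range m, a (θ + k * α)) * η θ := by
  induction m with
  | zero => simp
  | succ m ih =>
    rw [pow_succ', Finset.prod_range_succ, mul_right_comm, ← ih]
    change RH.tr (-α) (a * ((RH.tr (-α) ∘L ContinuousLinearMap.mul ℝ (RH σ) a) ^ m) η) _ = _
    rw [RH.tr_apply, RH.mul_apply]
    have : θ + ((m + 1 : ℕ) : ℂ) * α + ((-α : ℝ) : ℂ) = θ + m * α := by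
      push_cast
      ring
    rw [this, mul_comm]

/-- Contraction makes some power L^m of norm less than 1, so 1 - L^m is a unit; it is the product of
1 - L with a commuting geometric sum, hence 1 - L is a unit too. -/
theorem isUnit_one_sub_tr_mul {α : ℝ} {a : RH σ} (h : IsContracting α a) :
    IsUnit (1 - RH.tr (-α) ∘L ContinuousLinearMap.mul ℝ (RH σ) a : RH σ →L[ℝ] RH σ) := by
  obtain ⟨m, q, hq, h⟩ := h
  set L : RH σ →L[ℝ] RH σ := RH.tr (-α) ∘L ContinuousLinearMap.mul ℝ (RH σ) a
  have hL : ‖L ^ m‖ < 1 := by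
    refine lt_of_le_of_lt (b := max q 0) ?_ (max_lt hq one_pos)
    refine ContinuousLinearMap.opNorm_le_bound _ (le_max_right _ _) fun η => ?_
    refine RH.norm_le_of_forall (by positivity) fun θ hθ => ?_
    have h1 := pow_tr_mul_apply α a η m (θ - m * α)
    rw [sub_add_cancel] at h1
    have h2 : θ - m * α ∈ strip σ := by simpa using sub_ofReal_mem_strip hθ (m * α)
    change ‖(L ^ m) η θ‖ ≤ _
    rw [h1, norm_mul]
    exact mul_le_mul ((h _ h2).trans (le_max_left _ _)) (RH.norm_apply_le _ _) (norm_nonneg _)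
      (le_max_right _ _)
  have h1 : IsUnit (1 - L ^ m) := isUnit_one_sub_of_norm_lt_one hL
  have hcomm : Commute (1 - L) (∑ i ∈ Finset.range m, L ^ i) :=
    ((Commute.one_left _).sub_left (Commute.sum_right _ _ _ fun i _ => Commute.self_pow L i))
  rw [← mul_neg_geom_sum, hcomm.isUnit_mul_iff] at h1
  exact h1.1

/-- The derivative is -T(1 - T⁻¹a), with T the invertible translation by Nω. -/
theorem isInvertible_fderiv_defect (hσ : 0 < σ) (hW : IsOpen W) {N : ℕ} {g : Maps σ W} {y : RH σ}
    (h : IsGood N ω g y) (hc : IsContracting (N * ω) (multiplier N ω g y)) :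
    (fderiv ℝ (defect N ω) (g, y) ∘L .inr ℝ (Maps σ W) (RH σ)).IsInvertible := by
  set α : ℝ := N * ω
  have htr : ∀ c : ℝ, (RH.tr c : RH σ →L[ℝ] RH σ) * RH.tr (-c) = 1 := fun c => by
    ext1 φ
    change RH.tr c (RH.tr (-c) φ) = φ
    rw [RH.tr_tr, add_neg_cancel, RH.tr_zero]
  have hu : IsUnit (RH.tr α : RH σ →L[ℝ] RH σ) :=
    ⟨⟨RH.tr α, RH.tr (-α), htr α, by simpa using htr (-α)⟩, rfl⟩
  obtain ⟨u, hu⟩ := (hu.mul (isUnit_one_sub_tr_mul hc)).neg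
  refine ⟨ContinuousLinearEquiv.unitsEquiv ℝ _ u, ?_⟩
  ext1 η
  rw [fderiv_defect_inr hσ hW h]
  change (u : RH σ →L[ℝ] RH σ) η = _
  rw [hu]
  change -(RH.tr α (η - RH.tr (-α) (multiplier N ω g y * η))) = _
  rw [map_sub, RH.tr_tr, add_neg_cancel, RH.tr_zero, neg_sub]

/-- The implicit function theorem for `defect` in the curve variable. The uniqueness clause is used
throughout to identify any invariant curve close to x with X. -/
theorem exists_implicitCurve (hσ : 0 < σ) (hW : IsOpen W) {N : ℕ} {f : Maps σ W} {x : RH σ}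
    (h : IsGood N ω f x) (hc : IsContracting (N * ω) (multiplier N ω f x))
    (hx : defect N ω (f, x) = 0) :
    ∃ X : Maps σ W → RH σ, ContDiffAt ℝ ⊤ X f ∧ X f = x ∧
      (∀ᶠ g in 𝓝 f, IsGood N ω g (X g) ∧ defect N ω (g, X g) = 0) ∧
      ∀ᶠ p in 𝓝 (f, x), defect N ω p = 0 → p.2 = X p.1 := by
  have := completeSpace_maps (σ := σ) hW
  have hcd := contDiffAt_defect hσ h
  have hi := isInvertible_fderiv_defect hσ hW h hc
  have htop : (⊤ : WithTop ℕ∞) ≠ 0 := by simp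
  have hX := hcd.contDiffAt_implicitFunction htop hi
  have hXf : hcd.implicitFunction htop hi f = x := hcd.implicitFunction_apply_self htop hi
  refine ⟨hcd.implicitFunction htop hi, hX, hXf, ?_, ?_⟩
  · have hgood : ∀ᶠ g in 𝓝 f, IsGood N ω g (hcd.implicitFunction htop hi g) := by
      have : Tendsto (fun g => (g, hcd.implicitFunction htop hi g)) (𝓝 f) (𝓝 (f, x)) := by
        have := (continuousAt_id (x := f)).prodMk hX.continuousAt
        simpa [ContinuousAt, hXf] using this
      exact this.eventually (eventually_isGood hσ h)
    filter_upwards [hgood, hcd.eventually_apply_implicitFunction htop hi] with g h1 h2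
    exact ⟨h1, by rw [h2, hx]⟩
  · filter_upwards [hcd.eventually_apply_eq_iff_implicitFunction htop hi] with p hp h0
    exact (hp.1 (by rw [h0, hx])).symm

end ImplicitCurve

/-! ### Uniform Birkhoff averages over an irrational rotation. -/

section Equidistribution

/-- A geometric sum whose ratio differs from 1 by irrationality. -/
theorem norm_sum_fourier_le {α : ℝ} (hα : Irrational α) {n : ℤ} (hn : n ≠ 0) :
    ∃ C : ℝ, ∀ (m : ℕ) (x : UnitAddCircle),
      ‖∑ k ∈ Finset.range m, fourier n (x + k • (α : UnitAddCircle))‖ ≤ C := by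
  set z : ℂ := fourier n (α : UnitAddCircle) with hz
  have hz1 : z ≠ 1 := by
    rw [hz, fourier_coe_apply, Ne, Complex.exp_eq_one_iff]
    rintro ⟨k, hk⟩
    have h2 : (2 * Real.pi * Complex.I : ℂ) ≠ 0 := by simp [Real.pi_ne_zero]
    have h3 : (n : ℂ) * α = k := by
      have : (2 * Real.pi * Complex.I : ℂ) * ((n : ℂ) * α) = (2 * Real.pi * Complex.I) * k := by
        rw [mul_comm _ (k : ℂ), ← hk]
        push_cast
        ring
      exact mul_left_cancel₀ h2 this
    have h4 : (n : ℝ) * α = k := by exact_mod_cast h3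
    exact (hα.intCast_mul hn).ne_int k h4
  have hzn : ‖z‖ = 1 := by rw [hz, fourier_apply, Circle.norm_coe]
  refine ⟨2 / ‖z - 1‖, fun m x => ?_⟩
  have hterm : ∀ k : ℕ, fourier n (x + k • (α : UnitAddCircle)) = fourier n x * z ^ k := by
    intro k
    induction k with
    | zero => simp
    | succ k ih =>
      rw [succ_nsmul, ← add_assoc, pow_succ, ← mul_assoc, ← ih, hz]
      simp only [fourier_apply, smul_add, AddCircle.toCircle_add, Circle.coe_mul]
  simp only [hterm, ← Finset.mul_sum]
  rw [geom_sum_eq hz1, norm_mul, norm_div]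
  have : ‖fourier n x‖ = 1 := by rw [fourier_apply, Circle.norm_coe]
  rw [this, one_mul]
  gcongr
  calc ‖z ^ m - 1‖ ≤ ‖z ^ m‖ + ‖(1 : ℂ)‖ := norm_sub_le _ _
    _ = 2 := by rw [norm_pow, hzn]; norm_num

/-- The mean of a continuous function over the circle. -/
def circleMean : C(UnitAddCircle, ℂ) →ₗ[ℂ] ℂ where
  toFun φ := ∫ t in (0 : ℝ)..1, φ t
  map_add' φ ψ := by
    simp only [ContinuousMap.add_apply]
    refine intervalIntegral.integral_add ?_ ?_ <;>
      exact Continuous.intervalIntegrable (by fun_prop) _ _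
  map_smul' c φ := by simp

theorem norm_circleMean_le (φ : C(UnitAddCircle, ℂ)) : ‖circleMean φ‖ ≤ ‖φ‖ := by
  have := intervalIntegral.norm_integral_le_of_norm_le_const (a := (0 : ℝ)) (b := 1)
    (f := fun t : ℝ => φ t) (C := ‖φ‖) fun t _ => φ.norm_coe_le_norm _
  simpa [circleMean] using this

theorem circleMean_fourier {n : ℤ} (hn : n ≠ 0) : circleMean (fourier n) = 0 := by
  change ∫ t in (0 : ℝ)..1, fourier n (t : UnitAddCircle) = 0
  have hc : (2 * Real.pi * Complex.I * n : ℂ) ≠ 0 := by simp [Real.pi_ne_zero, hn]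
  have h : ∀ t : ℝ, fourier n (t : UnitAddCircle) = Complex.exp ((2 * Real.pi * Complex.I * n) * t) := by
    intro t
    rw [fourier_coe_apply]
    congr 1
    push_cast
    ring
  simp only [h]
  rw [integral_exp_mul_complex hc]
  have : Complex.exp (2 * Real.pi * Complex.I * n * ((1 : ℝ) : ℂ)) = 1 :=
    Complex.exp_eq_one_iff.2 ⟨n, by push_cast; ring⟩
  rw [this]
  simp

/-- For trigonometric polynomials the deviation of the sums stays bounded, uniformly in the initial
point; their density in the continuous functions then costs an arbitrarily small multiple of m. -/
theorem birkhoff_circle {α : ℝ} (hα : Irrational α) (φ : C(UnitAddCircle, ℂ)) {ε : ℝ}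
    (hε : 0 < ε) : ∃ m₀ : ℕ, ∀ m ≥ m₀, ∀ x : UnitAddCircle,
      ‖∑ k ∈ Finset.range m, φ (x + k • (α : UnitAddCircle)) - m * circleMean φ‖ ≤ m * ε := by
  have hspan : ∀ ψ ∈ Submodule.span ℂ (range (@fourier (1 : ℝ))), ∃ C : ℝ, ∀ (m : ℕ)
      (x : UnitAddCircle),
      ‖∑ k ∈ Finset.range m, ψ (x + k • (α : UnitAddCircle)) - m * circleMean ψ‖ ≤ C := by
    intro ψ hψ
    induction hψ using Submodule.span_induction with
    | mem ψ h =>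
      obtain ⟨n, rfl⟩ := h
      rcases eq_or_ne n 0 with rfl | hn
      · refine ⟨0, fun m x => ?_⟩
        have : circleMean (fourier 0) = 1 := by simp [circleMean]
        simp [this]
      · simpa [circleMean_fourier hn] using norm_sum_fourier_le hα hn
    | zero => exact ⟨0, fun m x => by simp⟩
    | add ψ χ _ _ h1 h2 =>
      obtain ⟨C, hC⟩ := h1
      obtain ⟨D, hD⟩ := h2
      refine ⟨C + D, fun m x => le_trans (le_of_eq ?_)
        ((norm_add_le _ _).trans (add_le_add (hC m x) (hD m x)))⟩
      simp only [map_add, ContinuousMap.add_apply, Finset.sum_add_distrib]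
      congr 1
      ring
    | smul c ψ _ h =>
      obtain ⟨C, hC⟩ := h
      refine ⟨‖c‖ * C, fun m x => le_trans (le_of_eq ?_)
        (mul_le_mul_of_nonneg_left (hC m x) (norm_nonneg c))⟩
      simp only [map_smul, ContinuousMap.smul_apply, smul_eq_mul, ← Finset.mul_sum]
      rw [← norm_mul]
      congr 1
      ring
  have hφ : φ ∈ (Submodule.span ℂ (range (@fourier (1 : ℝ)))).topologicalClosure := by
    rw [span_fourier_closure_eq_top]
    trivial
  obtain ⟨ψ, hψ, hd⟩ := Metric.mem_closure_iff.1 hφ (ε / 3) (by positivity)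
  rw [dist_eq_norm] at hd
  obtain ⟨C, hC⟩ := hspan ψ hψ
  obtain ⟨m₀, hm₀⟩ := exists_nat_ge (C / (ε / 3))
  refine ⟨m₀, fun m hm x => ?_⟩
  have h1 : ‖∑ k ∈ Finset.range m, (φ - ψ) (x + k • (α : UnitAddCircle))‖ ≤ m * (ε / 3) := by
    refine (norm_sum_le_of_le _ (f := fun k : ℕ => (φ - ψ) (x + k • (α : UnitAddCircle)))
      fun k _ => ((φ - ψ).norm_coe_le_norm _).trans hd.le).trans ?_
    simp
  have h2 : ‖(m : ℂ) * circleMean (φ - ψ)‖ ≤ m * (ε / 3) := by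
    rw [norm_mul, Complex.norm_natCast]
    exact mul_le_mul_of_nonneg_left ((norm_circleMean_le _).trans hd.le) (Nat.cast_nonneg m)
  have h3 : C ≤ m * (ε / 3) := by
    have : C / (ε / 3) ≤ m := hm₀.trans (by exact_mod_cast hm)
    rwa [div_le_iff₀ (by positivity)] at this
  have h4 : ∑ k ∈ Finset.range m, φ (x + k • (α : UnitAddCircle)) - m * circleMean φ
      = (∑ k ∈ Finset.range m, (φ - ψ) (x + k • (α : UnitAddCircle))
        - m * circleMean (φ - ψ)) +
        (∑ k ∈ Finset.range m, ψ (x + k • (α : UnitAddCircle)) - m * circleMean ψ) := by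
    simp only [map_sub, ContinuousMap.sub_apply, Finset.sum_sub_distrib]
    ring
  rw [h4]
  refine (norm_add_le _ _).trans ((add_le_add (norm_sub_le _ _) (hC m x)).trans ?_)
  linarith

theorem birkhoff_le {α : ℝ} (hα : Irrational α) {ψ : ℝ → ℝ} (hc : Continuous ψ)
    (hp : Function.Periodic ψ 1) {ε : ℝ} (hε : 0 < ε) :
    ∃ m₀ : ℕ, ∀ m ≥ m₀, ∀ t : ℝ,
      ∑ k ∈ Finset.range m, ψ (t + k * α) ≤ m * ((∫ t in (0 : ℝ)..1, ψ t) + ε) := by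
  let φ : C(UnitAddCircle, ℂ) := ⟨fun x => ((hp.lift x : ℝ) : ℂ), by
    refine Complex.continuous_ofReal.comp ?_
    exact (QuotientAddGroup.isQuotientMap_mk _).continuous_iff.2 hc⟩
  have hφ : ∀ t : ℝ, φ (t : UnitAddCircle) = ψ t := fun t => rfl
  obtain ⟨m₀, h⟩ := birkhoff_circle hα φ hε
  refine ⟨m₀, fun m hm t => ?_⟩
  have h1 := h m hm t
  have h2 : circleMean φ = ((∫ t in (0 : ℝ)..1, ψ t : ℝ) : ℂ) := by
    rw [← intervalIntegral.integral_ofReal]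
    rfl
  have h3 : ∀ k : ℕ, φ ((t : UnitAddCircle) + k • (α : UnitAddCircle)) = ψ (t + k * α) := by
    intro k
    rw [← hφ]
    congr 1
    simp
  simp only [h2, h3] at h1
  have h4 : ∑ k ∈ Finset.range m, (ψ (t + k * α) : ℂ) - m * ((∫ t in (0 : ℝ)..1, ψ t : ℝ) : ℂ)
      = ((∑ k ∈ Finset.range m, ψ (t + k * α) - m * (∫ t in (0 : ℝ)..1, ψ t) : ℝ) : ℂ) := by
    push_cast
    rfl
  rw [h4, Complex.norm_real, Real.norm_eq_abs] at h1
  have := (abs_le.1 h1).2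
  linarith

end Equidistribution

/-! ### Truncated logarithmic means. -/

section LogMean

/-- The mean of `log |a|`, where `|a|` is cut off from below at `η`. -/
def logMean (η : ℝ) (a : ℝ → ℂ) : ℝ := ∫ t in (0 : ℝ)..1, Real.log (max ‖a t‖ η)

theorem continuous_log_max {a : ℝ → ℂ} (ha : Continuous a) {η : ℝ} (hη : 0 < η) :
    Continuous fun t => Real.log (max ‖a t‖ η) :=
  (ha.norm.max continuous_const).log fun _ => (lt_max_of_lt_right hη).ne'

theorem logMean_eq (η : ℝ) (a : ℝ → ℂ) :
    logMean η a = ∫ t in Icc (0 : ℝ) 1, Real.log (max ‖a t‖ η) := by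
  rw [logMean, intervalIntegral.integral_of_le zero_le_one, integral_Icc_eq_integral_Ioc]

theorem integrable_log_max {a : ℝ → ℂ} (ha : Continuous a) {η : ℝ} (hη : 0 < η) :
    Integrable (fun t => Real.log (max ‖a t‖ η)) (volume.restrict (Icc (0 : ℝ) 1)) :=
  (continuous_log_max ha hη).integrableOn_Icc

theorem enorm_log {z : ℂ} (hz : z ≠ 0) : ENNReal.log ‖z‖ₑ = (Real.log ‖z‖ : ℝ) := by
  rw [← ofReal_norm, ENNReal.log_ofReal_of_pos (norm_pos_iff.2 hz)]

theorem toENNReal_log (z : ℂ) : (ENNReal.log ‖z‖ₑ).toENNReal = ENNReal.ofReal (Real.log ‖z‖) := by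
  rcases eq_or_ne z 0 with rfl | hz
  · simp
  · rw [enorm_log hz, EReal.real_coe_toENNReal]

theorem toENNReal_neg_log {z : ℂ} (hz : z ≠ 0) :
    (-ENNReal.log ‖z‖ₑ).toENNReal = ENNReal.ofReal (-Real.log ‖z‖) := by
  rw [enorm_log hz, ← EReal.coe_neg, EReal.real_coe_toENNReal]

theorem logMean_eq_lintegral {a : ℝ → ℂ} (ha : Continuous a) {η : ℝ} (hη : 0 < η) :
    logMean η a = (∫⁻ t in Icc (0 : ℝ) 1, ENNReal.ofReal (Real.log (max ‖a t‖ η))).toReal -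
      (∫⁻ t in Icc (0 : ℝ) 1, ENNReal.ofReal (-Real.log (max ‖a t‖ η))).toReal := by
  rw [logMean_eq, integral_eq_lintegral_pos_part_sub_lintegral_neg_part (integrable_log_max ha hη)]

theorem lintegral_ofReal_ne_top {u : ℝ → ℝ} (hu : Continuous u) :
    ∫⁻ t in Icc (0 : ℝ) 1, ENNReal.ofReal (u t) ≠ ⊤ :=
  (hu.integrableOn_Icc (a := 0) (b := 1)).lintegral_lt_top.ne

theorem continuous_neg_log_max {a : ℝ → ℂ} (ha : Continuous a) {η : ℝ} (hη : 0 < η) :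
    Continuous fun t => -Real.log (max ‖a t‖ η) :=
  (continuous_log_max ha hη).neg

/-- Cutting off from below only raises the logarithm. The truncated mean has a continuous integrand,
to which uniform Birkhoff averages apply even when a vanishes somewhere. -/
theorem logIntegral_le_logMean {a : ℝ → ℂ} (ha : Continuous a) {η : ℝ} (hη : 0 < η) :
    logIntegral a ≤ (logMean η a : ℝ) := by
  have hc := continuous_log_max ha hη
  rw [logMean_eq_lintegral ha hη, EReal.coe_sub, EReal.coe_ennreal_toReal (lintegral_ofReal_ne_top hc),
    EReal.coe_ennreal_toReal (lintegral_ofReal_ne_top (continuous_neg_log_max ha hη)), logIntegral]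
  refine EReal.sub_le_sub ?_ ?_
  · refine EReal.coe_ennreal_le_coe_ennreal_iff.2 (lintegral_mono fun t => ?_)
    simp only [toENNReal_log]
    rcases eq_or_ne (a t) 0 with h0 | h0
    · simp [h0]
    · exact ENNReal.ofReal_le_ofReal (Real.log_le_log (norm_pos_iff.2 h0) (le_max_left _ _))
  · refine EReal.coe_ennreal_le_coe_ennreal_iff.2 (lintegral_mono fun t => ?_)
    rcases eq_or_ne (a t) 0 with h0 | h0
    · simp [h0]
    · simp only [toENNReal_neg_log h0]
      exact ENNReal.ofReal_le_ofReal
        (neg_le_neg (Real.log_le_log (norm_pos_iff.2 h0) (le_max_left _ _)))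

/-- For cut-offs at most 1 the positive part does not change and the negative part increases to its
limit, so monotone convergence applies, also when the exponent is -∞. -/
theorem exists_logMean_lt {a : ℝ → ℂ} (ha : Continuous a) {c : ℝ}
    (h : logIntegral a < (c : ℝ)) : ∃ η > 0, logMean η a < c := by
  by_contra! hcon
  -- With this cut-off the truncated logarithm at a zero of a is exactly -n.
  set η : ℕ → ℝ := fun n => Real.exp (-n) with hη
  have hη0 : ∀ n, 0 < η n := fun n => Real.exp_pos _
  have hη1 : ∀ n, η n ≤ 1 := fun n => Real.exp_le_one_iff.2 (by simp)
  set A := ∫⁻ t in Icc (0 : ℝ) 1, (ENNReal.log ‖a t‖ₑ).toENNReal with hA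
  set B := ∫⁻ t in Icc (0 : ℝ) 1, (-ENNReal.log ‖a t‖ₑ).toENNReal with hB
  have hpos : ∀ n, ∫⁻ t in Icc (0 : ℝ) 1, ENNReal.ofReal (Real.log (max ‖a t‖ (η n))) = A := by
    intro n
    refine lintegral_congr fun t => ?_
    rw [toENNReal_log]
    rcases le_total (η n) ‖a t‖ with h1 | h1
    · rw [max_eq_left h1]
    · rw [max_eq_right h1, ENNReal.ofReal_of_nonpos (Real.log_nonpos (hη0 n).le (hη1 n)),
        ENNReal.ofReal_of_nonpos (Real.log_nonpos (norm_nonneg _) (h1.trans (hη1 n)))]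
  have hAtop : A ≠ ⊤ := by
    rw [← hpos 0]
    exact lintegral_ofReal_ne_top (continuous_log_max ha (hη0 0))
  have hlim : Tendsto (fun n : ℕ => ∫⁻ t in Icc (0 : ℝ) 1,
      ENNReal.ofReal (-Real.log (max ‖a t‖ (η n)))) atTop (𝓝 B) := by
    refine lintegral_tendsto_of_tendsto_of_monotone
      (fun n => (continuous_log_max ha (hη0 n)).neg.measurable.ennreal_ofReal.aemeasurable)
      (Eventually.of_forall fun t n m hnm => ?_) (Eventually.of_forall fun t => ?_)
    · refine ENNReal.ofReal_le_ofReal (neg_le_neg (Real.log_le_log (lt_max_of_lt_right (hη0 _))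
        (max_le_max le_rfl ?_)))
      exact Real.exp_le_exp.2 (neg_le_neg (by exact_mod_cast hnm))
    · rcases eq_or_ne (a t) 0 with h0 | h0
      · have : ∀ n, -Real.log (max ‖a t‖ (η n)) = n := fun n => by
          rw [h0, norm_zero, max_eq_right (hη0 n).le, hη, Real.log_exp, neg_neg]
        simp only [this]
        simp only [h0, enorm_zero, ENNReal.log_zero, EReal.neg_bot, EReal.toENNReal_top]
        simpa using ENNReal.tendsto_nat_nhds_top
      · rw [toENNReal_neg_log h0]
        refine tendsto_const_nhds.congr' ?_
        obtain ⟨N, hN⟩ := exists_nat_ge (-Real.log ‖a t‖)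
        filter_upwards [eventually_ge_atTop N] with n hn
        rw [max_eq_left]
        have : (N : ℝ) ≤ n := by exact_mod_cast hn
        rw [← Real.exp_log (norm_pos_iff.2 h0)]
        exact Real.exp_le_exp.2 (by linarith)
  have hle : ∀ n, ∫⁻ t in Icc (0 : ℝ) 1, ENNReal.ofReal (-Real.log (max ‖a t‖ (η n)))
      ≤ ENNReal.ofReal (A.toReal - c) := by
    intro n
    have h1 := hcon (η n) (hη0 n)
    rw [logMean_eq_lintegral ha (hη0 n), hpos n] at h1
    rw [← ENNReal.ofReal_toReal (lintegral_ofReal_ne_top (continuous_neg_log_max ha (hη0 n)))]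
    exact ENNReal.ofReal_le_ofReal (by linarith)
  have hBle : B ≤ ENNReal.ofReal (A.toReal - c) := le_of_tendsto' hlim hle
  have hAc : 0 ≤ A.toReal - c := by
    have h1 := hcon (η 0) (hη0 0)
    rw [logMean_eq_lintegral ha (hη0 0), hpos 0] at h1
    have := ENNReal.toReal_nonneg (a := ∫⁻ t in Icc (0 : ℝ) 1,
      ENNReal.ofReal (-Real.log (max ‖a t‖ (η 0))))
    linarith
  refine absurd h (not_lt.2 ?_)
  calc ((c : ℝ) : EReal) = (A : EReal) - (ENNReal.ofReal (A.toReal - c) : ℝ≥0∞) := by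
        rw [EReal.coe_ennreal_ofReal, max_eq_left hAc, ← EReal.coe_ennreal_toReal hAtop,
          ← EReal.coe_sub]
        congr 1
        ring
    _ ≤ logIntegral a := EReal.sub_le_sub le_rfl (EReal.coe_ennreal_le_coe_ennreal_iff.2 hBle)

/-- The truncated logarithm is Lipschitz with constant 1/η. -/
theorem logMean_le_add {a b : ℝ → ℂ} (ha : Continuous a) (hb : Continuous b) {η δ : ℝ}
    (hη : 0 < η) (h : ∀ t ∈ Icc (0 : ℝ) 1, ‖a t - b t‖ ≤ δ) :
    logMean η a ≤ logMean η b + δ / η := by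
  have hpt : ∀ t ∈ Icc (0 : ℝ) 1,
      Real.log (max ‖a t‖ η) ≤ Real.log (max ‖b t‖ η) + δ / η := by
    intro t ht
    have hb0 : 0 < max ‖b t‖ η := lt_max_of_lt_right hη
    have ha0 : 0 < max ‖a t‖ η := lt_max_of_lt_right hη
    have hδ : 0 ≤ δ := (norm_nonneg _).trans (h t ht)
    have h1 : max ‖a t‖ η ≤ max ‖b t‖ η + δ := by
      refine max_le ?_ ((le_max_right ‖b t‖ η).trans (by linarith))
      have : ‖a t‖ ≤ ‖b t‖ + ‖a t - b t‖ := by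
        calc ‖a t‖ = ‖b t + (a t - b t)‖ := by congr 1; ring
          _ ≤ _ := norm_add_le _ _
      linarith [h t ht, le_max_left ‖b t‖ η]
    have h2 : Real.log (max ‖a t‖ η / max ‖b t‖ η) ≤ max ‖a t‖ η / max ‖b t‖ η - 1 :=
      Real.log_le_sub_one_of_pos (div_pos ha0 hb0)
    rw [Real.log_div ha0.ne' hb0.ne'] at h2
    have h3 : max ‖a t‖ η / max ‖b t‖ η - 1 ≤ δ / η := by
      rw [div_sub_one hb0.ne']
      exact div_le_div₀ hδ (by linarith) hη (le_max_right _ _)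
    linarith
  have hia := (continuous_log_max ha hη).intervalIntegrable (μ := volume) 0 1
  have hib := (continuous_log_max hb hη).intervalIntegrable (μ := volume) 0 1
  calc logMean η a ≤ ∫ t in (0 : ℝ)..1, (Real.log (max ‖b t‖ η) + δ / η) :=
        intervalIntegral.integral_mono_on zero_le_one hia
          (hib.add intervalIntegrable_const) hpt
    _ = logMean η b + δ / η := by
      rw [intervalIntegral.integral_add hib intervalIntegrable_const]
      simp [logMean]

/-- Dominated convergence, with the integrable majorant |log |a||. -/
theorem exists_logMean_le_integral_log {a : ℝ → ℂ} (ha : Continuous a)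
    (hi : IntervalIntegrable (fun t => Real.log ‖a t‖) volume 0 1) (h0 : ∀ᵐ t : ℝ, a t ≠ 0)
    {ε : ℝ} (hε : 0 < ε) :
    ∃ η > 0, logMean η a ≤ (∫ t in (0 : ℝ)..1, Real.log ‖a t‖) + ε := by
  set η : ℕ → ℝ := fun n => Real.exp (-n) with hη
  have hη0 : ∀ n, 0 < η n := fun n => Real.exp_pos _
  have hη1 : ∀ n, η n ≤ 1 := fun n => Real.exp_le_one_iff.2 (by simp)
  have hlim : Tendsto (fun n => logMean (η n) a) atTop (𝓝 (∫ t in (0 : ℝ)..1, Real.log ‖a t‖)) := by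
    refine intervalIntegral.tendsto_integral_filter_of_dominated_convergence
      (fun t => |Real.log ‖a t‖|)
      (Eventually.of_forall fun n => (continuous_log_max ha (hη0 n)).aestronglyMeasurable)
      (Eventually.of_forall fun n => ?_) hi.abs ?_
    · filter_upwards [h0] with t ht _
      rw [Real.norm_eq_abs]
      rcases le_total (η n) ‖a t‖ with h1 | h1
      · rw [max_eq_left h1]
      · rw [max_eq_right h1, abs_of_nonpos (Real.log_nonpos (hη0 n).le (hη1 n)),
          abs_of_nonpos (Real.log_nonpos (norm_nonneg _) (h1.trans (hη1 n)))]
        exact neg_le_neg (Real.log_le_log (norm_pos_iff.2 ht) h1)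
    · filter_upwards [h0] with t ht _
      refine tendsto_const_nhds.congr' ?_
      obtain ⟨N, hN⟩ := exists_nat_ge (-Real.log ‖a t‖)
      filter_upwards [eventually_ge_atTop N] with n hn
      rw [max_eq_left]
      have : (N : ℝ) ≤ n := by exact_mod_cast hn
      rw [← Real.exp_log (norm_pos_iff.2 ht)]
      exact Real.exp_le_exp.2 (by linarith)
  obtain ⟨n, hn⟩ := ((tendsto_order.1 hlim).2 _ (lt_add_of_pos_right _ hε)).exists
  exact ⟨η n, hη0 n, hn.le⟩

end LogMean

/-! ### Contraction on a complex band. -/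

section ThreeLines

variable {σ : ℝ}

/-- The restriction of a function to the line `Im θ = s`. -/
def onLine (φ : ℂ → ℂ) (s : ℝ) (t : ℝ) : ℂ := φ (t + s * Complex.I)

theorem onLine_zero (φ : ℂ → ℂ) (t : ℝ) : onLine φ 0 t = φ t := by simp [onLine]

theorem line_mem_strip {s : ℝ} (hs : |s| < σ) (t : ℝ) : (t : ℂ) + s * Complex.I ∈ strip σ := by
  simpa [strip] using hs

theorem continuous_onLine (φ : RH σ) {s : ℝ} (hs : |s| < σ) : Continuous (onLine φ s) :=
  φ.differentiableOn.continuousOn.comp_continuous (by fun_prop) fun t => line_mem_strip hs t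

theorem periodic_onLine (φ : RH σ) {s : ℝ} (hs : |s| < σ) : Function.Periodic (onLine φ s) 1 := by
  intro t
  rw [onLine, onLine, ← φ.apply_add_one (subset_closure (line_mem_strip hs t))]
  push_cast
  ring_nf

theorem norm_onLine_le_of_three_lines (φ : RH σ) {s₁ s₂ s A B : ℝ} (h12 : s₁ < s₂) (h1 : -σ < s₁)
    (h2 : s₂ < σ) (hs : s ∈ Icc s₁ s₂) (hA : ∀ t, ‖onLine φ s₁ t‖ ≤ A)
    (hB : ∀ t, ‖onLine φ s₂ t‖ ≤ B) (t : ℝ) :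
    ‖onLine φ s t‖ ≤ A ^ (1 - (s - s₁) / (s₂ - s₁)) * B ^ ((s - s₁) / (s₂ - s₁)) := by
  have hmaps : ∀ z : ℂ, z ∈ Complex.HadamardThreeLines.verticalClosedStrip s₁ s₂ →
      z * Complex.I ∈ strip σ := by
    intro z hz
    have hz' : z.re ∈ Icc s₁ s₂ := hz
    have : |z.re| < σ := abs_lt.2 ⟨by linarith [hz'.1], by linarith [hz'.2]⟩
    simpa [strip] using this
  have hd : DifferentiableOn ℂ (fun z => φ (z * Complex.I))
      (Complex.HadamardThreeLines.verticalClosedStrip s₁ s₂) :=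
    φ.differentiableOn.comp (by fun_prop) hmaps
  have hcl : closure (Complex.HadamardThreeLines.verticalStrip s₁ s₂)
      ⊆ Complex.HadamardThreeLines.verticalClosedStrip s₁ s₂ :=
    closure_minimal (preimage_mono Ioo_subset_Icc_self) (isClosed_Icc.preimage Complex.continuous_re)
  have key := Complex.HadamardThreeLines.norm_le_interp_of_mem_verticalClosedStrip'
    -- Multiplication by i turns vertical lines into horizontal ones; the point s - ti goes to t +
    -- si.
    (f := fun z => φ (z * Complex.I)) (z := (s : ℂ) - t * Complex.I) (a := A) (b := B) h12
    (by simpa [Complex.HadamardThreeLines.verticalClosedStrip] using hs)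
    ((hd.mono hcl).diffContOnCl)
    (by
      refine ⟨‖φ‖, ?_⟩
      rintro _ ⟨z, -, rfl⟩
      exact φ.norm_apply_le _)
    (fun z hz => by
      have hz' : z.re = s₁ := hz
      refine le_trans (le_of_eq ?_) (hA (-z.im))
      rw [onLine]
      congr 2
      apply Complex.ext <;> simp [hz'])
    (fun z hz => by
      have hz' : z.re = s₂ := hz
      refine le_trans (le_of_eq ?_) (hB (-z.im))
      rw [onLine]
      congr 2
      apply Complex.ext <;> simp [hz'])
  have h3 : ((s : ℂ) - t * Complex.I) * Complex.I = t + s * Complex.I := by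
    apply Complex.ext <;> simp
  simp only [h3] at key
  simpa [onLine] using key

/-- The product of the first `m` translates of `φ`. -/
def rotProd (α : ℝ) (φ : RH σ) (m : ℕ) : RH σ := ∏ k ∈ Finset.range m, RH.tr (k * α) φ

theorem rotProd_apply (α : ℝ) (φ : RH σ) (m : ℕ) {θ : ℂ} (hθ : θ ∈ closure (strip σ)) :
    rotProd α φ m θ = ∏ k ∈ Finset.range m, φ (θ + k * α) := by
  rw [rotProd, RH.prod_apply _ _ hθ]
  refine Finset.prod_congr rfl fun k _ => ?_
  rw [RH.tr_apply]
  push_cast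
  rfl

theorem onLine_rotProd (α : ℝ) (φ : RH σ) (m : ℕ) {s : ℝ} (hs : |s| < σ) (t : ℝ) :
    onLine (rotProd α φ m) s t = ∏ k ∈ Finset.range m, onLine φ s (t + k * α) := by
  rw [onLine, rotProd_apply α φ m (subset_closure (line_mem_strip hs t))]
  refine Finset.prod_congr rfl fun k _ => ?_
  rw [onLine]
  push_cast
  ring_nf

/-- Birkhoff averages of the truncated logarithm, exponentiated; uniform in the starting point. -/
theorem norm_onLine_rotProd_le {α : ℝ} (hα : Irrational α) (φ : RH σ) {s : ℝ} (hs : |s| < σ)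
    {η b : ℝ} (hη : 0 < η) (hb : logMean η (onLine φ s) < b) :
    ∃ m₀ : ℕ, ∀ m ≥ m₀, ∀ t, ‖onLine (rotProd α φ m) s t‖ ≤ Real.exp (m * b) := by
  have hc := continuous_log_max (continuous_onLine φ hs) hη
  have hp : Function.Periodic (fun t => Real.log (max ‖onLine φ s t‖ η)) 1 := fun t => by
    simp only [periodic_onLine φ hs t]
  obtain ⟨m₀, h⟩ := birkhoff_le hα hc hp (sub_pos.2 hb)
  refine ⟨m₀, fun m hm t => ?_⟩
  have h1 := h m hm t
  rw [onLine_rotProd α φ m hs, norm_prod]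
  calc ∏ k ∈ Finset.range m, ‖onLine φ s (t + k * α)‖
      ≤ ∏ k ∈ Finset.range m, Real.exp (Real.log (max ‖onLine φ s (t + k * α)‖ η)) := by
        refine Finset.prod_le_prod (fun _ _ => norm_nonneg _) fun k _ => ?_
        rw [Real.exp_log (lt_max_of_lt_right hη)]
        exact le_max_left _ _
    _ = Real.exp (∑ k ∈ Finset.range m, Real.log (max ‖onLine φ s (t + k * α)‖ η)) :=
        (Real.exp_sum _ _).symm
    _ ≤ _ := Real.exp_le_exp.2 (by
        rw [logMean] at h1
        simpa using h1)

/-- The relative width of the band on which a multiplier bounded by `M` is still contracting. -/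
def bandRatio (K M : ℝ) : ℝ := K / (2 * (K + Real.log M))

/-- Products of m translates are at most exp(-mK) on the real axis and at most M^m on the lines at
height ±τ/2. At relative height u between them the exponent is m(-K + u(K + log M)), which is at
most -mK/2 exactly when u does not exceed `bandRatio K M`. -/
theorem contracting_of_logIntegral {τ K M α : ℝ} (hτ : 0 < τ) (hK : 0 < K) (hM : 1 ≤ M)
    (hα : Irrational α) (φ : RH τ) (hφ : ‖φ‖ ≤ M)
    (h : logIntegral (fun t : ℝ => φ t) < ((-K : ℝ) : EReal)) :
    ∃ (m : ℕ) (q : ℝ), q < 1 ∧ ∀ θ ∈ strip (τ / 2 * bandRatio K M),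
      ‖∏ k ∈ Finset.range m, φ (θ + k * α)‖ ≤ q := by
  have hlog : 0 ≤ Real.log M := Real.log_nonneg hM
  set r := bandRatio K M with hr
  have hr0 : 0 < r := by rw [hr, bandRatio]; positivity
  have hr1 : r ≤ 1 / 2 := by
    rw [hr, bandRatio, div_le_div_iff₀ (by positivity) (by norm_num)]
    linarith
  have hrK : r * (K + Real.log M) = K / 2 := by
    rw [hr, bandRatio]
    field_simp
  have h0 : (fun t : ℝ => φ t) = onLine φ 0 := funext fun t => (onLine_zero φ t).symm
  rw [h0] at h
  obtain ⟨η, hη, hJ⟩ := exists_logMean_lt (continuous_onLine φ (by simpa using hτ)) h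
  obtain ⟨m₀, hm₀⟩ := norm_onLine_rotProd_le hα φ (by simpa using hτ) hη hJ
  -- A positive number of factors is needed for the bound exp(-mK/2) to be below 1.
  set m := m₀ + 1
  have hA := hm₀ m (by omega)
  have hB : ∀ s : ℝ, |s| < τ → ∀ t, ‖onLine (rotProd α φ m) s t‖ ≤ Real.exp (m * Real.log M) := by
    intro s hs t
    rw [onLine_rotProd α φ m hs, norm_prod, mul_comm, Real.exp_mul, Real.exp_log (by linarith),
      Real.rpow_natCast]
    calc _ ≤ ∏ k ∈ Finset.range m, M :=
          Finset.prod_le_prod (fun _ _ => norm_nonneg _) fun k _ => (φ.norm_apply_le _).trans hφ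
      _ = _ := by simp
  have hm : (0 : ℝ) < m := by positivity
  have final : ∀ u : ℝ, 0 ≤ u → u ≤ r →
      Real.exp (m * -K) ^ (1 - u) * Real.exp (m * Real.log M) ^ u ≤ Real.exp (-(m * (K / 2))) := by
    intro u hu0 hu
    rw [← Real.exp_mul, ← Real.exp_mul, ← Real.exp_add]
    refine Real.exp_le_exp.2 ?_
    have h1 : u * (K + Real.log M) ≤ K / 2 := by
      rw [← hrK]
      gcongr
    nlinarith
  have hτ2 : |τ / 2| < τ := by rw [abs_of_pos (half_pos hτ)]; linarith
  refine ⟨m, Real.exp (-(m * (K / 2))), Real.exp_lt_one_iff.2 (by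
    have : 0 < (m : ℝ) * (K / 2) := by positivity
    linarith), fun θ hθ => ?_⟩
  have hθ' : |θ.im| < τ / 2 * r := hθ
  have hθ2 : |θ.im| < τ / 2 := by nlinarith
  have hθτ : |θ.im| < τ := by linarith
  rw [← rotProd_apply α φ m (subset_closure hθτ)]
  have hline : rotProd α φ m θ = onLine (rotProd α φ m) θ.im θ.re := by
    rw [onLine, Complex.re_add_im]
  rw [hline]
  rcases le_total 0 θ.im with hpos | hneg
  · rw [abs_of_nonneg hpos] at hθ' hθ2
    refine (norm_onLine_le_of_three_lines (rotProd α φ m) (half_pos hτ) (by linarith)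
      (by linarith) ⟨hpos, hθ2.le⟩ hA (hB _ hτ2) _).trans (final _ (by simp; positivity) ?_)
    rw [sub_zero, sub_zero, div_le_iff₀ (half_pos hτ)]
    linarith
  · rw [abs_of_nonpos hneg] at hθ' hθ2
    have h3 := norm_onLine_le_of_three_lines (rotProd α φ m) (s₁ := -(τ / 2)) (s₂ := 0)
      (s := θ.im) (by linarith) (by linarith) hτ ⟨by linarith, hneg⟩
      (hB _ (by rwa [abs_neg])) hA θ.re
    have h4 : (0 : ℝ) - -(τ / 2) = τ / 2 := by ring
    set u := -θ.im / (τ / 2) with hu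
    have h5 : (θ.im - -(τ / 2)) / (τ / 2) = 1 - u := by
      rw [hu]
      field_simp
      ring
    rw [h4, h5, sub_sub_cancel, mul_comm] at h3
    refine h3.trans (final u (by rw [hu]; exact div_nonneg (by linarith) (half_pos hτ).le) ?_)
    rw [hu, div_le_iff₀ (half_pos hτ)]
    linarith

end ThreeLines

/-! ### Lower semicontinuity of the Lyapunov exponent. -/

section LogSemicontinuity

variable {σ : ℝ}

theorem analyticOnNhd_onLine (φ : RH σ) {s : ℝ} (hs : |s| < σ) :
    AnalyticOnNhd ℝ (onLine φ s) univ := by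
  intro t _
  have h1 : AnalyticAt ℂ φ (t + s * Complex.I) :=
    φ.differentiableOn.analyticAt ((isOpen_strip σ).mem_nhds (line_mem_strip hs t))
  have h2 : AnalyticAt ℝ (fun t : ℝ => (t : ℂ) + s * Complex.I) t :=
    (Complex.ofRealCLM.analyticAt t).add analyticAt_const
  exact AnalyticAt.fun_comp (g := φ) (f := fun t : ℝ => (t : ℂ) + s * Complex.I) h1.restrictScalars h2

theorem RH.eq_zero_of_frequently (φ : RH σ) {θ : ℂ} (hθ : θ ∈ strip σ)
    (h : ∃ᶠ z in 𝓝[≠] θ, φ z = 0) : φ = 0 := by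
  refine RH.ext_of_strip fun z hz => ?_
  rw [RH.zero_apply]
  exact (φ.differentiableOn.analyticOnNhd (isOpen_strip σ)).eqOn_zero_of_preconnected_of_frequently_eq_zero
    (convex_strip σ).isPreconnected hθ h hz

theorem RH.eq_zero_of_onLine (φ : RH σ) {s : ℝ} (hs : |s| < σ) (h : ∀ t, onLine φ s t = 0) :
    φ = 0 := by
  refine φ.eq_zero_of_frequently (line_mem_strip hs 0) ?_
  have hlim : Tendsto (fun t : ℝ => (t : ℂ) + s * Complex.I) (𝓝[≠] 0)
      (𝓝[≠] (((0 : ℝ) : ℂ) + s * Complex.I)) := by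
    refine tendsto_nhdsWithin_iff.2 ⟨?_, ?_⟩
    · have : Continuous fun t : ℝ => (t : ℂ) + s * Complex.I := by fun_prop
      exact (this.tendsto 0).mono_left nhdsWithin_le_nhds
    · filter_upwards [self_mem_nhdsWithin] with t ht
      simpa using ht
  exact hlim.frequently (Eventually.frequently (Eventually.of_forall h))

theorem ae_onLine_ne_zero {φ : RH σ} (hφ : φ ≠ 0) {s : ℝ} (hs : |s| < σ) :
    ∀ᵐ t : ℝ, onLine φ s t ≠ 0 := by
  rcases (analyticOnNhd_onLine φ hs).eqOn_zero_or_eventually_ne_zero_of_preconnected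
    isPreconnected_univ with h | h
  · exact absurd (φ.eq_zero_of_onLine hs fun t => h (mem_univ t)) hφ
  · have := ae_restrict_le_codiscreteWithin (μ := (volume : Measure ℝ)) MeasurableSet.univ h
    rwa [Measure.restrict_univ] at this

theorem intervalIntegrable_log_onLine (φ : RH σ) {s : ℝ} (hs : |s| < σ) (a b : ℝ) :
    IntervalIntegrable (fun t => Real.log ‖onLine φ s t‖) volume a b :=
  MeromorphicOn.intervalIntegrable_log_norm fun t _ =>
    (analyticOnNhd_onLine φ hs t (mem_univ t)).meromorphicAt

/-- The mean of log |φ| over horizontal lines is midpoint convex. Birkhoff averages bound a long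
product of translates on the outer lines and three lines bounds it on the middle one; integrating
the logarithm of the product there gives m times the mean, by periodicity. -/
theorem integral_log_midline_le {α : ℝ} (hα : Irrational α) {φ : RH σ} (hφ : φ ≠ 0)
    {s₁ s₂ η₁ η₂ b₁ b₂ : ℝ} (h12 : s₁ ≠ s₂) (h1 : |s₁| < σ) (h2 : |s₂| < σ) (hη₁ : 0 < η₁)
    (hη₂ : 0 < η₂) (hb₁ : logMean η₁ (onLine φ s₁) < b₁) (hb₂ : logMean η₂ (onLine φ s₂) < b₂) :
    ∫ t in (0 : ℝ)..1, Real.log ‖onLine φ ((s₁ + s₂) / 2) t‖ ≤ (b₁ + b₂) / 2 := by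
  wlog hlt : s₁ < s₂ generalizing s₁ s₂ η₁ η₂ b₁ b₂
  · have := this h12.symm h2 h1 hη₂ hη₁ hb₂ hb₁ (lt_of_le_of_ne (not_lt.1 hlt) h12.symm)
    rwa [add_comm s₁, add_comm b₁]
  set s := (s₁ + s₂) / 2 with hs_def
  have hs : |s| < σ := by
    rw [abs_lt] at *
    constructor <;> linarith
  obtain ⟨m₁, hm₁⟩ := norm_onLine_rotProd_le hα φ h1 hη₁ hb₁
  obtain ⟨m₂, hm₂⟩ := norm_onLine_rotProd_le hα φ h2 hη₂ hb₂
  set m := max m₁ m₂ + 1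
  have hm : (0 : ℝ) < m := by positivity
  have hbound : ∀ t, ‖onLine (rotProd α φ m) s t‖ ≤ Real.exp (m * ((b₁ + b₂) / 2)) := by
    intro t
    have h3 := norm_onLine_le_of_three_lines (rotProd α φ m) (s := s) hlt (abs_lt.1 h1).1
      (abs_lt.1 h2).2 ⟨by linarith, by linarith⟩ (hm₁ m (by omega)) (hm₂ m (by omega)) t
    have h4 : (s - s₁) / (s₂ - s₁) = 1 / 2 := by
      rw [div_eq_div_iff (by linarith) (by norm_num)]
      linarith
    rw [h4, ← Real.exp_mul, ← Real.exp_mul, ← Real.exp_add] at h3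
    refine h3.trans (le_of_eq ?_)
    congr 1
    ring
  -- The logarithm of the product splits only where no factor vanishes, which holds almost
  -- everywhere.
  have hne : ∀ᵐ t : ℝ, ∀ k : ℕ, onLine φ s (t + k * α) ≠ 0 := by
    rw [ae_all_iff]
    intro k
    exact (measurePreserving_add_right (volume : Measure ℝ) (k * α)).quasiMeasurePreserving.ae
      (ae_onLine_ne_zero hφ hs)
  have hint : ∀ k : ℕ, IntervalIntegrable (fun t => Real.log ‖onLine φ s (t + k * α)‖) volume 0 1 := by
    intro k
    have := (intervalIntegrable_log_onLine φ hs (0 + k * α) (1 + k * α)).comp_add_right (k * α)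
    simpa using this
  have hsum : ∫ t in (0 : ℝ)..1, ∑ k ∈ Finset.range m, Real.log ‖onLine φ s (t + k * α)‖
      = m * ∫ t in (0 : ℝ)..1, Real.log ‖onLine φ s t‖ := by
    rw [intervalIntegral.integral_finsetSum fun k _ => hint k]
    have hper : Function.Periodic (fun t => Real.log ‖onLine φ s t‖) 1 := fun t => by
      simp only [periodic_onLine φ hs t]
    have : ∀ k : ℕ, ∫ t in (0 : ℝ)..1, Real.log ‖onLine φ s (t + k * α)‖
        = ∫ t in (0 : ℝ)..1, Real.log ‖onLine φ s t‖ := by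
      intro k
      rw [intervalIntegral.integral_comp_add_right (fun t => Real.log ‖onLine φ s t‖)]
      have := hper.intervalIntegral_add_eq (k * α) 0
      rw [zero_add] at this
      rw [zero_add, add_comm 1 ((k : ℝ) * α), this]
    simp [this]
  have hle : ∫ t in (0 : ℝ)..1, ∑ k ∈ Finset.range m, Real.log ‖onLine φ s (t + k * α)‖
      ≤ ∫ t in (0 : ℝ)..1, (m * ((b₁ + b₂) / 2)) := by
    refine intervalIntegral.integral_mono_ae zero_le_one
      (by simpa [Finset.sum_fn] using IntervalIntegrable.sum (Finset.range m) fun k _ => hint k)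
      intervalIntegrable_const ?_
    filter_upwards [hne] with t ht
    rw [← Real.log_prod fun k _ => norm_ne_zero_iff.2 (ht k), ← norm_prod,
      ← onLine_rotProd α φ m hs]
    refine (Real.log_le_iff_le_exp ?_).2 (hbound t)
    rw [norm_pos_iff, onLine_rotProd α φ m hs]
    exact Finset.prod_ne_zero_iff.2 fun k _ => ht k
  rw [hsum] at hle
  simp only [intervalIntegral.integral_const, sub_zero, one_smul] at hle
  exact le_of_mul_le_mul_left hle hm

theorem eventually_onLine_near (φ : RH σ) (hσ : 0 < σ) {ε : ℝ} (hε : 0 < ε) :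
    ∀ᶠ s : ℝ in 𝓝 0, ∀ t ∈ Icc (0 : ℝ) 1, ‖onLine φ s t - onLine φ 0 t‖ ≤ ε := by
  refine isCompact_Icc.eventually_forall_of_forall_eventually fun t _ => ?_
  have hat : ContinuousAt φ (((t : ℝ) : ℂ) + ((0 : ℝ) : ℂ) * Complex.I) :=
    φ.differentiableOn.continuousOn.continuousAt
      ((isOpen_strip σ).mem_nhds (line_mem_strip (by simpa using hσ) t))
  have h1 : ContinuousAt (fun p : ℝ × ℝ => onLine φ p.1 p.2) (0, t) :=
    ContinuousAt.comp (f := fun p : ℝ × ℝ => (p.2 : ℂ) + p.1 * Complex.I) (x := ((0 : ℝ), t))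
      (g := φ) hat (by fun_prop)
  have h2 : ContinuousAt (fun p : ℝ × ℝ => onLine φ 0 p.2) (0, t) :=
    ContinuousAt.comp (f := fun p : ℝ × ℝ => (p.2 : ℂ) + ((0 : ℝ) : ℂ) * Complex.I)
      (x := ((0 : ℝ), t)) (g := φ) hat (by fun_prop)
  have h3 : Tendsto (fun p : ℝ × ℝ => ‖onLine φ p.1 p.2 - onLine φ 0 p.2‖) (𝓝 (0, t)) (𝓝 0) := by
    have := (h1.sub h2).norm
    simpa [ContinuousAt] using this
  filter_upwards [(tendsto_order.1 h3).2 ε hε] with p hp using hp.le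

theorem eventually_abs_lt {r : ℝ} (hr : 0 < r) : ∀ᶠ s : ℝ in 𝓝 0, |s| < r := by
  filter_upwards [Metric.ball_mem_nhds (0 : ℝ) hr] with s hs
  simpa using hs

/-- Zeros are isolated and a period is compact, so nearby lines other than the real axis carry none.
-/
theorem eventually_onLine_ne_zero {φ : RH σ} (hσ : 0 < σ) (hφ : φ ≠ 0) :
    ∀ᶠ s : ℝ in 𝓝 0, s ≠ 0 → ∀ t, onLine φ s t ≠ 0 := by
  have h1 : ∀ᶠ s : ℝ in 𝓝 0, ∀ t ∈ Icc (0 : ℝ) 1, s ≠ 0 → onLine φ s t ≠ 0 := by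
    refine isCompact_Icc.eventually_forall_of_forall_eventually fun t _ => ?_
    have hev : ∀ᶠ z in 𝓝[≠] (t : ℂ), φ z ≠ 0 := by
      by_contra hcon
      exact hφ (φ.eq_zero_of_frequently (ofReal_mem_strip hσ t)
        (by simpa using Filter.not_eventually.1 hcon))
    rw [eventually_nhdsWithin_iff] at hev
    have hc : Tendsto (fun p : ℝ × ℝ => (p.2 : ℂ) + p.1 * Complex.I) (𝓝 (0, t)) (𝓝 (t : ℂ)) := by
      have : Continuous fun p : ℝ × ℝ => (p.2 : ℂ) + p.1 * Complex.I := by fun_prop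
      simpa using this.tendsto (0, t)
    filter_upwards [hc.eventually hev] with p hp hp0
    refine hp fun he => hp0 ?_
    have := congrArg Complex.im he
    simpa using this
  have h2 : ∀ᶠ s : ℝ in 𝓝 0, |s| < σ :=
    eventually_abs_lt hσ
  filter_upwards [h1, h2] with s hs hsσ hs0 t
  have := (periodic_onLine φ hsσ).sub_zsmul_eq (x := t) ⌊t⌋
  rw [← this]
  refine hs _ ⟨?_, ?_⟩ hs0
  · simp
  · have := Int.lt_floor_add_one t
    simp only [zsmul_eq_mul, mul_one]
    linarith

theorem logMean_eq_integral_log {a : ℝ → ℂ} {η : ℝ} (h : ∀ t, η ≤ ‖a t‖) :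
    logMean η a = ∫ t in (0 : ℝ)..1, Real.log ‖a t‖ := by
  rw [logMean]
  congr 1
  funext t
  rw [max_eq_left (h t)]

theorem exists_pos_le_onLine {φ : RH σ} {s : ℝ} (hs : |s| < σ) (h : ∀ t, onLine φ s t ≠ 0) :
    ∃ c > 0, ∀ t, c ≤ ‖onLine φ s t‖ := by
  obtain ⟨t₀, -, ht₀⟩ := isCompact_Icc.exists_isMinOn (nonempty_Icc.2 (zero_le_one (α := ℝ)))
    (continuous_onLine φ hs).norm.continuousOn
  refine ⟨‖onLine φ s t₀‖, norm_pos_iff.2 (h t₀), fun t => ?_⟩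
  rw [← (periodic_onLine φ hs).sub_zsmul_eq (x := t) ⌊t⌋]
  refine ht₀ ⟨?_, ?_⟩
  · simp
  · have := Int.lt_floor_add_one t
    simp only [zsmul_eq_mul, mul_one]
    linarith

/-- Zeros on the real axis could make the exponent jump in the limit, so the comparison is made on
lines at heights ±s, where the limit has no zeros. There convexity for φ i bounds its mean by the
average of c (real axis) and nearly u (height ±2s), where u is the exponent of the limit. Passing to
the limit, and using convexity between -s and s, gives u ≤ c up to ε. -/
theorem logIntegral_le_of_tendsto {ι : Type*} {F : Filter ι} [NeBot F] {α : ℝ}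
    (hα : Irrational α) (hσ : 0 < σ) {φ : ι → RH σ} {φ₀ : RH σ} (hφ : Tendsto φ F (𝓝 φ₀)) {c : ℝ}
    (hc : ∀ᶠ i in F, logIntegral (fun t : ℝ => φ i t) < (c : ℝ)) :
    logIntegral (fun t : ℝ => φ₀ t) ≤ (c : ℝ) := by
  have hline : ∀ ψ : RH σ, (fun t : ℝ => ψ t) = onLine ψ 0 := fun ψ =>
    funext fun t => (onLine_zero ψ t).symm
  simp only [hline] at hc ⊢
  have h0σ : |(0 : ℝ)| < σ := by simpa using hσ
  have hc0 := continuous_onLine φ₀ h0σ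
  rcases eq_or_ne φ₀ 0 with rfl | hne
  · have := logIntegral_le_logMean hc0 (Real.exp_pos c)
    refine this.trans (le_of_eq ?_)
    simp [logMean, onLine, (Real.exp_pos c).le]
  set u := ∫ t in (0 : ℝ)..1, Real.log ‖onLine φ₀ 0 t‖ with hu
  have hexists : ∀ ε > 0, ∃ η > 0, logMean η (onLine φ₀ 0) ≤ u + ε := fun ε hε =>
    exists_logMean_le_integral_log hc0 (intervalIntegrable_log_onLine φ₀ h0σ 0 1)
      (ae_onLine_ne_zero hne h0σ) hε
  -- From u ≤ (c + u + 3ε)/2 + ε + ε/2, where the last term makes an inequality strict, solving for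
  -- u gives c + 6ε.
  suffices hmain : ∀ ε > 0, u ≤ c + 6 * ε by
    by_contra hcon
    obtain ⟨d, hd1, hd2⟩ := EReal.lt_iff_exists_real_btwn.1 (not_le.1 hcon)
    have hd1' : c < d := by exact_mod_cast hd1
    obtain ⟨η, hη, hle⟩ := hexists ((d - c) / 12) (by linarith)
    have h1 := logIntegral_le_logMean hc0 hη
    have h2 := hmain ((d - c) / 12) (by linarith)
    have h3 : d < logMean η (onLine φ₀ 0) := by exact_mod_cast hd2.trans_le h1
    linarith
  intro ε hε
  obtain ⟨η, hη, hJ⟩ := hexists ε hε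
  -- Heights up to 2s must be admissible: s is the midpoint of 0 and 2s.
  obtain ⟨s, hs0, hs⟩ : ∃ s > 0, ∀ v : ℝ, |v| ≤ 2 * s → |v| < σ ∧ (v ≠ 0 → ∀ t, onLine φ₀ v t ≠ 0) ∧
      ∀ t ∈ Icc (0 : ℝ) 1, ‖onLine φ₀ v t - onLine φ₀ 0 t‖ ≤ ε * η := by
    have h1 : ∀ᶠ s : ℝ in 𝓝 0, |s| < σ :=
      eventually_abs_lt hσ
    obtain ⟨r, hr, h⟩ := Metric.eventually_nhds_iff.1 ((h1.and (eventually_onLine_ne_zero hσ hne)).and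
      (eventually_onLine_near φ₀ hσ (mul_pos hε hη)))
    refine ⟨r / 4, by positivity, fun v hv => ?_⟩
    have := h (y := v) (by rw [dist_zero_right, Real.norm_eq_abs]; linarith)
    exact ⟨this.1.1, this.1.2, this.2⟩
  have hside : ∀ v : ℝ, |v| = s → ∃ c' > 0, (∀ t, c' ≤ ‖onLine φ₀ v t‖) ∧
      logMean c' (onLine φ₀ v) ≤ (c + (u + 3 * ε)) / 2 + ε := by
    intro v hv
    have hvσ := hs v (by linarith)
    have hv2 : |2 * v| ≤ 2 * s := by rw [abs_mul, abs_two, hv]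
    have hv2σ := hs (2 * v) hv2
    have hv0 : v ≠ 0 := fun h => by simp [h] at hv; linarith
    obtain ⟨d, hd, hdle⟩ := exists_pos_le_onLine hvσ.1 (hvσ.2.1 hv0)
    have hJ2 : logMean η (onLine φ₀ (2 * v)) ≤ u + 2 * ε := by
      have := logMean_le_add (continuous_onLine φ₀ hv2σ.1) hc0 hη hv2σ.2.2
      rw [mul_div_cancel_right₀ _ hη.ne'] at this
      linarith
    have hclose : ∀ κ > 0, ∀ᶠ i in F, ‖φ i - φ₀‖ ≤ κ := fun κ hκ => by
      filter_upwards [(Metric.tendsto_nhds.1 hφ) κ hκ] with i hi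
      rw [dist_eq_norm] at hi
      exact hi.le
    have hnear : ∀ i (κ w : ℝ), ‖φ i - φ₀‖ ≤ κ → ∀ t, ‖onLine (φ i) w t - onLine φ₀ w t‖ ≤ κ :=
      fun i κ w h t => by
        have := (RH.norm_apply_le (φ i - φ₀) (t + w * Complex.I)).trans h
        rwa [RH.sub_apply] at this
    obtain ⟨i, hi, hi1, hi2, hi3⟩ := (hc.and ((hclose (d / 2) (by positivity)).and
      ((hclose (ε / 2 * η) (by positivity)).and
        (hclose (ε * (d / 2)) (by positivity))))).exists
    have hge : ∀ t, d / 2 ≤ ‖onLine (φ i) v t‖ := fun t => by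
      have h1 := hdle t
      have h2 := hnear i _ v hi1 t
      have h3 : ‖onLine φ₀ v t‖ ≤ ‖onLine (φ i) v t‖ + ‖onLine (φ i) v t - onLine φ₀ v t‖ := by
        rw [norm_sub_rev]
        calc ‖onLine φ₀ v t‖ = ‖onLine (φ i) v t + (onLine φ₀ v t - onLine (φ i) v t)‖ := by
              congr 1; ring
          _ ≤ _ := norm_add_le _ _
      linarith
    have hine : φ i ≠ 0 := fun h => by
      have := hge 0
      rw [h, onLine, RH.zero_apply, norm_zero] at this
      linarith
    obtain ⟨η₁, hη₁, hJ1⟩ := exists_logMean_lt (continuous_onLine (φ i) h0σ) hi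
    have hJi : logMean η (onLine (φ i) (2 * v)) < u + 3 * ε := by
      have := logMean_le_add (continuous_onLine (φ i) hv2σ.1) (continuous_onLine φ₀ hv2σ.1) hη
        fun t _ => hnear i _ (2 * v) hi2 t
      rw [mul_div_cancel_right₀ _ hη.ne'] at this
      linarith
    have hmid := integral_log_midline_le hα hine (s₁ := 0) (s₂ := 2 * v)
      (fun h => hv0 (by linarith)) h0σ hv2σ.1 hη₁ hη hJ1 hJi
    have hv' : (0 + 2 * v) / 2 = v := by ring
    rw [hv', ← logMean_eq_integral_log hge] at hmid
    refine ⟨d / 2, half_pos hd, fun t => (by linarith [hdle t]), ?_⟩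
    have := logMean_le_add (continuous_onLine φ₀ hvσ.1) (continuous_onLine (φ i) hvσ.1) (half_pos hd)
      (δ := ε * (d / 2)) fun t _ => by
        rw [norm_sub_rev]
        exact hnear i _ v hi3 t
    rw [mul_div_cancel_right₀ _ (half_pos hd).ne'] at this
    linarith
  obtain ⟨c₁, hc₁, -, hb₁⟩ := hside (-s) (by rw [abs_neg, abs_of_pos hs0])
  obtain ⟨c₂, hc₂, -, hb₂⟩ := hside s (abs_of_pos hs0)
  have hmid := integral_log_midline_le hα hne (s₁ := -s) (s₂ := s) (by linarith)
    (hs _ (by rw [abs_neg, abs_of_pos hs0]; linarith)).1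
    (hs _ (by rw [abs_of_pos hs0]; linarith)).1 hc₁ hc₂
    (lt_of_le_of_lt hb₁ (lt_add_of_pos_right _ (by positivity : 0 < ε / 2)))
    (lt_of_le_of_lt hb₂ (lt_add_of_pos_right _ (by positivity : 0 < ε / 2)))
  have hs' : (-s + s) / 2 = 0 := by ring
  rw [hs', ← hu] at hmid
  linarith

end LogSemicontinuity

/-! ### Joint analyticity of evaluation at a real point. -/

section Evaluation

variable {σ : ℝ}

/-- The derivative of a function of a parameter and a real variable in the real variable. -/
def partialSnd {E : Type*} [NormedAddCommGroup E] [NormedSpace ℝ E] (F : E × ℝ → ℝ) (p : E × ℝ) : ℝ :=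
  fderiv ℝ F p (0, 1)

theorem contDiffAt_partialSnd {E : Type*} [NormedAddCommGroup E] [NormedSpace ℝ E] {F : E × ℝ → ℝ}
    {p : E × ℝ} (h : ContDiffAt ℝ ⊤ F p) : ContDiffAt ℝ ⊤ (partialSnd F) p :=
  (h.fderiv_right (m := ⊤) le_rfl).clm_apply contDiffAt_const

theorem hasDerivAt_partialSnd {E : Type*} [NormedAddCommGroup E] [NormedSpace ℝ E] {F : E × ℝ → ℝ}
    {g : E} {t : ℝ} (h : ContDiffAt ℝ ⊤ F (g, t)) :
    HasDerivAt (fun t => F (g, t)) (partialSnd F (g, t)) t :=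
  (h.differentiableAt (by simp)).hasFDerivAt.comp_hasDerivAt t
    ((hasDerivAt_const t g).prodMk (hasDerivAt_id t))

/-- The real value of an element of `RH σ` at a real point. -/
def reEval (p : RH σ × ℝ) : ℝ := (p.1 p.2).re

theorem ofReal_reEval (φ : RH σ) (t : ℝ) : ((reEval (φ, t) : ℝ) : ℂ) = φ t := φ.ofReal_re_apply t

theorem reEval_mul (φ ψ : RH σ) (t : ℝ) : reEval (φ * ψ, t) = reEval (φ, t) * reEval (ψ, t) := by
  apply Complex.ofReal_injective
  rw [Complex.ofReal_mul, ofReal_reEval, ofReal_reEval, ofReal_reEval, RH.mul_apply]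

theorem reEval_eq_zero_iff (φ : RH σ) (t : ℝ) : reEval (φ, t) = 0 ↔ φ t = 0 := by
  rw [← ofReal_reEval, Complex.ofReal_eq_zero]

theorem reEval_add_int (hσ : 0 < σ) (φ : RH σ) (t : ℝ) (k : ℤ) :
    reEval (φ, t + k) = reEval (φ, t) := by
  have := φ.apply_add_int (subset_closure (ofReal_mem_strip hσ t)) k
  simp only [reEval]
  rw [← this]
  push_cast
  rfl

theorem exists_taylorFunctional (hσ : 0 < σ) (t : ℝ) (k : ℕ) :
    ∃ l : RH σ →L[ℝ] ℝ, ‖l‖ * (σ / 2) ^ k ≤ 1 ∧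
      ∀ φ : RH σ, l φ = ((k.factorial : ℂ)⁻¹ * iteratedDeriv k φ t).re := by
  have hcd : ∀ φ : RH σ, ContDiffAt ℂ k φ (t : ℂ) := fun φ =>
    (φ.differentiableOn.analyticAt ((isOpen_strip σ).mem_nhds (ofReal_mem_strip hσ t))).contDiffAt
  have hfac : (0 : ℝ) < k.factorial := by positivity
  let L : RH σ →ₗ[ℝ] ℝ :=
    { toFun := fun φ => ((k.factorial : ℂ)⁻¹ * iteratedDeriv k φ t).re
      map_add' := fun φ ψ => by
        have : ((φ + ψ : RH σ) : ℂ → ℂ) = (φ : ℂ → ℂ) + ψ := funext fun θ => RH.add_apply φ ψ θ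
        rw [this, iteratedDeriv_add (hcd φ) (hcd ψ), mul_add, Complex.add_re]
      map_smul' := fun c φ => by
        have : ((c • φ : RH σ) : ℂ → ℂ) = fun θ => (c : ℂ) * φ θ :=
          funext fun θ => RH.smul_apply c φ θ
        rw [this, iteratedDeriv_const_mul _ (hcd φ), mul_left_comm, Complex.re_ofReal_mul]
        rfl }
  have hL : ∀ φ, ‖L φ‖ ≤ 1 / (σ / 2) ^ k * ‖φ‖ := fun φ => by
    have h1 : ‖iteratedDeriv k φ (t : ℂ)‖ ≤ k.factorial * ‖φ‖ / (σ / 2) ^ k := by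
      refine Complex.norm_iteratedDeriv_le_of_forall_mem_sphere_norm_le k (half_pos hσ) ?_
        fun z _ => φ.norm_apply_le z
      refine DifferentiableOn.diffContOnCl (φ.differentiableOn.mono ?_)
      exact (closure_ball_subset_closedBall.trans (closedBall_subset_ball (half_lt_self hσ))).trans
        (ball_subset_strip (by simp))
    have h2 : ‖(k.factorial : ℂ)⁻¹ * iteratedDeriv k φ (t : ℂ)‖ ≤ 1 / (σ / 2) ^ k * ‖φ‖ := by
      rw [norm_mul, norm_inv, Complex.norm_natCast]
      calc _ ≤ (k.factorial : ℝ)⁻¹ * (k.factorial * ‖φ‖ / (σ / 2) ^ k) := by gcongr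
        _ = _ := by field_simp
    exact (Complex.abs_re_le_norm _).trans h2
  refine ⟨L.mkContinuous _ hL, ?_, fun φ => rfl⟩
  have := L.mkContinuous_norm_le (by positivity) hL
  rwa [le_div_iff₀ (by positivity)] at this

/-- Evaluation is linear in φ. As a function of the point with values in the dual of `RH σ` it is a
power series, whose coefficients, the Taylor functionals, satisfy Cauchy's bounds; so it is analytic
in both variables together. -/
theorem contDiffAt_reEval (hσ : 0 < σ) (p : RH σ × ℝ) : ContDiffAt ℝ ⊤ (reEval : RH σ × ℝ → ℝ) p := by
  obtain ⟨φ, t⟩ := p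
  choose l hl hlk using exists_taylorFunctional hσ t
  obtain ⟨F, hF, hsum⟩ := exists_analyticOnNhd_hasSum (A := ℝ) (V := RH σ →L[ℝ] ℝ)
    (fun k => ContinuousLinearMap.smulRight (1 : ℝ →L[ℝ] ℝ) (l k)) (half_pos hσ) (K := 1)
    fun k => by simpa using hl k
  have hval : ∀ s : ℝ, |s| < σ / 2 → ∀ ψ : RH σ, F s ψ = reEval (ψ, t + s) := by
    intro s hs ψ
    have h1 := (ContinuousLinearMap.apply ℝ ℝ ψ).hasSum (hsum s (by simpa using hs))
    have h2 := Complex.hasSum_taylorSeries_on_ball (c := (t : ℂ)) (r := σ) (ψ.differentiableOn.mono (ball_subset_strip (R := σ) (by simp)))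
      (z := t + s) (by simpa using hs.trans (half_lt_self hσ))
    have h3 := Complex.reCLM.hasSum h2
    have h4 : (fun k => Complex.reCLM ((k.factorial : ℂ)⁻¹ • ((t : ℂ) + s - t) ^ k •
        iteratedDeriv k ψ t)) = fun k => ContinuousLinearMap.apply ℝ ℝ ψ
          (ContinuousLinearMap.smulRight (1 : ℝ →L[ℝ] ℝ) (l k) (s ^ k)) := by
      funext k
      change Complex.re _ = s ^ k * l k ψ
      rw [hlk, smul_eq_mul, smul_eq_mul, add_sub_cancel_left, mul_left_comm, ← Complex.ofReal_pow,
        Complex.re_ofReal_mul]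
    rw [h4] at h3
    have h5 := h1.unique h3
    simpa [reEval] using h5
  have hFt : ContDiffAt ℝ ⊤ F (t - t) := by
    rw [sub_self]
    exact (hF 0 (mem_ball_self (half_pos hσ))).contDiffAt
  have h1 : ContDiffAt ℝ ⊤ (fun p : RH σ × ℝ => F (p.2 - t) p.1) (φ, t) :=
    (ContDiffAt.comp (φ, t) hFt (f := fun p : RH σ × ℝ => p.2 - t)
      (contDiffAt_snd.sub contDiffAt_const)).clm_apply contDiffAt_fst
  refine h1.congr_of_eventuallyEq ?_
  have hc : Continuous fun p : RH σ × ℝ => p.2 - t := by fun_prop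
  have := (hc.tendsto (φ, t)).eventually (by
    simpa using eventually_abs_lt (half_pos hσ))
  filter_upwards [this] with p hp
  rw [hval _ hp, add_sub_cancel]

end Evaluation

/-! ### Extremum zero versus double zero. -/

section Extremum

variable {σ : ℝ}

/-- A convex function lies above its tangent, which is zero at a double zero. -/
theorem nonneg_of_second_deriv_pos {u u₁ u₂ : ℝ → ℝ} {a b p : ℝ} (hp : p ∈ Ioo a b)
    (h1 : ∀ t ∈ Ioo a b, HasDerivAt u (u₁ t) t) (h2 : ∀ t ∈ Ioo a b, HasDerivAt u₁ (u₂ t) t)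
    (hpos : ∀ t ∈ Ioo a b, 0 < u₂ t) (hu : u p = 0) (hu₁ : u₁ p = 0) {t : ℝ} (ht : t ∈ Ioo a b) :
    0 ≤ u t := by
  have hconv : ConvexOn ℝ (Ioo a b) u := by
    refine convexOn_of_hasDerivWithinAt2_nonneg (f' := u₁) (f'' := u₂) (convex_Ioo a b)
      (fun t ht => (h1 t ht).continuousAt.continuousWithinAt) ?_ ?_ ?_
    all_goals rw [interior_Ioo]; intro t ht
    · exact (h1 t ht).hasDerivWithinAt
    · exact (h2 t ht).hasDerivWithinAt
    · exact (hpos t ht).le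
  have hd := h1 p hp
  rw [hu₁] at hd
  rcases lt_trichotomy p t with h | rfl | h
  · have := hconv.le_slope_of_hasDerivAt hp ht h hd
    rw [slope_def_field, hu, sub_zero] at this
    by_contra hneg
    exact absurd this (not_le.2 (div_neg_of_neg_of_pos (not_le.1 hneg) (sub_pos.2 h)))
  · exact hu.ge
  · have := hconv.slope_le_of_hasDerivAt ht hp h hd
    rw [slope_def_field, hu, zero_sub] at this
    by_contra hneg
    exact absurd this (not_le.2 (div_pos (neg_pos.2 (not_le.1 hneg)) (sub_pos.2 h)))

/-- Near a function whose minimum is `0` and is attained at a single non-degenerate point, having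
minimum `0` amounts to having a double zero near that point. -/
theorem eventually_isLeast_iff (hσ : 0 < σ) {s : ℝ} {φ₀ : RH σ} {θ₀ : ℝ}
    (hnn : ∀ t, 0 ≤ s * reEval (φ₀, t))
    (huniq : ∀ t : ℝ, reEval (φ₀, t) = 0 → ∃ k : ℤ, t = θ₀ + k) (hs : s ≠ 0)
    (h2 : 0 < s * partialSnd (partialSnd reEval) (φ₀, θ₀)) :
    ∃ δ₀ > 0, ∀ δ > 0, δ ≤ δ₀ → ∀ᶠ φ in 𝓝 φ₀,
      (IsLeast (range fun t : ℝ => s * reEval (φ, t)) 0 ↔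
        ∃ p, |p - θ₀| < δ ∧ reEval (φ, p) = 0 ∧ partialSnd reEval (φ, p) = 0) := by
  have hC := contDiffAt_reEval hσ
  have hcont2 : ContinuousAt (fun p : RH σ × ℝ => s * partialSnd (partialSnd reEval) p) (φ₀, θ₀) :=
    continuousAt_const.mul (contDiffAt_partialSnd (contDiffAt_partialSnd (hC _))).continuousAt
  have hev := hcont2.eventually (lt_mem_nhds h2)
  rw [nhds_prod_eq] at hev
  obtain ⟨P, hP, Q, hQ, hPQ⟩ := eventually_prod_iff.1 hev
  obtain ⟨δ₀, hδ₀, hball⟩ := Metric.eventually_nhds_iff.1 hQ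
  refine ⟨min δ₀ (1 / 4), by positivity, fun δ hδ hδle => ?_⟩
  have hδ1 : δ ≤ δ₀ := hδle.trans (min_le_left _ _)
  have hK : IsCompact (Icc (θ₀ - 1 / 2) (θ₀ + 1 / 2) ∩ {t | δ ≤ |t - θ₀|}) :=
    isCompact_Icc.inter_right (isClosed_le continuous_const (by fun_prop))
  -- Away from θ₀, within one period, the limit function is strictly positive by uniqueness of the
  -- minimum; compactness makes this stable.
  have hfar : ∀ᶠ φ in 𝓝 φ₀, ∀ t ∈ Icc (θ₀ - 1 / 2) (θ₀ + 1 / 2) ∩ {t | δ ≤ |t - θ₀|},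
      0 < s * reEval (φ, t) := by
    refine hK.eventually_forall_of_forall_eventually fun t ht => ?_
    have hpos : 0 < s * reEval (φ₀, t) := by
      refine lt_of_le_of_ne (hnn t) fun h0 => ?_
      obtain ⟨k, hk⟩ := huniq t ((mul_eq_zero.1 h0.symm).resolve_left hs)
      have h5 : δ ≤ |(k : ℝ)| := by simpa [hk] using ht.2
      have hk0 : k ≠ 0 := by
        rintro rfl
        simp at h5
        linarith
      have h6 : (1 : ℝ) ≤ |(k : ℝ)| := by exact_mod_cast Int.one_le_abs hk0
      have h7 : |(k : ℝ)| ≤ 1 / 2 := by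
        rw [abs_le]
        constructor <;> linarith [ht.1.1, ht.1.2]
      linarith
    exact (continuousAt_const.mul (hC (φ₀, t)).continuousAt).eventually (lt_mem_nhds hpos)
  filter_upwards [hP, hfar] with φ hφP hφfar
  have hd1 : ∀ t, HasDerivAt (fun t => s * reEval (φ, t)) (s * partialSnd reEval (φ, t)) t :=
    fun t => (hasDerivAt_partialSnd (hC _)).const_mul s
  have hd2 : ∀ t, HasDerivAt (fun t => s * partialSnd reEval (φ, t))
      (s * partialSnd (partialSnd reEval) (φ, t)) t :=
    fun t => (hasDerivAt_partialSnd (contDiffAt_partialSnd (hC _))).const_mul s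
  have hred : ∀ t : ℝ, ∃ t' ∈ Icc (θ₀ - 1 / 2) (θ₀ + 1 / 2), reEval (φ, t) = reEval (φ, t') := by
    intro t
    refine ⟨t - (round (t - θ₀) : ℤ), ?_, ?_⟩
    · have := abs_le.1 (abs_sub_round (t - θ₀))
      constructor <;> linarith [this.1, this.2]
    · have := reEval_add_int hσ φ (t - (round (t - θ₀) : ℤ)) (round (t - θ₀))
      rwa [sub_add_cancel] at this
  have hIoo : ∀ t, |t - θ₀| < δ ↔ t ∈ Ioo (θ₀ - δ) (θ₀ + δ) := fun t => by
    rw [abs_lt, mem_Ioo]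
    constructor <;> rintro ⟨h1, h2⟩ <;> constructor <;> linarith
  constructor
  · rintro ⟨⟨t, ht⟩, hlb⟩
    have hlb' : ∀ t, 0 ≤ s * reEval (φ, t) := fun t => hlb ⟨t, rfl⟩
    obtain ⟨t', ht', heq⟩ := hred t
    simp only [heq] at ht
    refine ⟨t', ?_, (mul_eq_zero.1 ht).resolve_left hs, ?_⟩
    · by_contra hcon
      exact (hφfar t' ⟨ht', not_lt.1 hcon⟩).ne' ht
    · have hmin : IsLocalMin (fun t => s * reEval (φ, t)) t' :=
        Eventually.of_forall fun v => by simpa only [ht] using hlb' v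
      exact (mul_eq_zero.1 (hmin.hasDerivAt_eq_zero (hd1 t'))).resolve_left hs
  · rintro ⟨p, hp, h0, h1⟩
    refine ⟨⟨p, by simp [h0]⟩, ?_⟩
    rintro _ ⟨t, rfl⟩
    obtain ⟨t', ht', heq⟩ := hred t
    simp only [heq]
    by_cases hcase : |t' - θ₀| < δ
    · refine nonneg_of_second_deriv_pos ((hIoo p).1 hp) (fun t _ => hd1 t) (fun t _ => hd2 t)
        (fun t ht => ?_) (by simp [h0]) (by simp [h1]) ((hIoo t').1 hcase)
      exact hPQ hφP (hball (by
        rw [Real.dist_eq]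
        exact ((hIoo t).2 ht).trans_le hδ1))
    · exact (hφfar t' ⟨ht', not_lt.1 hcase⟩).le

end Extremum

/-! ### Elimination of the position of the zero. -/

section DefiningFunction

variable {E : Type*} [NormedAddCommGroup E] [NormedSpace ℝ E]

theorem isInvertible_of_apply_one_ne_zero {L : ℝ →L[ℝ] ℝ} (h : L 1 ≠ 0) : L.IsInvertible := by
  refine ⟨ContinuousLinearEquiv.unitsEquivAut ℝ (Units.mk0 _ h), ?_⟩
  ext
  simp

theorem hasDerivAt_add_smul (f h : E) : HasDerivAt (fun s : ℝ => f + s • h) h 0 := by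
  simpa using ((hasDerivAt_id (0 : ℝ)).smul_const h).const_add f

theorem tendsto_add_smul (f h : E) : Tendsto (fun s : ℝ => f + s • h) (𝓝 0) (𝓝 f) := by
  simpa using (hasDerivAt_add_smul f h).continuousAt.tendsto

theorem _root_.HasFDerivAt.hasDerivAt_add_smul {F : Type*} [NormedAddCommGroup F] [NormedSpace ℝ F]
    {Φ : E → F} {L : E →L[ℝ] F} {f : E} (hΦ : HasFDerivAt Φ L f) (h : E) :
    HasDerivAt (fun s : ℝ => Φ (f + s • h)) (L h) 0 := by
  have hΦ' : HasFDerivAt Φ L (f + (0 : ℝ) • h) := by simpa using hΦ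
  exact hΦ'.comp_hasDerivAt (f := fun s : ℝ => f + s • h) 0 (QPForced.hasDerivAt_add_smul f h)

/-- The equation D(g, p) = 0 is solved as p = T(g), and Φ(g) = C(g, T(g)). Along h the derivative of
Φ is w plus a term through the motion of T; `halt` kills this term, either because C is stationary
in p or because T does not move along h. -/
theorem exists_definingFunction [CompleteSpace E] {C D : E × ℝ → ℝ} {f : E} {θ₀ : ℝ}
    (hC : ContDiffAt ℝ ⊤ C (f, θ₀)) (hD : ContDiffAt ℝ ⊤ D (f, θ₀)) (hD0 : D (f, θ₀) = 0)
    (hDθ : partialSnd D (f, θ₀) ≠ 0) {h : E} {w : ℝ} (hw : w ≠ 0)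
    (hder : HasDerivAt (fun s : ℝ => C (f + s • h, θ₀)) w 0)
    (halt : partialSnd C (f, θ₀) = 0 ∨ ∀ᶠ s : ℝ in 𝓝 0, D (f + s • h, θ₀) = 0) :
    ∃ Φ : E → ℝ, ContDiffAt ℝ ⊤ Φ f ∧ fderiv ℝ Φ f ≠ 0 ∧ ∃ δ₀ > 0, ∀ δ > 0, δ ≤ δ₀ →
      ∀ᶠ g in 𝓝 f, (Φ g = 0 ↔ ∃ p, |p - θ₀| < δ ∧ C (g, p) = 0 ∧ D (g, p) = 0) := by
  have hi : (fderiv ℝ D (f, θ₀) ∘L .inr ℝ E ℝ).IsInvertible :=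
    isInvertible_of_apply_one_ne_zero (by simpa [partialSnd] using hDθ)
  have htop : (⊤ : WithTop ℕ∞) ≠ 0 := by simp
  set T := hD.implicitFunction htop hi with hTdef
  have hT : ContDiffAt ℝ ⊤ T f := hD.contDiffAt_implicitFunction htop hi
  have hTf : T f = θ₀ := hD.implicitFunction_apply_self htop hi
  have hT0 : ∀ᶠ p in 𝓝 (f, θ₀), D p = 0 ↔ T p.1 = p.2 := by
    filter_upwards [hD.eventually_apply_eq_iff_implicitFunction htop hi] with p hp
    rw [← hp, hD0]
  have hΦ : ContDiffAt ℝ ⊤ (fun g => C (g, T g)) f := by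
    refine ContDiffAt.comp f (g := C) (f := fun g => (g, T g)) ?_ (contDiffAt_id.prodMk hT)
    rwa [hTf]
  refine ⟨fun g => C (g, T g), hΦ, fun h0 => hw ?_, ?_⟩
  · have h1 := ((hΦ.differentiableAt htop).hasFDerivAt).hasDerivAt_add_smul h
    rw [h0] at h1
    rcases halt with halt | halt
    · have hC1 := (hC.differentiableAt htop).hasFDerivAt
      have hC2 : HasFDerivAt C (fderiv ℝ C (f, θ₀)) (f, T f) := by rwa [hTf]
      have h2 := (hC2.comp f (f := fun g => (g, T g)) ((hasFDerivAt_id f).prodMk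
        (hT.differentiableAt htop).hasFDerivAt)).hasDerivAt_add_smul h
      have h3 : HasDerivAt (fun s : ℝ => C (f + s • h, θ₀)) (fderiv ℝ C (f, θ₀) (h, 0)) 0 :=
        (hC1.comp f (f := fun g => (g, θ₀)) ((hasFDerivAt_id f).prodMk
          (hasFDerivAt_const θ₀ f))).hasDerivAt_add_smul h
      have h4 : fderiv ℝ C (f, θ₀) (h, fderiv ℝ T f h) = 0 := h2.unique h1
      have h5 : ((h, fderiv ℝ T f h) : E × ℝ) = (h, 0) + fderiv ℝ T f h • ((0 : E), (1 : ℝ)) := by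
        simp
      rw [h5, map_add, map_smul, ← partialSnd, halt, smul_zero, add_zero] at h4
      exact (hder.unique h3).trans h4
    · refine hder.unique (h1.congr_of_eventuallyEq ?_)
      have hT1 : ∀ᶠ g in 𝓝 f, D (g, θ₀) = 0 ↔ T g = θ₀ :=
        ((continuous_id.prodMk continuous_const).tendsto f).eventually hT0
      filter_upwards [halt, (tendsto_add_smul f h).eventually hT1] with s hs hs1
      rw [hs1.1 hs]
  · rw [nhds_prod_eq] at hT0
    obtain ⟨P, hP, Q, hQ, hPQ⟩ := eventually_prod_iff.1 hT0
    obtain ⟨δ₀, hδ₀, hball⟩ := Metric.eventually_nhds_iff.1 hQ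
    refine ⟨δ₀, hδ₀, fun δ hδ hle => ?_⟩
    have hnear : ∀ᶠ g in 𝓝 f, |T g - θ₀| < δ := by
      have := hT.continuousAt.eventually (Metric.ball_mem_nhds (T f) hδ)
      filter_upwards [this] with g hg
      rwa [hTf, Real.dist_eq] at hg
    filter_upwards [hP, hnear] with g hg hgn
    have key : ∀ p, |p - θ₀| < δ → (D (g, p) = 0 ↔ T g = p) := fun p hp =>
      hPQ hg (hball (by rw [Real.dist_eq]; exact hp.trans_le hle))
    constructor
    · intro h0
      exact ⟨T g, hgn, h0, (key _ hgn).2 rfl⟩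
    · rintro ⟨p, hp, h1, h2⟩
      rw [(key p hp).1 h2]
      exact h1

theorem isCodimOneManifoldNear_of_eventually {S : Set E} {f : E} {Φ : E → ℝ}
    (hΦ : ContDiffAt ℝ ⊤ Φ f) (h0 : fderiv ℝ Φ f ≠ 0) (hf : f ∈ S)
    (h : ∀ᶠ g in 𝓝 f, (g ∈ S ↔ Φ g = 0)) : IsCodimOneManifoldNear S f := by
  have h1 : ∀ᶠ g in 𝓝 f, fderiv ℝ Φ g ≠ 0 :=
    (hΦ.fderiv_right (m := ⊤) le_rfl).continuousAt.eventually (isOpen_ne.mem_nhds h0)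
  have h2 : ∀ᶠ g in 𝓝 f, ContDiffAt ℝ ⊤ Φ g := hΦ.eventually (by simp)
  obtain ⟨U, hU, hUo, hfU⟩ := _root_.eventually_nhds_iff.1 (h.and (h1.and h2))
  refine ⟨hf, U, hUo, hfU, Φ, fun g hg => ((hU g hg).2.2.of_le le_top).contDiffWithinAt,
    fun g hg => (hU g hg).2.1, ?_⟩
  ext g
  constructor
  · rintro ⟨hgS, hgU⟩
    exact ⟨hgU, (hU g hgU).1.1 hgS⟩
  · rintro ⟨hgU, hg⟩
    exact ⟨(hU g hgU).1.2 hg, hgU⟩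

end DefiningFunction

/-! ### Perturbations that keep the orbit of a curve. -/

section Direction

variable {σ : ℝ} {W : Set ℂ} {ω : ℝ}

theorem Maps.exists_of (hσ : 0 < σ) {u : ℂ × ℂ → ℂ} {K : ℝ} (hc : Continuous
    fun p : dom σ W => u p) (hd : DifferentiableOn ℂ u (strip σ ×ˢ W))
    (hr : ∀ t x : ℝ, (u (t, x)).im = 0) (hp : ∀ θ ∈ strip σ, ∀ z, u (θ + 1, z) = u (θ, z))
    (hK : ∀ p ∈ dom σ W, ‖u p‖ ≤ K) : ∃ h : Maps σ W, ∀ p ∈ dom σ W, ev h.1 p = u p := by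
  let φ : dom σ W →ᵇ ℂ := BoundedContinuousFunction.ofNormedAddCommGroup
    (fun w => u w) hc K fun w => hK w w.2
  have key : ∀ p ∈ dom σ W, ev φ p = u p := fun p hp => by
    rw [ev_of_mem _ hp]
    rfl
  refine ⟨⟨φ, ?_, ?_, ?_⟩, key⟩
  · exact hd.congr fun p hp => key p (strip_prod_subset_dom hp)
  · intro t x hx
    rw [key _ (strip_prod_subset_dom ⟨ofReal_mem_strip hσ t, hx⟩), hr]
  · intro θ hθ z hz
    have hθ1 : θ + 1 ∈ strip σ := by simpa using add_ofReal_mem_strip hθ 1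
    rw [key (θ + 1, z) (strip_prod_subset_dom ⟨hθ1, hz⟩), key (θ, z) (strip_prod_subset_dom ⟨hθ, hz⟩),
      hp θ hθ]

theorem deriv_sub_mul {P : ℂ → ℂ} (a : ℂ) (hP : Differentiable ℂ P) :
    deriv (fun w => (w - a) * P w) a = P a := by
  have := ((hasDerivAt_id a).sub_const a).fun_mul (hP a).hasDerivAt
  simpa using this.deriv

/-- A map that vanishes on the curves `y i`, `i ∈ insert i₀ S`, to second order for `i ≠ i₀`. -/
theorem exists_direction (hσ : 0 < σ) (hW : IsOpen W) (hWb : Bornology.IsBounded W)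
    {y : ℕ → RH σ} {i₀ : ℕ} {S : Finset ℕ} (hi₀ : y i₀ ∈ inner σ W) (hS : ∀ i ∈ S, y i ∈ inner σ W) :
    ∃ h : Maps σ W, comp (y i₀) h = 0 ∧ (∀ i ∈ S, comp (y i) h = 0 ∧ compDeriv h (y i) = 0) ∧
      ∀ θ ∈ strip σ, compDeriv h (y i₀) θ = ∏ i ∈ S, (y i₀ θ - y i θ) ^ 2 := by
  obtain ⟨K, hK⟩ := hWb.closure.exists_norm_le
  -- A simple zero on the chosen curve and double zeros on the others; bounded because W is.
  let u : ℂ × ℂ → ℂ := fun p => (p.2 - y i₀ p.1) * ∏ i ∈ S, (p.2 - y i p.1) ^ 2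
  have hdom : ∀ p ∈ dom σ W, p.1 ∈ closure (strip σ) ∧ p.2 ∈ closure W := fun p hp => by
    rwa [dom_eq] at hp
  have hyc : ∀ i, Continuous fun p : dom σ W => y i (p : ℂ × ℂ).1 := fun i =>
    (y i).continuousOn.comp_continuous (continuous_fst.comp continuous_subtype_val)
      fun p => (hdom p p.2).1
  have hyd : ∀ i, DifferentiableOn ℂ (fun p : ℂ × ℂ => y i p.1) (strip σ ×ˢ W) := fun i =>
    (y i).differentiableOn.comp differentiableOn_fst fun p hp => hp.1
  have hsub : ∀ i, ∀ p ∈ dom σ W, ‖p.2 - y i p.1‖ ≤ K + ‖y i‖ := fun i p hp =>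
    (norm_sub_le _ _).trans (add_le_add (hK _ (hdom p hp).2) ((y i).norm_apply_le _))
  obtain ⟨h, hh⟩ : ∃ h : Maps σ W, ∀ p ∈ dom σ W, ev h.1 p = u p := by
    refine Maps.exists_of hσ (K := (K + ‖y i₀‖) * ∏ i ∈ S, (K + ‖y i‖) ^ 2) ?_ ?_ ?_ ?_ ?_
    · have : Continuous fun p : dom σ W => (p : ℂ × ℂ).2 := continuous_snd.comp continuous_subtype_val
      exact (this.sub (hyc i₀)).mul (continuous_finsetProd _ fun i _ => (this.sub (hyc i)).pow 2)
    · exact (differentiableOn_snd.sub (hyd i₀)).mul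
        fun p hp => (HasFDerivWithinAt.finsetProd fun i _ =>
          ((differentiableOn_snd.sub (hyd i)).pow 2 p hp).hasFDerivWithinAt).differentiableWithinAt
    · intro t x
      have : u (t, x) = (((x - (y i₀ t).re) * ∏ i ∈ S, (x - (y i t).re) ^ 2 : ℝ) : ℂ) := by
        simp only [u]
        push_cast
        simp only [RH.ofReal_re_apply]
      rw [this, Complex.ofReal_im]
    · intro θ hθ z
      simp only [u, (y _).apply_add_one (subset_closure hθ)]
    · intro p hp
      simp only [u, norm_mul, norm_prod, norm_pow]
      have h0 : ∀ i, 0 ≤ K + ‖y i‖ := fun i => (norm_nonneg _).trans (hsub i p hp)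
      exact mul_le_mul (hsub i₀ p hp) (Finset.prod_le_prod (fun i _ => by positivity)
        fun i _ => pow_le_pow_left₀ (norm_nonneg _) (hsub i p hp) 2) (by positivity) (h0 i₀)
  have hderiv : ∀ θ ∈ strip σ, ∀ z ∈ W, deriv (fun w => ev h.1 (θ, w)) z
      = deriv (fun w => u (θ, w)) z := fun θ hθ z hz => by
    refine EventuallyEq.deriv_eq ?_
    filter_upwards [hW.mem_nhds hz] with w hw
    exact hh _ (strip_prod_subset_dom ⟨hθ, hw⟩)
  have happ : ∀ i, y i ∈ inner σ W → ∀ θ ∈ strip σ, comp (y i) h θ = u (θ, y i θ) :=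
    fun i hi θ hθ => by
      rw [comp_apply hσ hi h (subset_closure hθ)]
      exact hh _ (strip_prod_subset_dom ⟨hθ, mem_of_mem_inner hi (subset_closure hθ)⟩)
  have happ' : ∀ i, y i ∈ inner σ W → ∀ θ ∈ strip σ, compDeriv h (y i) θ
      = deriv (fun w => u (θ, w)) (y i θ) := fun i hi θ hθ => by
    rw [compDeriv_apply hσ hW hi h hθ]
    exact hderiv θ hθ _ (mem_of_mem_inner hi (subset_closure hθ))
  refine ⟨h, ?_, fun i hi => ⟨?_, ?_⟩, fun θ hθ => ?_⟩
  · refine RH.ext_of_strip fun θ hθ => ?_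
    rw [happ i₀ hi₀ θ hθ, RH.zero_apply]
    simp [u]
  · refine RH.ext_of_strip fun θ hθ => ?_
    rw [happ i (hS i hi) θ hθ, RH.zero_apply]
    exact mul_eq_zero_of_right _ (Finset.prod_eq_zero hi (by simp))
  · refine RH.ext_of_strip fun θ hθ => ?_
    rw [happ' i (hS i hi) θ hθ, RH.zero_apply]
    have : (fun w => u (θ, w)) = fun w => (w - y i θ) * ((w - y i θ) *
        ((w - y i₀ θ) * ∏ j ∈ S.erase i, (w - y j θ) ^ 2)) := by
      funext w
      simp only [u]
      rw [← Finset.mul_prod_erase S _ hi]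
      ring
    rw [this, deriv_sub_mul _ (by fun_prop)]
    simp
  · rw [happ' i₀ hi₀ θ hθ]
    exact deriv_sub_mul (P := fun w => ∏ i ∈ S, (w - y i θ) ^ 2) (y i₀ θ) (by fun_prop)

theorem compDeriv_add_smul (f h : Maps σ W) (s : ℝ) (y : RH σ) :
    compDeriv (f + s • h) y = compDeriv f y + s • compDeriv h y := by
  simp only [compDeriv, map_add, map_smul]

/-- A perturbation that vanishes on every curve of the orbit leaves the orbit itself unchanged. -/
theorem orb_add_smul {N : ℕ} {f h : Maps σ W} {x : RH σ}
    (hh : ∀ l < N, comp (RH.tr (-(l * ω)) (orb f ω x l)) h = 0) (s : ℝ) {l : ℕ} (hl : l ≤ N) :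
    orb (f + s • h) ω x l = orb f ω x l := by
  induction l with
  | zero => rfl
  | succ l ih =>
    rw [orb, ih (by omega), map_add, map_smul, hh l (by omega), smul_zero, add_zero, orb]

theorem orbFactor_add_smul {N : ℕ} {f h : Maps σ W} {x : RH σ}
    (hh : ∀ l < N, comp (RH.tr (-(l * ω)) (orb f ω x l)) h = 0) (s : ℝ) {l : ℕ} (hl : l < N) :
    orbFactor (f + s • h) ω x l = orbFactor f ω x l
      + s • RH.tr (l * ω) (compDeriv h (RH.tr (-(l * ω)) (orb f ω x l))) := by
  rw [orbFactor, orb_add_smul hh s hl.le, compDeriv_add_smul, map_add, map_smul, orbFactor]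

end Direction

/-! ### Zeros of the factors of the multiplier. -/

section MultiplierZero

variable {σ : ℝ} {W : Set ℂ} {ω : ℝ}

theorem partialSnd_comp {E : Type*} [NormedAddCommGroup E] [NormedSpace ℝ E]
    {F : RH σ × ℝ → ℝ} {A : E → RH σ} {g : E} {t : ℝ} (hF : ContDiffAt ℝ ⊤ F (A g, t))
    (hA : ContDiffAt ℝ ⊤ A g) :
    ContDiffAt ℝ ⊤ (fun p : E × ℝ => F (A p.1, p.2)) (g, t) ∧
      partialSnd (fun p : E × ℝ => F (A p.1, p.2)) (g, t) = partialSnd F (A g, t) := by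
  have h1 : ContDiffAt ℝ ⊤ (fun p : E × ℝ => F (A p.1, p.2)) (g, t) :=
    ContDiffAt.comp (g, t) (g := F) (f := fun p : E × ℝ => (A p.1, p.2)) hF
      ((hA.comp (g, t) contDiffAt_fst).prodMk contDiffAt_snd)
  exact ⟨h1, (hasDerivAt_partialSnd h1).unique (hasDerivAt_partialSnd hF)⟩

theorem hasDerivAt_reEval (hσ : 0 < σ) (φ : RH σ) (t : ℝ) :
    HasDerivAt (fun t => reEval (φ, t)) (partialSnd reEval (φ, t)) t :=
  hasDerivAt_partialSnd (contDiffAt_reEval hσ _)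

theorem hasDerivAt_partialSnd_reEval (hσ : 0 < σ) (φ : RH σ) (t : ℝ) :
    HasDerivAt (fun t => partialSnd reEval (φ, t)) (partialSnd (partialSnd reEval) (φ, t)) t :=
  hasDerivAt_partialSnd (contDiffAt_partialSnd (contDiffAt_reEval hσ _))

theorem partialSnd_reEval_mul (hσ : 0 < σ) (φ ψ : RH σ) (t : ℝ) :
    partialSnd reEval (φ * ψ, t)
      = partialSnd reEval (φ, t) * reEval (ψ, t) + reEval (φ, t) * partialSnd reEval (ψ, t) := by
  have h := (hasDerivAt_reEval hσ φ t).mul (hasDerivAt_reEval hσ ψ t)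
  refine (hasDerivAt_reEval hσ (φ * ψ) t).unique (h.congr_of_eventuallyEq ?_)
  exact Eventually.of_forall fun t => reEval_mul φ ψ t

theorem partialSnd_partialSnd_reEval_mul (hσ : 0 < σ) (φ ψ : RH σ) (t : ℝ) :
    partialSnd (partialSnd reEval) (φ * ψ, t)
      = partialSnd (partialSnd reEval) (φ, t) * reEval (ψ, t)
        + 2 * (partialSnd reEval (φ, t) * partialSnd reEval (ψ, t))
        + reEval (φ, t) * partialSnd (partialSnd reEval) (ψ, t) := by
  have h := ((hasDerivAt_partialSnd_reEval hσ φ t).mul (hasDerivAt_reEval hσ ψ t)).add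
    ((hasDerivAt_reEval hσ φ t).mul (hasDerivAt_partialSnd_reEval hσ ψ t))
  have := (hasDerivAt_partialSnd_reEval hσ (φ * ψ) t).unique (h.congr_of_eventuallyEq
    (Eventually.of_forall fun t => partialSnd_reEval_mul hσ φ ψ t))
  rw [this]
  ring

/-- Where the i-th and the j-th curve of the orbit meet, both factors are the derivative of the same
fibre map at the same point; only their base points differ, by (i - j)ω. -/
theorem orbFactor_eq_zero_of_orb_eq (hσ : 0 < σ) (hW : IsOpen W) {N : ℕ} {f : Maps σ W} {x : RH σ}
    (h : IsGood N ω f x) {i j : ℕ} (hi : i < N) (hj : j < N) {t : ℝ}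
    (h0 : orbFactor f ω x i t = 0)
    (heq : orb f ω x i t = RH.tr (-(j * ω)) (orb f ω x j) (t + i * ω)) :
    orbFactor f ω x j ((t + ((i : ℝ) - j) * ω : ℝ) : ℂ) = 0 := by
  have hmem : ∀ v : ℝ, (v : ℂ) ∈ strip σ := ofReal_mem_strip hσ
  have h1 : orbFactor f ω x i t = deriv (fun w => ev f.1 ((t : ℂ) + i * ω, w)) (orb f ω x i t) := by
    rw [orbFactor, RH.tr_apply, compDeriv_apply hσ hW (h i hi) f
      (add_ofReal_mem_strip (hmem t) _), RH.tr_apply]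
    push_cast
    ring_nf
  have h2 : orbFactor f ω x j ((t + ((i : ℝ) - j) * ω : ℝ) : ℂ)
      = deriv (fun w => ev f.1 ((t : ℂ) + i * ω, w))
        (RH.tr (-(j * ω)) (orb f ω x j) (t + i * ω)) := by
    rw [orbFactor, RH.tr_apply, compDeriv_apply hσ hW (h j hj) f
      (add_ofReal_mem_strip (hmem _) _)]
    push_cast
    ring_nf
  rw [h2, ← heq, ← h1, h0]

/-- A direction in the space of maps along which the curve `x` stays invariant, and a single factor
of its multiplier changes, and this at a given point at which it vanishes. -/
theorem exists_orbit_direction (hσ : 0 < σ) (hW : IsOpen W) (hWb : Bornology.IsBounded W)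
    (hω : Irrational ω) {N : ℕ} {f : Maps σ W} {x : RH σ} (h : IsGood N ω f x) {θ₀ : ℝ}
    (huniq : ∀ t : ℝ, reEval (multiplier N ω f x, t) = 0 → ∃ k : ℤ, t = θ₀ + k) {i : ℕ}
    (hi : i < N) (h0 : orbFactor f ω x i θ₀ = 0) :
    ∃ (v : Maps σ W) (w : ℝ), w ≠ 0 ∧ ∀ s : ℝ, (∀ l ≤ N, orb (f + s • v) ω x l = orb f ω x l) ∧
      (∀ l < N, l ≠ i → orbFactor (f + s • v) ω x l = orbFactor f ω x l) ∧
      reEval (orbFactor (f + s • v) ω x i, θ₀) = s * w := by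
  set y : ℕ → RH σ := fun l => RH.tr (-(l * ω)) (orb f ω x l) with hy
  -- If two curves met at this point, the multiplier would vanish at θ₀ + (i - l)ω as well, which is
  -- not θ₀ modulo 1.
  have hne : ∀ l ∈ (Finset.range N).erase i, y i (θ₀ + i * ω) - y l (θ₀ + i * ω) ≠ 0 := by
    intro l hl heq
    obtain ⟨hli, hlN⟩ := Finset.mem_erase.1 hl
    have hlN := Finset.mem_range.1 hlN
    have hyi : y i (θ₀ + i * ω) = orb f ω x i θ₀ := by
      simp only [hy, RH.tr_apply]
      push_cast
      ring_nf
    rw [hyi] at heq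
    have h1 := orbFactor_eq_zero_of_orb_eq hσ hW h hi hlN h0 (sub_eq_zero.1 heq)
    obtain ⟨k, hk⟩ := huniq (θ₀ + ((i : ℝ) - l) * ω) (by
      rw [reEval_eq_zero_iff, multiplier, RH.prod_apply _ _ (subset_closure (ofReal_mem_strip hσ _))]
      exact Finset.prod_eq_zero (Finset.mem_range.2 hlN) h1)
    have hirr : Irrational (((i : ℤ) - l : ℤ) * ω) :=
      hω.intCast_mul (by omega)
    refine hirr.ne_int k ?_
    push_cast
    linarith
  obtain ⟨v, hv1, hv2, hv3⟩ := exists_direction hσ hW hWb (y := y) (h i hi)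
    (S := (Finset.range N).erase i)
    fun l hl => h l (Finset.mem_range.1 (Finset.mem_of_mem_erase hl))
  have hcomp : ∀ l < N, comp (y l) v = 0 := fun l hl => by
    rcases eq_or_ne l i with rfl | hli
    · exact hv1
    · exact (hv2 l (Finset.mem_erase.2 ⟨hli, Finset.mem_range.2 hl⟩)).1
  refine ⟨v, reEval (RH.tr (i * ω) (compDeriv v (y i)), θ₀), ?_, fun s => ⟨fun l hl =>
    orb_add_smul hcomp s hl, fun l hl hli => ?_, ?_⟩⟩
  · rw [Ne, reEval_eq_zero_iff, RH.tr_apply, hv3 _ (add_ofReal_mem_strip (ofReal_mem_strip hσ _) _)]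
    refine Finset.prod_ne_zero_iff.2 fun l hl => pow_ne_zero 2 ?_
    have := hne l hl
    push_cast
    exact this
  · rw [orbFactor_add_smul hcomp s hl]
    have := (hv2 l (Finset.mem_erase.2 ⟨hli, Finset.mem_range.2 hl⟩)).2
    simp only [hy] at this
    rw [this, map_zero, smul_zero, add_zero]
  · rw [orbFactor_add_smul hcomp s hi]
    simp only [reEval, RH.add_apply, h0, zero_add, RH.smul_apply, Complex.re_ofReal_mul]
    rfl

end MultiplierZero

/-! ### The defining function of the manifold. -/

section MultiplierDefiningFunction

variable {σ : ℝ} {W : Set ℂ} {ω : ℝ}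

theorem exists_nhds_interval {E : Type*} [TopologicalSpace E] {f : E} {θ₀ : ℝ} {P : E × ℝ → Prop}
    (h : ∀ᶠ p in 𝓝 (f, θ₀), P p) :
    ∃ δ > 0, ∀ᶠ g in 𝓝 f, ∀ p : ℝ, |p - θ₀| < δ → P (g, p) := by
  rw [nhds_prod_eq] at h
  obtain ⟨A, hA, B, hB, hAB⟩ := eventually_prod_iff.1 h
  obtain ⟨δ, hδ, hball⟩ := Metric.eventually_nhds_iff.1 hB
  refine ⟨δ, hδ, ?_⟩
  filter_upwards [hA] with g hg p hp
  exact hAB hg (hball (by rwa [Real.dist_eq]))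

/-- For a product `φ ψ` with a double zero at `θ₀`, where `φ` vanishes, two scalar functions whose
common zeros are the double zeros of the product. -/
theorem exists_doubleZero_equations (hσ : 0 < σ) {E : Type*} [NormedAddCommGroup E]
    [NormedSpace ℝ E] {A B : E → RH σ} {f : E} {θ₀ : ℝ} (hA : ContDiffAt ℝ ⊤ A f)
    (hB : ContDiffAt ℝ ⊤ B f) (h0 : reEval (A f, θ₀) = 0)
    (h1 : partialSnd reEval (A f * B f, θ₀) = 0)
    (h2 : partialSnd (partialSnd reEval) (A f * B f, θ₀) ≠ 0) :
    ∃ D : E × ℝ → ℝ, ContDiffAt ℝ ⊤ D (f, θ₀) ∧ D (f, θ₀) = 0 ∧ partialSnd D (f, θ₀) ≠ 0 ∧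
      ((partialSnd reEval (A f, θ₀) = 0) ∨ (∀ g, D (g, θ₀) = reEval (B g, θ₀)) ∧
        reEval (B f, θ₀) = 0) ∧
      ∃ δ > 0, ∀ᶠ g in 𝓝 f, ∀ p, |p - θ₀| < δ →
        (reEval (A g, p) = 0 ∧ D (g, p) = 0 ↔
          reEval (A g * B g, p) = 0 ∧ partialSnd reEval (A g * B g, p) = 0) := by
  have hC := contDiffAt_reEval hσ
  have hC1 := fun p : RH σ × ℝ => contDiffAt_partialSnd (hC p)
  rw [partialSnd_reEval_mul hσ, h0, zero_mul, add_zero] at h1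
  rw [partialSnd_partialSnd_reEval_mul hσ, h0, zero_mul, add_zero] at h2
  have hne : ∀ {F : RH σ × ℝ → ℝ} {A : E → RH σ}, ContDiffAt ℝ ⊤ F (A f, θ₀) →
      ContDiffAt ℝ ⊤ A f → F (A f, θ₀) ≠ 0 → ∀ᶠ p : E × ℝ in 𝓝 (f, θ₀), F (A p.1, p.2) ≠ 0 :=
    fun {F A} hF hA h => (partialSnd_comp hF hA).1.continuousAt.eventually
      (isOpen_ne.mem_nhds h)
  -- If B vanishes at θ₀, both zeros are simple by non-degeneracy, and a double zero of the product
  -- is a common zero: D = B. Otherwise B is a local unit and the double zero belongs to A: D = ∂A.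
  by_cases hB0 : reEval (B f, θ₀) = 0
  · rw [hB0, mul_zero, zero_add] at h2
    have hA1 : partialSnd reEval (A f, θ₀) ≠ 0 := fun h => h2 (by simp [h])
    have hB1 : partialSnd reEval (B f, θ₀) ≠ 0 := fun h => h2 (by simp [h])
    have hD := partialSnd_comp (hC (B f, θ₀)) hB
    refine ⟨fun p => reEval (B p.1, p.2), hD.1, hB0, hD.2.symm ▸ hB1, Or.inr ⟨fun g => rfl, hB0⟩, ?_⟩
    obtain ⟨δ, hδ, h⟩ := exists_nhds_interval ((hne (hC1 _) hA hA1).and (hne (hC1 _) hB hB1))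
    refine ⟨δ, hδ, ?_⟩
    filter_upwards [h] with g hg p hp
    obtain ⟨k1, k2⟩ := hg p hp
    rw [reEval_mul, partialSnd_reEval_mul hσ]
    constructor
    · rintro ⟨e1, e2⟩
      simp [e1, e2]
    · rintro ⟨e1, e2⟩
      rcases mul_eq_zero.1 e1 with e | e
      · simpa [e, k1] using e2
      · simpa [e, k2] using e2
  · have hA1 : partialSnd reEval (A f, θ₀) = 0 := (mul_eq_zero.1 h1).resolve_right hB0
    have hA2 : partialSnd (partialSnd reEval) (A f, θ₀) ≠ 0 := fun h => h2 (by simp [h, hA1])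
    have hD := partialSnd_comp (hC1 (A f, θ₀)) hA
    refine ⟨fun p => partialSnd reEval (A p.1, p.2), hD.1, hA1, hD.2.symm ▸ hA2, Or.inl hA1, ?_⟩
    obtain ⟨δ, hδ, h⟩ := exists_nhds_interval (hne (hC _) hB hB0)
    refine ⟨δ, hδ, ?_⟩
    filter_upwards [h] with g hg p hp
    have k1 := hg p hp
    rw [reEval_mul, partialSnd_reEval_mul hσ]
    constructor
    · rintro ⟨e1, e2⟩
      simp [e1, e2]
    · rintro ⟨e1, e2⟩
      have e := (mul_eq_zero.1 e1).resolve_right k1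
      simpa [e, k1] using e2

/-- C is a factor A vanishing at θ₀ and D comes from `exists_doubleZero_equations`. Along the
direction of `exists_orbit_direction` the invariant curve remains x, A(θ₀) grows linearly and the
other factors are constant, so the differential is nonzero in either case for D. -/
theorem exists_definingFunction_multiplier (hσ : 0 < σ) (hW : IsOpen W)
    (hWb : Bornology.IsBounded W) (hω : Irrational ω) {N : ℕ} {f : Maps σ W} {x : RH σ}
    (h : IsGood N ω f x) (hx : defect N ω (f, x) = 0) {X : Maps σ W → RH σ}
    (hX : ContDiffAt ℝ ⊤ X f) (hXf : X f = x)
    (hXu : ∀ᶠ p in 𝓝 (f, x), defect N ω p = 0 → p.2 = X p.1) {s θ₀ : ℝ} (hs : s ≠ 0)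
    (hnn : ∀ t, 0 ≤ s * reEval (multiplier N ω f x, t))
    (h0 : reEval (multiplier N ω f x, θ₀) = 0)
    (huniq : ∀ t : ℝ, reEval (multiplier N ω f x, t) = 0 → ∃ k : ℤ, t = θ₀ + k)
    (h2 : 0 < s * partialSnd (partialSnd reEval) (multiplier N ω f x, θ₀)) :
    ∃ Φ : Maps σ W → ℝ, ContDiffAt ℝ ⊤ Φ f ∧ fderiv ℝ Φ f ≠ 0 ∧
      ∀ᶠ g in 𝓝 f, (Φ g = 0 ↔
        IsLeast (range fun t : ℝ => s * reEval (multiplier N ω g (X g), t)) 0) := by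
  have := completeSpace_maps (σ := σ) hW
  have h1 : partialSnd reEval (multiplier N ω f x, θ₀) = 0 := by
    have hmin : IsLocalMin (fun t => s * reEval (multiplier N ω f x, t)) θ₀ :=
      Eventually.of_forall fun v => by simpa only [h0, mul_zero] using hnn v
    exact (mul_eq_zero.1 (hmin.hasDerivAt_eq_zero
      ((hasDerivAt_reEval hσ _ θ₀).const_mul s))).resolve_left hs
  obtain ⟨i, hi, hi0⟩ : ∃ i < N, orbFactor f ω x i θ₀ = 0 := by
    rw [reEval_eq_zero_iff, multiplier,
      RH.prod_apply _ _ (subset_closure (ofReal_mem_strip hσ _))] at h0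
    obtain ⟨i, hi, h⟩ := Finset.prod_eq_zero_iff.1 h0
    exact ⟨i, Finset.mem_range.1 hi, h⟩
  set A : Maps σ W → RH σ := fun g => orbFactor g ω (X g) i with hAdef
  set B : Maps σ W → RH σ := fun g => ∏ l ∈ (Finset.range N).erase i, orbFactor g ω (X g) l with hBdef
  have hAB : ∀ g, multiplier N ω g (X g) = A g * B g := fun g =>
    (Finset.mul_prod_erase _ _ (Finset.mem_range.2 hi)).symm
  have hfac : ∀ l < N, ContDiffAt ℝ ⊤ (fun g => orbFactor g ω (X g) l) f := fun l hl => by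
    have h1 := contDiffAt_orbFactor hσ h hl
    rw [← hXf] at h1
    exact h1.comp f (f := fun g => (g, X g)) (contDiffAt_id.prodMk hX)
  have hA : ContDiffAt ℝ ⊤ A f := hfac i hi
  have hB : ContDiffAt ℝ ⊤ B f := contDiffAt_prod fun l hl =>
    hfac l (Finset.mem_range.1 (Finset.mem_of_mem_erase hl))
  have hABf := hAB f
  rw [hXf] at hABf
  have hAf : A f = orbFactor f ω x i := by simp only [hAdef, hXf]
  have hA0 : reEval (A f, θ₀) = 0 := by rw [reEval_eq_zero_iff, hAf, hi0]
  obtain ⟨D, hD, hD0, hDθ, halt, δ₁, hδ₁, hiff₁⟩ := exists_doubleZero_equations hσ hA hB hA0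
    (by rwa [← hABf]) (by rw [← hABf]; exact fun h => by simp [h] at h2)
  obtain ⟨v, w, hw, hv⟩ := exists_orbit_direction hσ hW hWb hω h huniq hi hi0
  -- The orbit of x is unaffected by the perturbation, so x stays invariant and local uniqueness
  -- gives X = x.
  have hXv : ∀ᶠ t : ℝ in 𝓝 0, X (f + t • v) = x := by
    have hlim : Tendsto (fun t : ℝ => (f + t • v, x)) (𝓝 0) (𝓝 (f, x)) :=
      (tendsto_add_smul f v).prodMk_nhds tendsto_const_nhds
    filter_upwards [hlim.eventually hXu] with t ht
    refine (ht ?_).symm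
    rw [defect, (hv t).1 N le_rfl]
    exact hx
  have hCs : ContDiffAt ℝ ⊤ (fun p : Maps σ W × ℝ => reEval (A p.1, p.2)) (f, θ₀) ∧ _ :=
    partialSnd_comp (contDiffAt_reEval hσ _) hA
  obtain ⟨Φ, hΦ, hΦ', δ₂, hδ₂, hiff₂⟩ := exists_definingFunction hCs.1 hD hD0 hDθ (h := v) hw (by
      have hlin : HasDerivAt (fun t : ℝ => t * w) w 0 := by
        simpa using (hasDerivAt_id (0 : ℝ)).mul_const w
      refine hlin.congr_of_eventuallyEq ?_
      filter_upwards [hXv] with t ht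
      simp only [hAdef, ht]
      exact (hv t).2.2) (by
      rcases halt with halt | ⟨halt, hB0⟩
      · left
        rw [hCs.2, halt]
      · right
        filter_upwards [hXv] with t ht
        rw [halt, ← hB0]
        simp only [hBdef, ht, hXf]
        refine congrArg (fun φ => reEval (φ, θ₀)) (Finset.prod_congr rfl fun l hl => ?_)
        obtain ⟨hli, hl⟩ := Finset.mem_erase.1 hl
        exact (hv t).2.1 l (Finset.mem_range.1 hl) hli)
  obtain ⟨δ₃, hδ₃, hiff₃⟩ := eventually_isLeast_iff hσ hnn huniq hs h2
  have hM : ContinuousAt (fun g => multiplier N ω g (X g)) f := by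
    simp only [hAB]
    exact hA.continuousAt.mul hB.continuousAt
  set δ := min δ₁ (min δ₂ δ₃)
  have hδ : 0 < δ := by positivity
  have hev := hiff₃ δ hδ ((min_le_right _ _).trans (min_le_right _ _))
  rw [← hXf] at hev
  refine ⟨Φ, hΦ, hΦ', ?_⟩
  filter_upwards [hiff₁, hiff₂ δ hδ ((min_le_right _ _).trans (min_le_left _ _)),
    hM.eventually hev] with g hg1 hg2 hg3
  rw [hg2, hg3, hAB]
  refine exists_congr fun p => and_congr_right fun hp => ?_
  exact hg1 p (hp.trans_le (min_le_left _ _))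

end MultiplierDefiningFunction

/-! ### From attracting curves to elements of the Banach algebra. -/

section Bridge

variable {σ ρ : ℝ} {W : Set ℂ} {ω K₀ : ℝ} {n : ℕ}

/-- The minimum (`s = 1`) or the maximum (`s = -1`) of `D_x g^{2^n}` along the curve `y` is `0`. -/
def ExtSlopeZero (s ω : ℝ) (n : ℕ) (g : Maps σ W) (y : ℂ → ℂ) : Prop :=
  IsLeast (range fun θ : ℝ => s * (slope g ω n θ (y θ)).re) 0

theorem minSlopeZero_iff {g : Maps σ W} {y : ℂ → ℂ} :
    MinSlopeZero ω n g y ↔ ExtSlopeZero 1 ω n g y := by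
  simp only [MinSlopeZero, ExtSlopeZero, one_mul]

theorem maxSlopeZero_iff {g : Maps σ W} {y : ℂ → ℂ} :
    MaxSlopeZero ω n g y ↔ ExtSlopeZero (-1) ω n g y := by
  simp only [MaxSlopeZero, ExtSlopeZero, IsGreatest, IsLeast, upperBounds, lowerBounds, mem_range,
    forall_exists_index, forall_apply_eq_imp_iff, mem_ofPred_eq, neg_one_mul, neg_eq_zero,
    Left.nonneg_neg_iff]

theorem ev_restrict {W : Set ℂ} (h : σ ≤ ρ) (f : Maps ρ W) {p : ℂ × ℂ} (hp : p ∈ dom σ W) :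
    ev (restrict h f).1 p = ev f.1 p := by
  rw [ev_of_mem _ hp, ev_of_mem _ (dom_mono h W hp)]
  rfl

theorem iter_restrict (h : σ ≤ ρ) (f : Maps ρ W) {θ z : ℂ} (hθ : θ ∈ closure (strip σ)) {k : ℕ}
    (hk : ∀ l < k, iter f ω l θ z ∈ closure W) :
    iter (restrict h f) ω k θ z = iter f ω k θ z := by
  induction k with
  | zero => rfl
  | succ k ih =>
    change ev (restrict h f).1 _ = ev f.1 _
    rw [ih fun l hl => hk l (by omega)]
    refine ev_restrict h f ?_
    rw [dom_eq]
    exact ⟨add_mul_mem_closure_strip hθ k ω, hk k (by omega)⟩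

theorem slope_restrict (h : σ ≤ ρ) (hW : IsOpen W) (f : Maps ρ W) {θ z : ℂ} (hθ : θ ∈ strip σ)
    (hk : ∀ l < 2 ^ n, iter f ω l θ z ∈ W) :
    slope (restrict h f) ω n θ z = slope f ω n θ z := by
  have hit : ∀ l ≤ 2 ^ n, iter (restrict h f) ω l θ z = iter f ω l θ z := fun l hl =>
    iter_restrict h f (subset_closure hθ) fun j hj => subset_closure (hk j (by omega))
  rw [slope_eq_prod f hW (strip_mono h hθ) n hk,
    slope_eq_prod (restrict h f) hW hθ n fun l hl => (hit l hl.le).symm ▸ hk l hl]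
  refine Finset.prod_congr rfl fun l hl => ?_
  have hl := Finset.mem_range.1 hl
  change deriv (fun w => ev (restrict h f).1 (θ + l * ω, w)) (iter (restrict h f) ω l θ z)
    = deriv (fun w => ev f.1 (θ + l * ω, w)) (iter f ω l θ z)
  rw [hit l hl.le]
  refine EventuallyEq.deriv_eq ?_
  filter_upwards [hW.mem_nhds (hk l hl)] with w hw
  exact ev_restrict h f (strip_prod_subset_dom ⟨add_mul_mem_strip hθ l ω, hw⟩)

theorem IsAttractingCurve.exists_rh (hσ : 0 < σ) (hWb : Bornology.IsBounded W) {g : Maps σ W}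
    {y : ℂ → ℂ} (h : IsAttractingCurve K₀ ω n g y) :
    ∃ φ : RH σ, ∀ θ ∈ closure (strip σ), φ θ = y θ := by
  obtain ⟨K, hK⟩ := hWb.exists_norm_le
  exact RH.exists_of hσ h.continuousOn h.differentiableOn h.real h.periodic
    fun θ hθ => hK _ (h.mem θ hθ 0 (by positivity))

theorem cast_two_pow_mul (θ : ℂ) (n : ℕ) (ω : ℝ) :
    θ + ((2 ^ n : ℕ) : ℂ) * ω = θ + 2 ^ n * (ω : ℂ) := by push_cast; rfl

theorem IsGood.isAttractingCurve (hσ : 0 < σ) (hW : IsOpen W) {g : Maps σ W} {φ : RH σ}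
    (h : IsGood (2 ^ n) ω g φ) (hd : defect (2 ^ n) ω (g, φ) = 0)
    (he : logIntegral (fun t : ℝ => multiplier (2 ^ n) ω g φ t) < ((-K₀ : ℝ) : EReal)) :
    IsAttractingCurve K₀ ω n g φ where
  continuousOn := φ.continuousOn
  differentiableOn := φ.differentiableOn
  real := φ.im_eq_zero
  periodic θ hθ := φ.apply_add_one (subset_closure hθ)
  mem θ hθ j hj := h.mem hσ hj (subset_closure hθ)
  invariant θ hθ := by
    rw [← cast_two_pow_mul]
    exact (defect_eq_zero_iff hσ h).1 hd θ hθ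
  exponent := by
    convert he using 3 with t
    exact (multiplier_eq_slope hσ hW h (ofReal_mem_strip hσ t)).symm

theorem IsGood.extSlopeZero_iff (hσ : 0 < σ) (hW : IsOpen W) {g : Maps σ W} {φ : RH σ}
    (h : IsGood (2 ^ n) ω g φ) {s : ℝ} :
    ExtSlopeZero s ω n g φ ↔
      IsLeast (range fun t : ℝ => s * reEval (multiplier (2 ^ n) ω g φ, t)) 0 := by
  simp only [ExtSlopeZero, reEval, multiplier_eq_slope hσ hW h (ofReal_mem_strip hσ _)]

/-- The curve `y`, restricted to a smaller band, as an invariant element of `RH σ`. -/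
theorem IsAttractingCurve.exists_restrict (hσ : 0 < σ) (h : σ < ρ) (hW : IsOpen W)
    (hWb : Bornology.IsBounded W) {g : Maps ρ W} {y : ℂ → ℂ} (hy : IsAttractingCurve K₀ ω n g y) :
    ∃ φ : RH σ, (∀ θ ∈ closure (strip σ), φ θ = y θ) ∧ IsGood (2 ^ n) ω (restrict h.le g) φ ∧
      defect (2 ^ n) ω (restrict h.le g, φ) = 0 ∧
      ∀ θ ∈ strip σ, multiplier (2 ^ n) ω (restrict h.le g) φ θ = slope g ω n θ (y θ) := by
  obtain ⟨K, hK⟩ := hWb.exists_norm_le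
  -- Strict narrowing puts the closed smaller band inside the open larger one, so the orbit stays in
  -- W up to the boundary, as `IsGood` requires.
  have hsub : closure (strip σ) ⊆ strip ρ := closure_strip_subset_strip h
  obtain ⟨φ, hφ⟩ := RH.exists_of hσ (hy.continuousOn.mono (hsub.trans subset_closure))
    (hy.differentiableOn.mono (subset_closure.trans hsub)) hy.real
    (fun θ hθ => hy.periodic θ (hsub (subset_closure hθ)))
    fun θ hθ => hK _ (hy.mem θ (hsub (subset_closure hθ)) 0 (by positivity))
  have hit : ∀ θ ∈ closure (strip σ), ∀ l ≤ 2 ^ n,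
      iter (restrict h.le g) ω l θ (y θ) = iter g ω l θ (y θ) := fun θ hθ l hl =>
    iter_restrict h.le g hθ fun j hj => subset_closure (hy.mem θ (hsub hθ) j (by omega))
  have hgood : IsGood (2 ^ n) ω (restrict h.le g) φ :=
    (isGood_iff (g := restrict h.le g) hσ hW).2 fun θ hθ l hl => by
      rw [hφ θ hθ, hit θ hθ l hl.le]
      exact hy.mem θ (hsub hθ) l hl
  refine ⟨φ, hφ, hgood, (defect_eq_zero_iff (g := restrict h.le g) hσ hgood).2 fun θ hθ => ?_,
    fun θ hθ => ?_⟩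
  · have hθ' := subset_closure hθ
    rw [hφ _ (add_mul_mem_closure_strip hθ' _ ω), hφ θ hθ', hit θ hθ' _ le_rfl, cast_two_pow_mul]
    exact hy.invariant θ (hsub hθ')
  · rw [multiplier_eq_slope hσ hW hgood hθ, hφ θ (subset_closure hθ)]
    exact slope_restrict h.le hW g hθ fun l hl => hy.mem θ (hsub (subset_closure hθ)) l hl

theorem ExtSlopeZero.multiplier_isLeast (hσ : 0 < σ) {s : ℝ} {a : RH σ} {g : Maps ρ W} {y : ℂ → ℂ}
    (h : ExtSlopeZero s ω n g y) (ha : ∀ θ ∈ strip σ, a θ = slope g ω n θ (y θ)) :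
    IsLeast (range fun t : ℝ => s * reEval (a, t)) 0 := by
  simpa only [ExtSlopeZero, reEval, ha _ (ofReal_mem_strip hσ _)] using h

end Bridge

/-! ### Minima and maxima treated together by a sign s. -/

section Nondegenerate

variable {σ : ℝ}

/-- `s a` has a unique absolute minimum in `ℝ/ℤ`, and this minimum is non-degenerate. -/
def HasUniqueNondegExt (s : ℝ) (a : ℝ → ℝ) : Prop :=
  ∃ θ₀ : ℝ, (∀ θ, s * a θ₀ ≤ s * a θ) ∧ (∀ θ, a θ = a θ₀ → ∃ k : ℤ, θ = θ₀ + k) ∧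
    0 < s * iteratedDeriv 2 a θ₀

theorem HasUniqueNondegMin.ext {a : ℝ → ℝ} (h : HasUniqueNondegMin a) : HasUniqueNondegExt 1 a := by
  simpa only [HasUniqueNondegExt, one_mul, HasUniqueNondegMin] using h

theorem HasUniqueNondegMax.ext {a : ℝ → ℝ} (h : HasUniqueNondegMax a) :
    HasUniqueNondegExt (-1) a := by
  simpa only [HasUniqueNondegExt, neg_one_mul, neg_le_neg_iff, Left.neg_pos_iff, HasUniqueNondegMax] using h

theorem iteratedDeriv_two_reEval (hσ : 0 < σ) (a : RH σ) (t : ℝ) :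
    iteratedDeriv 2 (fun t => reEval (a, t)) t = partialSnd (partialSnd reEval) (a, t) := by
  rw [iteratedDeriv_succ, iteratedDeriv_one]
  have : deriv (fun t => reEval (a, t)) = fun t => partialSnd reEval (a, t) :=
    funext fun t => (hasDerivAt_reEval hσ a t).deriv
  rw [this]
  exact (hasDerivAt_partialSnd_reEval hσ a t).deriv

theorem HasUniqueNondegExt.exists_zero (hσ : 0 < σ) {s : ℝ} {a : RH σ} (hs : s ≠ 0)
    (h : HasUniqueNondegExt s fun t => reEval (a, t))
    (h0 : IsLeast (range fun t : ℝ => s * reEval (a, t)) 0) :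
    ∃ θ₀, reEval (a, θ₀) = 0 ∧ (∀ t, 0 ≤ s * reEval (a, t)) ∧
      (∀ t, reEval (a, t) = 0 → ∃ k : ℤ, t = θ₀ + k) ∧
      0 < s * partialSnd (partialSnd reEval) (a, θ₀) := by
  obtain ⟨θ₀, h1, h2, h3⟩ := h
  have hnn : ∀ t, 0 ≤ s * reEval (a, t) := fun t => h0.2 ⟨t, rfl⟩
  obtain ⟨t, ht⟩ := h0.1
  have hz : reEval (a, θ₀) = 0 :=
    (mul_eq_zero.1 (le_antisymm ((h1 t).trans_eq ht) (hnn θ₀))).resolve_left hs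
  rw [iteratedDeriv_two_reEval hσ] at h3
  exact ⟨θ₀, hz, hnn, fun t ht => h2 t (ht.trans hz.symm), h3⟩

end Nondegenerate

/-! ### The local family of attracting curves. -/

section LocalCurve

variable {σ ρ : ℝ} {W : Set ℂ} {ω K₀ : ℝ} {n : ℕ}

theorem continuous_reLine (hσ : 0 < σ) (φ : RH σ) : Continuous fun t : ℝ => φ t :=
  φ.differentiableOn.continuousOn.comp_continuous Complex.continuous_ofReal (ofReal_mem_strip hσ)

/-- A truncated mean below c for a fixed cut-off is stable under small perturbations and still
dominates the exponent. -/
theorem eventually_logIntegral_lt (hσ : 0 < σ) {φ₀ : RH σ} {c : ℝ}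
    (h : logIntegral (fun t : ℝ => φ₀ t) < (c : ℝ)) :
    ∀ᶠ φ in 𝓝 φ₀, logIntegral (fun t : ℝ => (φ : RH σ) t) < (c : ℝ) := by
  obtain ⟨η, hη, hlt⟩ := exists_logMean_lt (continuous_reLine hσ φ₀) h
  set d := (c - logMean η fun t : ℝ => φ₀ t) / 2 with hd
  have hd0 : 0 < d := by linarith
  filter_upwards [Metric.ball_mem_nhds φ₀ (mul_pos hd0 hη)] with φ hφ
  have h1 := logMean_le_add (continuous_reLine hσ φ) (continuous_reLine hσ φ₀) hη
    (δ := d * η) fun t _ => by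
      rw [← RH.sub_apply]
      exact (RH.norm_apply_le _ _).trans (mem_ball_iff_norm.1 hφ).le
  rw [mul_div_cancel_right₀ _ hη.ne'] at h1
  refine (logIntegral_le_logMean (continuous_reLine hσ φ) hη).trans_lt ?_
  exact_mod_cast (by linarith : logMean η (fun t : ℝ => φ t) < c)

/-- `X` parametrises the invariant curves near `φ` of the maps near `F`. -/
structure IsLocalCurve (K₀ ω : ℝ) (n : ℕ) (F : Maps σ W) (φ : RH σ) (X : Maps σ W → RH σ) :
    Prop where
  contDiffAt : ContDiffAt ℝ ⊤ X F
  apply_self : X F = φ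
  isGood : ∀ᶠ g in 𝓝 F, IsGood (2 ^ n) ω g (X g)
  defect_eq_zero : ∀ᶠ g in 𝓝 F, defect (2 ^ n) ω (g, X g) = 0
  exponent : ∀ᶠ g in 𝓝 F,
    logIntegral (fun t : ℝ => multiplier (2 ^ n) ω g (X g) t) < ((-K₀ : ℝ) : EReal)
  isGood_near : ∀ᶠ p in 𝓝 (F, φ), IsGood (2 ^ n) ω p.1 p.2
  unique : ∀ᶠ p in 𝓝 (F, φ), defect (2 ^ n) ω p = 0 → p.2 = X p.1

theorem exists_isLocalCurve (hσ : 0 < σ) (hW : IsOpen W) {F : Maps σ W} {φ : RH σ}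
    (h : IsGood (2 ^ n) ω F φ) (hd : defect (2 ^ n) ω (F, φ) = 0)
    (hc : IsContracting ((2 ^ n : ℕ) * ω) (multiplier (2 ^ n) ω F φ))
    (he : logIntegral (fun t : ℝ => multiplier (2 ^ n) ω F φ t) < ((-K₀ : ℝ) : EReal)) :
    ∃ X, IsLocalCurve K₀ ω n F φ X := by
  obtain ⟨X, hX, hXF, hev, hu⟩ := exists_implicitCurve hσ hW h hc hd
  refine ⟨X, hX, hXF, hev.mono fun _ h => h.1, hev.mono fun _ h => h.2, ?_,
    eventually_isGood hσ h, hu⟩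
  have hm : ContinuousAt (fun g => multiplier (2 ^ n) ω g (X g)) F := by
    have h1 := (contDiffAt_multiplier hσ h).continuousAt
    rw [← hXF] at h1
    exact h1.comp (f := fun g => (g, X g)) (continuousAt_id.prodMk hX.continuousAt)
  rw [← hXF] at he
  exact hm.eventually (eventually_logIntegral_lt hσ he)

/-- The maps with an attracting curve along which the extremum of the slope is `0`. -/
def Upsilon (s K₀ ω : ℝ) (n : ℕ) : Set (Maps σ W) :=
  {g | ∃ y : ℂ → ℂ, IsAttractingCurve K₀ ω n g y ∧ ExtSlopeZero s ω n g y}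

/-- The part of `Upsilon` given by curves at uniform distance less than `ε` from `x`. -/
def UpsilonNear (s K₀ ω : ℝ) (n : ℕ) (x : ℂ → ℂ) (ε : ℝ) : Set (Maps σ W) :=
  {g | ∃ y : ℂ → ℂ, IsAttractingCurve K₀ ω n g y ∧ ExtSlopeZero s ω n g y ∧
    ∃ ε' < ε, ∀ θ ∈ strip σ, ‖y θ - x θ‖ ≤ ε'}

theorem ExtSlopeZero.congr {s : ℝ} {g : Maps σ W} {y z : ℂ → ℂ} (h : ExtSlopeZero s ω n g y)
    (hyz : ∀ t : ℝ, z t = y t) : ExtSlopeZero s ω n g z := by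
  simpa only [ExtSlopeZero, hyz] using h

theorem IsAttractingCurve.defect_eq_zero (hσ : 0 < σ) {g : Maps σ W} {y : ℂ → ℂ} {ψ : RH σ}
    (hy : IsAttractingCurve K₀ ω n g y) (hψ : ∀ θ ∈ closure (strip σ), ψ θ = y θ)
    (hgood : IsGood (2 ^ n) ω g ψ) : defect (2 ^ n) ω (g, ψ) = 0 :=
  (defect_eq_zero_iff hσ hgood).2 fun θ hθ => by
    have hθ' := subset_closure hθ
    rw [hψ _ (add_mul_mem_closure_strip hθ' _ ω), hψ θ hθ', cast_two_pow_mul]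
    exact hy.invariant θ hθ

/-- An invariant curve uniformly close to φ must be X(g), while X(g) itself is close to φ. So
membership depends only on the multiplier along X(g). -/
theorem IsLocalCurve.upsilonNear (hσ : 0 < σ) (hW : IsOpen W) (hWb : Bornology.IsBounded W)
    {F : Maps σ W} {φ : RH σ} {X : Maps σ W → RH σ} (hX : IsLocalCurve K₀ ω n F φ X) (s : ℝ) :
    ∃ ε₀ > 0, ∀ ε > 0, ε ≤ ε₀ → ∀ᶠ g in 𝓝 F, (g ∈ UpsilonNear s K₀ ω n φ ε ↔
      IsLeast (range fun t : ℝ => s * reEval (multiplier (2 ^ n) ω g (X g), t)) 0) := by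
  have hev := hX.isGood_near.and hX.unique
  rw [nhds_prod_eq] at hev
  obtain ⟨P, hP, Q, hQ, hPQ⟩ := eventually_prod_iff.1 hev
  obtain ⟨ε₀, hε₀, hball⟩ := Metric.eventually_nhds_iff.1 hQ
  refine ⟨ε₀, hε₀, fun ε hε hle => ?_⟩
  have hclose : ∀ᶠ g in 𝓝 F, ‖X g - φ‖ < ε / 2 := by
    have := hX.contDiffAt.continuousAt.eventually (Metric.ball_mem_nhds (X F) (half_pos hε))
    filter_upwards [this] with g hg
    rwa [hX.apply_self, dist_eq_norm] at hg
  filter_upwards [hP, hclose, hX.isGood, hX.defect_eq_zero, hX.exponent] with g hg h1 h2 h3 h4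
  rw [← h2.extSlopeZero_iff hσ hW]
  constructor
  · rintro ⟨y, hy, hext, ε', hε', hyx⟩
    obtain ⟨ψ, hψ⟩ := hy.exists_rh hσ hWb
    have hψφ : ‖ψ - φ‖ ≤ ε' := by
      have hε'0 : 0 ≤ ε' := (norm_nonneg _).trans (hyx 0 (by simpa [strip] using hσ))
      refine RH.norm_le_of_forall hε'0 fun θ hθ => ?_
      rw [RH.sub_apply, hψ θ (subset_closure hθ)]
      exact hyx θ hθ
    obtain ⟨hgood, hu⟩ := hPQ hg (hball (y := ψ) (by
      rw [dist_eq_norm]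
      exact hψφ.trans_lt (hε'.trans_le hle)))
    have hψX : ψ = X g := hu (hy.defect_eq_zero hσ hψ hgood)
    exact hext.congr fun t => by rw [← hψX, hψ _ (subset_closure (ofReal_mem_strip hσ t))]
  · intro h5
    refine ⟨X g, h2.isAttractingCurve hσ hW h3 h4, h5, ε / 2, half_lt_self hε, fun θ _ => ?_⟩
    rw [← RH.sub_apply]
    exact (RH.norm_apply_le _ _).trans h1.le

theorem irrational_of_isDiophantine (h : IsDiophantine ω) : Irrational ω := by
  obtain ⟨γ, τ, hγ, -, h⟩ := h
  rintro ⟨q, rfl⟩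
  have hq : (0 : ℝ) < q.den := by exact_mod_cast q.pos
  have := h q.num q.den (by exact_mod_cast q.pos.ne')
  have h0 : ((q.den : ℤ) : ℝ) * (q : ℝ) - (q.num : ℝ) = 0 := by
    rw [sub_eq_zero, Int.cast_natCast]
    exact_mod_cast Rat.den_mul_eq_num q
  rw [h0, abs_zero] at this
  have hpos : 0 < γ / |((q.den : ℤ) : ℝ)| ^ τ := by
    refine div_pos hγ (Real.rpow_pos_of_pos ?_ _)
    rw [abs_pos, Int.cast_natCast]
    exact hq.ne'
  linarith

/-- The width of the bands on which the curves persist. -/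
def bandWidth (K₀ r M : ℝ) : ℝ := r / 2 / 2 * bandRatio K₀ (max M 1)

theorem bandRatio_pos {K M : ℝ} (hK : 0 < K) (hM : 1 ≤ M) : 0 < bandRatio K M := by
  have := Real.log_nonneg hM
  exact div_pos hK (by linarith)

theorem bandRatio_le_one {K M : ℝ} (hK : 0 < K) (hM : 1 ≤ M) : bandRatio K M ≤ 1 := by
  have := Real.log_nonneg hM
  rw [bandRatio, div_le_one (by linarith)]
  linarith

theorem bandWidth_pos {r M : ℝ} (hK : 0 < K₀) (hr : 0 < r) : 0 < bandWidth K₀ r M :=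
  mul_pos (by linarith) (bandRatio_pos hK (le_max_right _ _))

theorem bandWidth_lt {r M : ℝ} (hK : 0 < K₀) (hr : 0 < r) : bandWidth K₀ r M < r / 2 := by
  have := bandRatio_le_one hK (le_max_right M 1)
  calc bandWidth K₀ r M ≤ r / 2 / 2 * 1 := mul_le_mul_of_nonneg_left this (by linarith)
    _ < r / 2 := by linarith

/-- The three lines estimate is made on the band of width r/2, where the restricted curve belongs to
the algebra; this explains the constant in `bandWidth`. The cut-off `max M 1` makes log M
nonnegative. -/
theorem IsAttractingCurve.isContracting {r M : ℝ} (hK : 0 < K₀) (hr : 0 < r) (hrρ : r ≤ ρ)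
    (hW : IsOpen W) (hWb : Bornology.IsBounded W) (hω : Irrational ω) {f : Maps ρ W} {x : ℂ → ℂ}
    (hx : IsAttractingCurve K₀ ω n f x) (hM : ∀ θ ∈ strip r, ‖slope f ω n θ (x θ)‖ ≤ M) {a : RH σ}
    (hσ : σ ≤ bandWidth K₀ r M) (ha : ∀ θ ∈ strip σ, a θ = slope f ω n θ (x θ)) :
    IsContracting ((2 ^ n : ℕ) * ω) a := by
  have hr2 : 0 < r / 2 := half_pos hr
  obtain ⟨φ, -, -, -, hm⟩ := hx.exists_restrict hr2 ((half_lt_self hr).trans_le hrρ) hW hWb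
  set b := multiplier (2 ^ n) ω (restrict ((half_lt_self hr).trans_le hrρ).le f) φ with hb
  have hbM : ‖b‖ ≤ max M 1 := RH.norm_le_of_forall (by positivity) fun θ hθ => by
    rw [hm θ hθ]
    exact (hM θ (strip_mono (half_le_self hr.le) hθ)).trans (le_max_left _ _)
  have hirr : Irrational ((2 ^ n : ℕ) * ω) := hω.natCast_mul (by positivity)
  obtain ⟨m, q, hq, h⟩ := contracting_of_logIntegral hr2 hK (le_max_right M 1) hirr b hbM (by
    convert hx.exponent using 3 with t
    exact hm t (ofReal_mem_strip hr2 t))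
  refine ⟨m, q, hq, fun θ hθ => ?_⟩
  have hθ' : θ ∈ strip (bandWidth K₀ r M) := strip_mono hσ hθ
  refine le_trans (le_of_eq ?_) (h θ hθ')
  congr 1
  refine Finset.prod_congr rfl fun k _ => ?_
  have h1 := add_mul_mem_strip hθ k ((2 ^ n : ℕ) * ω)
  rw [ha _ h1, hm _ (strip_mono (hσ.trans (bandWidth_lt hK hr).le) h1)]

end LocalCurve

/-! ### Narrower bands and Montel compactness. -/

section Restriction

variable {τ σ ρ : ℝ} {W : Set ℂ} {ω : ℝ}

theorem norm_restrict_sub_le (h : τ ≤ σ) (f g : Maps σ W) :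
    ‖(restrict h f - restrict h g : Maps τ W)‖ ≤ ‖f - g‖ := by
  refine (BoundedContinuousFunction.norm_le (norm_nonneg _)).2 fun p => ?_
  exact (f - g).1.norm_coe_le_norm (inclusion (dom_mono h W) p)

theorem tendsto_restrict (h : τ ≤ σ) {ι : Type*} {l : Filter ι} {G : ι → Maps σ W} {F : Maps σ W}
    (hG : Tendsto G l (𝓝 F)) :
    Tendsto (fun i => (restrict h (G i) : Maps τ W)) l (𝓝 (restrict h F)) := by
  rw [tendsto_iff_norm_sub_tendsto_zero] at hG ⊢
  exact squeeze_zero (fun _ => norm_nonneg _) (fun i => norm_restrict_sub_le h (G i) F) hG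

theorem restrict_restrict (h : τ ≤ σ) (h' : σ ≤ ρ) (f : Maps ρ W) :
    restrict h (restrict h' f) = restrict (h.trans h') f := rfl

namespace RH

/-- Restriction to a narrower band. -/
def restr (h : τ ≤ σ) (φ : RH σ) : RH τ := by
  have hcl : closure (strip τ) ⊆ closure (strip σ) := closure_mono (strip_mono h)
  let ψ : closure (strip τ) →ᵇ ℂ := φ.1.compContinuous ⟨inclusion hcl, continuous_inclusion _⟩
  have key : ∀ θ ∈ closure (strip τ), extend ψ θ = φ θ := fun θ hθ => by
    rw [extend_of_mem _ hθ, extend_of_mem _ (hcl hθ)]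
    rfl
  refine ⟨ψ, ?_, fun t => ?_, fun θ hθ => ?_⟩
  · exact (φ.differentiableOn.mono (strip_mono h)).congr fun θ hθ => key θ (subset_closure hθ)
  · by_cases ht : (t : ℂ) ∈ closure (strip τ)
    · rw [key _ ht, φ.im_eq_zero]
    · rw [extend_of_notMem _ ht, Complex.zero_im]
  · have hθ1 : θ + 1 ∈ strip τ := by simpa using add_ofReal_mem_strip hθ 1
    rw [key _ (subset_closure hθ), key _ (subset_closure hθ1),
      φ.apply_add_one (subset_closure (strip_mono h hθ))]

theorem restr_apply (h : τ ≤ σ) (φ : RH σ) {θ : ℂ} (hθ : θ ∈ closure (strip τ)) :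
    restr h φ θ = φ θ := by
  have hcl : closure (strip τ) ⊆ closure (strip σ) := closure_mono (strip_mono h)
  rw [extend_of_mem _ hθ, extend_of_mem _ (hcl hθ)]
  rfl

theorem norm_restr_sub_le (h : τ ≤ σ) (φ ψ : RH σ) : ‖restr h φ - restr h ψ‖ ≤ ‖φ - ψ‖ := by
  refine norm_le_of_forall (norm_nonneg _) fun θ hθ => ?_
  rw [sub_apply, restr_apply h _ (subset_closure hθ), restr_apply h _ (subset_closure hθ), ← sub_apply]
  exact norm_apply_le _ _

theorem tendsto_restr (h : τ ≤ σ) {ι : Type*} {l : Filter ι} {φ : ι → RH σ} {ψ : RH σ}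
    (hφ : Tendsto φ l (𝓝 ψ)) : Tendsto (fun i => restr h (φ i)) l (𝓝 (restr h ψ)) := by
  rw [tendsto_iff_norm_sub_tendsto_zero] at hφ ⊢
  exact squeeze_zero (fun _ => norm_nonneg _) (fun i => norm_restr_sub_le h (φ i) ψ) hφ

theorem tendsto_apply {ι : Type*} {l : Filter ι} {φ : ι → RH σ} {ψ : RH σ}
    (hφ : Tendsto φ l (𝓝 ψ)) (θ : ℂ) : Tendsto (fun i => φ i θ) l (𝓝 (ψ θ)) :=
  ((eval θ).continuous.tendsto ψ).comp hφ

theorem norm_apply_sub_apply_le (hτ : 0 < τ) (h : τ < σ) (φ : RH σ) {θ θ' : ℂ}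
    (hθ : θ ∈ closure (strip τ)) (hθ' : θ' ∈ closure (strip τ)) :
    ‖φ θ - φ θ'‖ ≤ 2 * ‖φ‖ / (σ - τ) * ‖θ - θ'‖ := by
  have hsub := closure_strip_subset_strip h
  refine (convex_strip τ).closure.norm_image_sub_le_of_norm_deriv_le (f := φ) (fun z hz => ?_)
    (fun z hz => ?_) hθ' hθ
  · exact φ.differentiableOn.differentiableAt ((isOpen_strip σ).mem_nhds (hsub hz))
  · have hz' := (mem_closure_strip_iff hτ).1 hz
    exact norm_deriv_le_of_ball (sub_pos.2 h)
      (φ.differentiableOn.mono (ball_subset_strip (by linarith))) fun w _ => φ.norm_apply_le w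

/-- Bounded families in `RH σ` are relatively compact on narrower bands. -/
theorem exists_tendsto_restr {ι : Type*} (U : Ultrafilter ι) (hτ : 0 < τ) (h : τ < σ)
    {φ : ι → RH σ} {K : ℝ} (hK : ∀ i, ‖φ i‖ ≤ K) :
    ∃ ψ : RH τ, Tendsto (fun i => restr h.le (φ i)) U (𝓝 ψ) := by
  have hlim : ∀ θ : ℂ, ∃ z, Tendsto (fun i => φ i θ) U (𝓝 z) := fun θ => by
    obtain ⟨z, -, hz⟩ := (isCompact_closedBall (0 : ℂ) K).ultrafilter_le_nhds
      (U.map fun i => φ i θ) (by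
        rw [le_principal_iff]
        have : ∀ i, φ i θ ∈ closedBall (0 : ℂ) K := fun i =>
          mem_closedBall_zero_iff.2 (((φ i).norm_apply_le θ).trans (hK i))
        exact (Eventually.of_forall this : ∀ᶠ i in (U : Filter ι), φ i θ ∈ closedBall (0 : ℂ) K))
    exact ⟨z, hz⟩
  choose z hz using hlim
  refine CompleteSpace.complete (f := map (fun i => restr h.le (φ i)) U) ?_
  rw [Metric.cauchy_iff]
  refine ⟨inferInstance, fun ε hε => ?_⟩
  -- A common Lipschitz constant on the narrower band, from Cauchy's estimate; the 1 makes it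
  -- positive.
  set L := 2 * (|K| + 1) / (σ - τ) with hL
  have hL0 : 0 < L := div_pos (by positivity) (sub_pos.2 h)
  have hlip : ∀ i, ∀ θ ∈ closure (strip τ), ∀ θ' ∈ closure (strip τ),
      ‖φ i θ - φ i θ'‖ ≤ L * ‖θ - θ'‖ := fun i θ hθ θ' hθ' => by
    refine (norm_apply_sub_apply_le hτ h (φ i) hθ hθ').trans ?_
    refine mul_le_mul_of_nonneg_right (div_le_div_of_nonneg_right ?_ (sub_pos.2 h).le) (norm_nonneg _)
    linarith [hK i, le_abs_self K]
  obtain ⟨t, ht, hcover⟩ := (isCompact_fundamental τ).finite_cover_balls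
    (show 0 < ε / 8 / L by positivity)
  obtain ⟨htf, hcover⟩ := hcover
  -- Pointwise closeness on a finite net of a period, with the Lipschitz bound, gives uniform
  -- closeness; the four errors of ε/8 add up to ε/2.
  have hev : ∀ᶠ i in (U : Filter ι), ∀ c ∈ t, ‖φ i c - z c‖ < ε / 8 := by
    refine (Filter.eventually_all_finite htf).2 fun c _ => ?_
    filter_upwards [(hz c).eventually (Metric.ball_mem_nhds (z c) (show 0 < ε / 8 by positivity))]
      with i hi
    exact (dist_eq_norm _ _).symm.trans_lt hi
  refine ⟨_, image_mem_map hev, ?_⟩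
  rintro _ ⟨i, hi, rfl⟩ _ ⟨j, hj, rfl⟩
  rw [dist_eq_norm]
  refine lt_of_le_of_lt (norm_le_of_forall (K := ε / 2) (by positivity) fun θ hθ => ?_) (half_lt_self hε)
  have hθ := subset_closure hθ
  rw [sub_apply, restr_apply _ _ hθ, restr_apply _ _ hθ]
  obtain ⟨θ', hθ', hθe⟩ := exists_fundamental hθ
  have hcl := hθ'.1
  have hcl' : closure (strip τ) ⊆ closure (strip σ) := closure_mono (strip_mono h.le)
  rw [hθe, (φ i).apply_add_int (hcl' hcl), (φ j).apply_add_int (hcl' hcl)]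
  obtain ⟨c, hct, hc⟩ := mem_iUnion₂.1 (hcover hθ')
  have hcτ := (ht hct).1
  have h1 : ∀ k, ‖φ k θ' - φ k c‖ ≤ ε / 8 := fun k => by
    refine (hlip k θ' hcl c hcτ).trans ?_
    have := (mem_ball_iff_norm.1 hc).le
    calc L * ‖θ' - c‖ ≤ L * (ε / 8 / L) := by gcongr
      _ = ε / 8 := by field_simp
  have h2 := hi c hct
  have h3 := hj c hct
  calc ‖φ i θ' - φ j θ'‖ = ‖(φ i θ' - φ i c) + (φ i c - z c) - (φ j c - z c) - (φ j θ' - φ j c)‖ := by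
        congr 1; ring
    _ ≤ ‖φ i θ' - φ i c‖ + ‖φ i c - z c‖ + ‖φ j c - z c‖ + ‖φ j θ' - φ j c‖ :=
        (norm_sub_le _ _).trans (add_le_add_left ((norm_sub_le _ _).trans
          (add_le_add_left (norm_add_le _ _) _)) _)
    _ ≤ ε / 2 := by linarith [h1 i, h1 j]

end RH

/-- A periodic property that holds near every real point holds on a band. -/
theorem exists_band {P : ℂ → Prop} (hper : ∀ θ (k : ℤ), P θ → P (θ + k))
    (h : ∀ t : ℝ, ∀ᶠ θ in 𝓝 (t : ℂ), P θ) {τ : ℝ} (hτ : 0 < τ) :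
    ∃ δ, 0 < δ ∧ δ < τ ∧ ∀ θ ∈ closure (strip δ), P θ := by
  have h1 : ∀ᶠ s : ℝ in 𝓝 0, ∀ t ∈ Icc (0 : ℝ) 1, P (t + s * Complex.I) := by
    refine isCompact_Icc.eventually_forall_of_forall_eventually fun t _ => ?_
    have hc : Tendsto (fun p : ℝ × ℝ => (p.2 : ℂ) + p.1 * Complex.I) (𝓝 (0, t)) (𝓝 (t : ℂ)) := by
      have : Continuous fun p : ℝ × ℝ => (p.2 : ℂ) + p.1 * Complex.I := by fun_prop
      simpa using this.tendsto (0, t)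
    exact hc.eventually (h t)
  obtain ⟨r, hr, hball⟩ := Metric.eventually_nhds_iff.1 h1
  have hδ : 0 < min r τ / 2 := by positivity
  refine ⟨min r τ / 2, hδ, by linarith [min_le_right r τ], fun θ hθ => ?_⟩
  obtain ⟨θ', hθ', hθe⟩ := exists_fundamental hθ
  rw [hθe]
  refine hper _ _ ?_
  have := hball (y := θ'.im) (by
    rw [dist_zero_right, Real.norm_eq_abs]
    linarith [(mem_closure_strip_iff hδ).1 hθ'.1, min_le_left r τ]) θ'.re hθ'.2
  rwa [Complex.re_add_im] at this

end Restriction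

/-! ### Images of an invariant curve under the dynamics. -/

section ShiftedCurves

variable {σ : ℝ} {W : Set ℂ} {ω : ℝ} {N : ℕ} {g : Maps σ W} {φ : RH σ}

/-- The image of the curve `φ` under the `j`-th iterate of the skew product. -/
def shiftCurve (g : Maps σ W) (ω : ℝ) (φ : RH σ) (j : ℕ) : RH σ := RH.tr (-(j * ω)) (orb g ω φ j)

theorem shiftCurve_apply (hσ : 0 < σ) (h : IsGood N ω g φ) {j : ℕ} (hj : j ≤ N) {θ : ℂ}
    (hθ : θ ∈ closure (strip σ)) :
    shiftCurve g ω φ j (θ + j * ω) = iter g ω j θ (φ θ) := by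
  rw [shiftCurve, RH.tr_apply, ← orb_apply hσ h hj hθ]
  push_cast
  ring_nf

theorem sub_mul_mem_closure_strip {θ : ℂ} (hθ : θ ∈ closure (strip σ)) (l : ℕ) (ω : ℝ) :
    θ - l * ω ∈ closure (strip σ) := by
  simpa using sub_ofReal_mem_closure_strip hθ (l * ω)

theorem iter_invariant (hσ : 0 < σ) (h : IsGood N ω g φ) (hd : defect N ω (g, φ) = 0) {θ : ℂ}
    (hθ : θ ∈ closure (strip σ)) : iter g ω N θ (φ θ) = φ (θ + N * ω) := by
  have : RH.tr (N * ω) φ = orb g ω φ N := (sub_eq_zero.1 hd).symm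
  rw [← orb_apply hσ h le_rfl hθ, ← this, RH.tr_apply]
  push_cast
  rfl

theorem iter_shiftCurve (hσ : 0 < σ) (h : IsGood N ω g φ) {j : ℕ} (hj : j ≤ N) (l : ℕ) {θ : ℂ}
    (hθ : θ ∈ closure (strip σ)) :
    iter g ω l (θ + j * ω) (shiftCurve g ω φ j (θ + j * ω)) = iter g ω (l + j) θ (φ θ) := by
  rw [shiftCurve_apply hσ h hj hθ, iter_add]

theorem iter_add_period (hσ : 0 < σ) (h : IsGood N ω g φ) (hd : defect N ω (g, φ) = 0) (l : ℕ) {θ : ℂ}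
    (hθ : θ ∈ closure (strip σ)) :
    iter g ω (l + N) θ (φ θ) = iter g ω l (θ + N * ω) (φ (θ + N * ω)) := by
  rw [iter_add, iter_invariant hσ h hd hθ]

/-- Iterates beyond the N-th wrap around to the beginning of the orbit, by invariance. -/
theorem IsGood.shiftCurve (hσ : 0 < σ) (hW : IsOpen W) (h : IsGood N ω g φ)
    (hd : defect N ω (g, φ) = 0) {j : ℕ} (hj : j ≤ N) : IsGood N ω g (shiftCurve g ω φ j) := by
  refine (isGood_iff hσ hW).2 fun θ hθ l hl => ?_
  have hθ' := sub_mul_mem_closure_strip hθ j ω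
  have := iter_shiftCurve hσ h hj l hθ'
  rw [sub_add_cancel] at this
  rw [this]
  rcases lt_or_ge (l + j) N with hlt | hge
  · exact h.mem hσ hlt hθ'
  · obtain ⟨m, hm⟩ := Nat.exists_eq_add_of_le' hge
    rw [hm, iter_add_period hσ h hd m hθ']
    exact h.mem hσ (by omega) (add_mul_mem_closure_strip hθ' N ω)

theorem defect_shiftCurve (hσ : 0 < σ) (hW : IsOpen W) (h : IsGood N ω g φ)
    (hd : defect N ω (g, φ) = 0) {j : ℕ} (hj : j ≤ N) :
    defect N ω (g, QPForced.shiftCurve g ω φ j) = 0 := by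
  refine (defect_eq_zero_iff hσ (h.shiftCurve hσ hW hd hj)).2 fun θ hθ => ?_
  have hθ' := sub_mul_mem_closure_strip (subset_closure hθ) j ω
  have h1 := iter_shiftCurve hσ h hj N hθ'
  have h2 := shiftCurve_apply hσ h hj (add_mul_mem_closure_strip hθ' N ω)
  rw [sub_add_cancel] at h1
  rw [h1, add_comm N j, iter_add_period hσ h hd j hθ', ← h2]
  ring_nf

theorem shiftCurve_period (hσ : 0 < σ) (h : IsGood N ω g φ) (hd : defect N ω (g, φ) = 0) :
    shiftCurve g ω φ N = φ := by
  refine RH.ext_of_strip fun θ hθ => ?_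
  have hθ' := sub_mul_mem_closure_strip (subset_closure hθ) N ω
  have h1 := shiftCurve_apply hσ h le_rfl hθ'
  rw [iter_invariant hσ h hd hθ', sub_add_cancel] at h1
  exact h1

theorem shiftCurve_shiftCurve (hσ : 0 < σ) (hW : IsOpen W) (h : IsGood N ω g φ)
    (hd : defect N ω (g, φ) = 0) {i j : ℕ} (hij : i + j ≤ N) :
    shiftCurve g ω (shiftCurve g ω φ j) i = shiftCurve g ω φ (i + j) := by
  refine RH.ext_of_strip fun θ hθ => ?_
  have hθ' := sub_mul_mem_closure_strip (subset_closure hθ) (i + j) ω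
  have hθj := add_mul_mem_closure_strip hθ' j ω
  have h1 := shiftCurve_apply hσ (h.shiftCurve hσ hW hd (j := j) (by omega)) (j := i) (by omega) hθj
  have h2 := shiftCurve_apply hσ h hij hθ'
  rw [iter_shiftCurve hσ h (by omega) i hθ', ← h2, sub_add_cancel] at h1
  rw [← h1]
  push_cast
  ring_nf

theorem tendsto_shiftCurve (hσ : 0 < σ) {ι : Type*} {l : Filter ι} {G : ι → Maps σ W}
    {u : ι → RH σ} (h : IsGood N ω g φ) (hG : Tendsto G l (𝓝 g)) (hu : Tendsto u l (𝓝 φ)) {j : ℕ}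
    (hj : j ≤ N) :
    Tendsto (fun i => shiftCurve (G i) ω (u i) j) l (𝓝 (shiftCurve g ω φ j)) := by
  have h1 : ContinuousAt (fun p : Maps σ W × RH σ => shiftCurve p.1 ω p.2 j) (g, φ) :=
    (RH.tr (-(j * ω))).continuous.continuousAt.comp (contDiffAt_orb hσ h hj).continuousAt
  exact h1.tendsto.comp (hG.prodMk_nhds hu)

theorem orbFactor_shiftCurve (hσ : 0 < σ) (hW : IsOpen W) (h : IsGood N ω g φ)
    (hd : defect N ω (g, φ) = 0) {j l : ℕ} (hj : j ≤ N) (hl : l < N) {θ : ℂ} (hθ : θ ∈ strip σ) :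
    orbFactor g ω (shiftCurve g ω φ j) l (θ + j * ω) = factor g ω (l + j) θ (φ θ) := by
  rw [orbFactor_apply hσ hW (h.shiftCurve hσ hW hd hj) hl (add_mul_mem_strip hθ j ω), factor, factor,
    iter_shiftCurve hσ h hj l (subset_closure hθ)]
  push_cast
  ring_nf

/-- The part of the multiplier of a curve that comes from the first `j` maps. -/
def headFactor (j : ℕ) (ω : ℝ) (g : Maps σ W) (φ : RH σ) : RH σ :=
  ∏ l ∈ Finset.range j, orbFactor g ω φ l

/-- The part of the multiplier of a curve that comes from all maps but the first `j`. -/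
def tailFactor (N j : ℕ) (ω : ℝ) (g : Maps σ W) (φ : RH σ) : RH σ :=
  ∏ l ∈ Finset.range (N - j), orbFactor g ω φ (j + l)

theorem multiplier_eq_head_mul_tail {j : ℕ} (hj : j ≤ N) (ω : ℝ) (g : Maps σ W) (φ : RH σ) :
    multiplier N ω g φ = headFactor j ω g φ * tailFactor N j ω g φ := by
  rw [multiplier, headFactor, tailFactor, ← Finset.prod_range_add, Nat.add_sub_cancel' hj]

/-- Starting j steps later, the first j factors are met last, at a base point advanced by Nω. The
multiplier is a rotated product, not a translate of the original one. -/
theorem multiplier_shiftCurve (hσ : 0 < σ) (hW : IsOpen W) (h : IsGood N ω g φ)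
    (hd : defect N ω (g, φ) = 0) {j : ℕ} (hj : j ≤ N) {θ : ℂ} (hθ : θ ∈ strip σ) :
    multiplier N ω g (shiftCurve g ω φ j) (θ + j * ω)
      = tailFactor N j ω g φ θ * headFactor j ω g φ (θ + N * ω) := by
  have hθ1 := subset_closure hθ
  have hθN := add_mul_mem_strip hθ N ω
  rw [multiplier, headFactor, tailFactor, RH.prod_apply _ _ (add_mul_mem_closure_strip hθ1 j ω),
    RH.prod_apply _ _ hθ1, RH.prod_apply _ _ (subset_closure hθN)]
  have hsplit := Finset.prod_range_add
    (fun l => orbFactor g ω (shiftCurve g ω φ j) l (θ + j * ω)) (N - j) j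
  rw [Nat.sub_add_cancel hj] at hsplit
  rw [hsplit]
  congr 1
  · refine Finset.prod_congr rfl fun l hl => ?_
    have hl := Finset.mem_range.1 hl
    rw [orbFactor_shiftCurve hσ hW h hd hj (by omega) hθ, add_comm l j,
      orbFactor_apply hσ hW h (by omega) hθ]
  · refine Finset.prod_congr rfl fun l hl => ?_
    have hl := Finset.mem_range.1 hl
    have he : N - j + l + j = l + N := by omega
    rw [orbFactor_shiftCurve hσ hW h hd hj (by omega) hθ, orbFactor_apply hσ hW h (by omega) hθN, he,
      factor, factor, iter_add_period hσ h hd l hθ1]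
    push_cast
    ring_nf

theorem continuousAt_headFactor (hσ : 0 < σ) (h : IsGood N ω g φ) {j : ℕ} (hj : j ≤ N) :
    ContinuousAt (fun p : Maps σ W × RH σ => headFactor j ω p.1 p.2) (g, φ) :=
  ContDiffAt.continuousAt (𝕜 := ℝ) (n := ⊤) (contDiffAt_prod fun _ hk =>
    contDiffAt_orbFactor hσ h (lt_of_lt_of_le (Finset.mem_range.1 hk) hj))

theorem continuousAt_tailFactor (hσ : 0 < σ) (h : IsGood N ω g φ) (j : ℕ) :
    ContinuousAt (fun p : Maps σ W × RH σ => tailFactor N j ω p.1 p.2) (g, φ) :=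
  ContDiffAt.continuousAt (𝕜 := ℝ) (n := ⊤) (contDiffAt_prod fun k hk =>
    contDiffAt_orbFactor hσ h (l := j + k) (by have := Finset.mem_range.1 hk; omega))

end ShiftedCurves

/-! ### Signs of rotated products. -/

section SignLemma

variable {σ : ℝ}

theorem isLeast_range_zero_iff {f : ℝ → ℝ} :
    IsLeast (range f) 0 ↔ (∀ t, 0 ≤ f t) ∧ ∃ t, f t = 0 := by
  constructor
  · rintro ⟨⟨t, ht⟩, h⟩
    exact ⟨fun t => h ⟨t, rfl⟩, t, ht⟩
  · rintro ⟨h, t, ht⟩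
    refine ⟨⟨t, ht⟩, ?_⟩
    rintro _ ⟨t, rfl⟩
    exact h t

theorem isLeast_range_mul_pos {f p : ℝ → ℝ} (hp : ∀ t, 0 < p t) :
    IsLeast (range fun t => f t * p t) 0 ↔ IsLeast (range f) 0 := by
  simp only [isLeast_range_zero_iff, mul_nonneg_iff_of_pos_right (hp _), mul_eq_zero, (hp _).ne',
    or_false]

theorem isLeast_range_shift {f : ℝ → ℝ} (c : ℝ) :
    IsLeast (range fun t => f (t + c)) 0 ↔ IsLeast (range f) 0 := by
  rw [show (fun t => f (t + c)) = f ∘ (Equiv.addRight c) from rfl,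
    (Equiv.addRight c).surjective.range_comp]

/-- A factor of constant sign can be replaced by any other factor of the same sign. -/
theorem isLeast_of_mul_of_sign {f p q : ℝ → ℝ} {s e : ℝ} (he : e ≠ 0) (hp : ∀ t, 0 < e * p t)
    (hq : ∀ t, 0 < e * q t) (h : IsLeast (range fun t => s * (f t * p t)) 0) :
    IsLeast (range fun t => s * (f t * q t)) 0 := by
  have key : ∀ r : ℝ → ℝ, (fun t => s * (f t * r t)) = fun t => (s * e⁻¹ * f t) * (e * r t) :=
    fun r => by
      funext t
      field_simp
  rw [key] at h ⊢
  exact (isLeast_range_mul_pos hq).2 ((isLeast_range_mul_pos hp).1 h)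

theorem continuous_reEval (hσ : 0 < σ) (φ : RH σ) : Continuous fun t => reEval (φ, t) :=
  Complex.continuous_re.comp (continuous_reLine hσ φ)

/-- The sign of an element of `RH σ` without real zeros is constant, and stable. -/
theorem exists_eventually_sign (hσ : 0 < σ) {φ₀ : RH σ} (h : ∀ t, reEval (φ₀, t) ≠ 0) :
    ∃ e : ℝ, e ≠ 0 ∧ ∀ᶠ φ in 𝓝 φ₀, ∀ t, 0 < e * reEval (φ, t) := by
  have hσ0 : |(0 : ℝ)| < σ := by simpa using hσ
  obtain ⟨c, hc, hle⟩ := exists_pos_le_onLine hσ0 (φ := φ₀) fun t ht =>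
    h t ((reEval_eq_zero_iff φ₀ t).2 (by rwa [onLine_zero] at ht))
  have hle' : ∀ t, c ≤ |reEval (φ₀, t)| := fun t => by
    have := hle t
    rwa [onLine_zero, ← ofReal_reEval, Complex.norm_real, Real.norm_eq_abs] at this
  obtain ⟨e, he, hsign⟩ : ∃ e : ℝ, e ≠ 0 ∧ |e| = 1 ∧ ∀ t, e * reEval (φ₀, t) = |reEval (φ₀, t)| := by
    have hcases : (∀ t, 0 < reEval (φ₀, t)) ∨ ∀ t, reEval (φ₀, t) < 0 := by
      by_contra! hcon
      obtain ⟨⟨a, ha⟩, b, hb⟩ := hcon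
      obtain ⟨t, ht⟩ := mem_range_of_exists_le_of_exists_ge (continuous_reEval hσ φ₀) ⟨a, ha⟩ ⟨b, hb⟩
      exact h t ht
    rcases hcases with h | h
    · exact ⟨1, one_ne_zero, abs_one, fun t => by rw [one_mul, abs_of_pos (h t)]⟩
    · exact ⟨-1, by norm_num, by norm_num, fun t => by rw [abs_of_neg (h t), neg_one_mul]⟩
  refine ⟨e, he, ?_⟩
  filter_upwards [Metric.ball_mem_nhds φ₀ hc] with φ hφ t
  have h1 : |reEval (φ, t) - reEval (φ₀, t)| < c := by
    have h2 : reEval (φ, t) - reEval (φ₀, t) = ((φ - φ₀) t).re := by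
      rw [RH.sub_apply, Complex.sub_re]
      rfl
    rw [h2]
    exact ((Complex.abs_re_le_norm _).trans (RH.norm_apply_le _ _)).trans_lt (mem_ball_iff_norm.1 hφ)
  have h3 : e * reEval (φ, t) = |reEval (φ₀, t)| + e * (reEval (φ, t) - reEval (φ₀, t)) := by
    rw [← hsign.2 t]
    ring
  have h4 : |e * (reEval (φ, t) - reEval (φ₀, t))| < c := by rwa [abs_mul, hsign.1, one_mul]
  rw [h3]
  linarith [hle' t, (abs_lt.1 h4).1]

/-- Near a product `P₀ Q₀` with a unique non-degenerate extremum `0`, if the rotated product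
`Q₀(t) P₀(t + α)` has the same sign, then the extremum of a rotated product is `0` only if
the one of the product itself is. -/
theorem eventually_isLeast_of_rotated (hσ : 0 < σ) {α : ℝ} (hα : Irrational α) {P₀ Q₀ : RH σ}
    {s θ₀ : ℝ} (hs : s ≠ 0)
    (huniq : ∀ t, reEval (P₀ * Q₀, t) = 0 → ∃ k : ℤ, t = θ₀ + k)
    (h2 : partialSnd (partialSnd reEval) (P₀ * Q₀, θ₀) ≠ 0)
    (hrot : ∀ t, 0 ≤ s * (reEval (Q₀, t) * reEval (P₀, t + α))) :
    ∀ᶠ p : RH σ × RH σ in 𝓝 P₀ ×ˢ 𝓝 Q₀,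
      IsLeast (range fun t => s * (reEval (p.2, t) * reEval (p.1, t + α))) 0 →
        IsLeast (range fun t => s * reEval (p.1 * p.2, t)) 0 := by
  have hper : ∀ φ : RH σ, (∀ t, reEval (φ, t) = 0 → reEval (P₀ * Q₀, t) = 0) →
      reEval (φ, θ₀) ≠ 0 → ∀ t, reEval (φ, t) ≠ 0 := by
    intro φ hφ hne t ht
    obtain ⟨k, rfl⟩ := huniq t (hφ t ht)
    rw [reEval_add_int hσ] at ht
    exact hne ht
  by_cases hP : reEval (P₀, θ₀) = 0
  -- If both factors vanished at θ₀, non-degeneracy would make the zero of Q₀ simple while P₀(θ₀ +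
  -- α) ≠ 0 by irrationality; the rotated product would then change sign at θ₀. So one factor has no
  -- real zero, hence constant sign, and can be exchanged with its translate.
  · have hQ : reEval (Q₀, θ₀) ≠ 0 := by
      intro hQ
      rw [partialSnd_partialSnd_reEval_mul hσ, hP, hQ] at h2
      have hQ' : partialSnd reEval (Q₀, θ₀) ≠ 0 := fun h => h2 (by simp [h])
      have hPα : reEval (P₀, θ₀ + α) ≠ 0 := fun h => by
        obtain ⟨k, hk⟩ := huniq (θ₀ + α) (by rw [reEval_mul, h, zero_mul])
        exact hα.ne_int k (by linarith)
      have hmin : IsLocalMin (fun t => s * (reEval (Q₀, t) * reEval (P₀, t + α))) θ₀ :=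
        Eventually.of_forall fun t => by simpa only [hQ, zero_mul, mul_zero] using hrot t
      have hd := ((hasDerivAt_reEval hσ Q₀ θ₀).mul
        ((hasDerivAt_reEval hσ P₀ (θ₀ + α)).comp_add_const θ₀ α)).const_mul s
      have := hmin.hasDerivAt_eq_zero hd
      rw [hQ, zero_mul, add_zero] at this
      exact mul_ne_zero hs (mul_ne_zero hQ' hPα) this
    obtain ⟨e, he, hev⟩ := exists_eventually_sign hσ
      (hper Q₀ (fun t ht => by rw [reEval_mul, ht, mul_zero]) hQ)
    filter_upwards [hev.prod_inr _] with p hp h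
    have h1 : IsLeast (range fun t => s * (reEval (p.1, t) * reEval (p.2, t - α))) 0 := by
      rw [← isLeast_range_shift α]
      simpa only [add_sub_cancel_right, mul_comm (reEval (p.2, _))] using h
    simpa only [reEval_mul] using isLeast_of_mul_of_sign he (fun t => hp (t - α)) hp h1
  · obtain ⟨e, he, hev⟩ := exists_eventually_sign hσ
      (hper P₀ (fun t ht => by rw [reEval_mul, ht, zero_mul]) hP)
    filter_upwards [hev.prod_inl _] with p hp h
    simpa only [reEval_mul, mul_comm (reEval (p.1, _))] using
      isLeast_of_mul_of_sign he (fun t => hp (t + α)) hp h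

/-- Having extremum `0` on the real axis passes to the limit. -/
theorem isLeast_of_tendsto (hσ : 0 < σ) {ι : Type*} {l : Filter ι} [NeBot l] {a : ι → RH σ}
    {a₀ : RH σ} (ha : Tendsto a l (𝓝 a₀)) {s : ℝ} (hs : s ≠ 0)
    (h : ∀ᶠ i in l, IsLeast (range fun t => s * reEval (a i, t)) 0) :
    IsLeast (range fun t => s * reEval (a₀, t)) 0 := by
  rw [isLeast_range_zero_iff]
  constructor
  · intro t
    have h1 : Tendsto (fun i => s * reEval (a i, t)) l (𝓝 (s * reEval (a₀, t))) :=
      ((Complex.continuous_re.tendsto _).comp (RH.tendsto_apply ha t)).const_mul s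
    exact ge_of_tendsto h1 (h.mono fun i hi => (isLeast_range_zero_iff.1 hi).1 t)
  -- A limit without real zeros would be bounded away from 0, and so would the functions close to
  -- it.
  · by_contra! hcon
    have hσ0 : |(0 : ℝ)| < σ := by simpa using hσ
    obtain ⟨c, hc, hle⟩ := exists_pos_le_onLine hσ0 (φ := a₀) fun t ht =>
      hcon t (by rw [(reEval_eq_zero_iff a₀ t).2 (by rwa [onLine_zero] at ht), mul_zero])
    obtain ⟨i, hi, hic⟩ := (h.and (ha.eventually (Metric.ball_mem_nhds a₀ hc))).exists
    obtain ⟨t, ht⟩ := (isLeast_range_zero_iff.1 hi).2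
    have h0 : a i t = 0 := (reEval_eq_zero_iff _ _).1 ((mul_eq_zero.1 ht).resolve_left hs)
    have h1 := hle t
    have h2 := RH.norm_apply_le (a i - a₀) t
    rw [RH.sub_apply, h0, zero_sub, norm_neg] at h2
    rw [onLine_zero] at h1
    have h3 : ‖a i - a₀‖ < c := mem_ball_iff_norm.1 hic
    linarith

end SignLemma

/-! ### Limits of attracting curves. -/

section LimitCurves

variable {τ σ ρ : ℝ} {W : Set ℂ} {ω K₀ : ℝ} {n : ℕ}

theorem RH.ext_of_real (hσ : 0 < σ) {φ ψ : RH σ} (h : ∀ t : ℝ, φ t = ψ t) : φ = ψ := by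
  rw [← sub_eq_zero]
  refine RH.eq_zero_of_onLine _ (s := 0) (by simpa using hσ) fun t => ?_
  rw [onLine_zero, RH.sub_apply, h, sub_self]

theorem iter_restrict_of_mem (h : σ ≤ ρ) (f : Maps ρ W) {θ z : ℂ} (hθ : θ ∈ closure (strip σ))
    {k : ℕ} (hk : ∀ l < k, iter (restrict h f) ω l θ z ∈ closure W) :
    iter f ω k θ z = iter (restrict h f) ω k θ z := by
  induction k using Nat.strong_induction_on with
  | _ k ih =>
    exact (iter_restrict h f hθ fun l hl => by
      rw [ih l hl fun m hm => hk m (by omega)]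
      exact hk l hl).symm

/-- The limit orbit is only known to lie in the closure of W, so just the continuity of the maps on
the closed domain is used. -/
theorem tendsto_iter {ι : Type*} {l : Filter ι} [NeBot l] {G : ι → Maps σ W} {F : Maps σ W}
    (hG : Tendsto G l (𝓝 F)) {u : ι → ℂ} {z θ : ℂ} (hu : Tendsto u l (𝓝 z))
    (hθ : θ ∈ closure (strip σ)) {k : ℕ}
    (hmem : ∀ j < k, ∀ i, iter (G i) ω j θ (u i) ∈ closure W) :
    Tendsto (fun i => iter (G i) ω k θ (u i)) l (𝓝 (iter F ω k θ z)) := by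
  induction k with
  | zero => exact hu
  | succ k ih =>
    have h1 := ih fun j hj => hmem j (by omega)
    have h2 : ∀ i, iter (G i) ω k θ (u i) ∈ closure W := hmem k (by omega)
    have h3 : iter F ω k θ z ∈ closure W :=
      isClosed_closure.mem_of_tendsto h1 (Eventually.of_forall h2)
    have hθk := add_mul_mem_closure_strip hθ k ω
    have hdom : ∀ w ∈ closure W, (θ + k * ω, w) ∈ dom σ W := fun w hw => by
      rw [dom_eq]
      exact ⟨hθk, hw⟩
    have h4 : Tendsto (fun i => ev F.1 (θ + k * ω, iter (G i) ω k θ (u i))) l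
        (𝓝 (ev F.1 (θ + k * ω, iter F ω k θ z))) :=
      (continuousOn_ev F _ (hdom _ h3)).tendsto.comp (tendsto_nhdsWithin_iff.2
        ⟨tendsto_const_nhds.prodMk_nhds h1, Eventually.of_forall fun i => hdom _ (h2 i)⟩)
    have h5 : Tendsto (fun i => ev (G i - F).1 (θ + k * ω, iter (G i) ω k θ (u i))) l (𝓝 0) :=
      squeeze_zero_norm (fun i => norm_ev_le (G i - F) _) (tendsto_iff_norm_sub_tendsto_zero.1 hG)
    have h6 := h5.add h4
    rw [zero_add] at h6
    refine h6.congr fun i => ?_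
    rw [ev_coe_sub, sub_add_cancel]
    rfl

theorem ev_add_int (g : Maps σ W) {θ z : ℂ} (hθ : θ ∈ strip σ) (hz : z ∈ W) (m : ℤ) :
    ev g.1 (θ + m, z) = ev g.1 (θ, z) := by
  have hmem : ∀ m : ℤ, θ + m ∈ strip σ := fun m => by
    simpa using add_ofReal_mem_strip hθ (m : ℝ)
  induction m using Int.induction_on with
  | zero => simp
  | succ i ih =>
    rw [← ih, ← g.2.2.2 _ (hmem i) z hz]
    push_cast
    ring_nf
  | pred i ih =>
    rw [← ih, ← g.2.2.2 _ (hmem (-i - 1)) z hz]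
    push_cast
    ring_nf

theorem iter_add_int (g : Maps σ W) (φ : RH σ) {θ : ℂ} (hθ : θ ∈ strip σ) (m : ℤ) {k : ℕ}
    (hk : ∀ l < k, iter g ω l θ (φ θ) ∈ W) :
    iter g ω k (θ + m) (φ (θ + m)) = iter g ω k θ (φ θ) := by
  induction k with
  | zero => exact φ.apply_add_int (subset_closure hθ) m
  | succ k ih =>
    rw [iter_succ, iter_succ, ih fun l hl => hk l (by omega), add_right_comm,
      ev_add_int g (add_mul_mem_strip hθ k ω) (hk k (by omega))]

theorem continuousAt_iter (hW : IsOpen W) (g : Maps σ W) (φ : RH σ) {θ : ℂ} (hθ : θ ∈ strip σ)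
    {k : ℕ} (hk : ∀ l < k, iter g ω l θ (φ θ) ∈ W) :
    ContinuousAt (fun θ => iter g ω k θ (φ θ)) θ := by
  induction k with
  | zero => exact φ.differentiableOn.continuousOn.continuousAt ((isOpen_strip σ).mem_nhds hθ)
  | succ k ih =>
    have h1 := ih fun l hl => hk l (by omega)
    have h2 : ContinuousAt (ev g.1) (θ + k * ω, iter g ω k θ (φ θ)) :=
      (differentiableOn_ev g).continuousOn.continuousAt
        (((isOpen_strip σ).prod hW).mem_nhds ⟨add_mul_mem_strip hθ k ω, hk k (by omega)⟩)
    exact ContinuousAt.comp (f := fun θ : ℂ => (θ + k * ω, iter g ω k θ (φ θ))) h2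
      ((by fun_prop : ContinuousAt (fun θ : ℂ => θ + k * ω) θ).prodMk h1)

/-- A curve whose iterates over the real axis lie in `W` is good on some narrower band. -/
theorem exists_isGood_restrict (hσ : 0 < σ) (hW : IsOpen W) {N : ℕ} (g : Maps σ W) (φ : RH σ)
    (h : ∀ t : ℝ, ∀ l < N, iter g ω l t (φ t) ∈ W) :
    ∃ (δ : ℝ) (hδ : δ < σ), 0 < δ ∧ IsGood N ω (restrict hδ.le g) (RH.restr hδ.le φ) := by
  obtain ⟨δ, hδ, hδσ, hP⟩ := exists_band
    (P := fun θ => θ ∈ strip σ ∧ ∀ l < N, iter g ω l θ (φ θ) ∈ W) (fun θ k hθ => by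
      refine ⟨by simpa using add_ofReal_mem_strip hθ.1 (k : ℝ), fun l hl => ?_⟩
      rw [iter_add_int g φ hθ.1 k fun j hj => hθ.2 j (by omega)]
      exact hθ.2 l hl) (fun t => by
      have ht := ofReal_mem_strip hσ t
      refine Eventually.and ((isOpen_strip σ).mem_nhds ht) ?_
      have : ∀ l ∈ Finset.range N, ∀ᶠ θ in 𝓝 (t : ℂ), iter g ω l θ (φ θ) ∈ W := fun l hl => by
        have hl := Finset.mem_range.1 hl
        exact (continuousAt_iter hW g φ ht fun j hj => h t j (by omega)).eventually
          (hW.mem_nhds (h t l hl))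
      filter_upwards [(Finset.eventually_all _).2 this] with θ hθ l hl
      exact hθ l (Finset.mem_range.2 hl)) hσ
  refine ⟨δ, hδσ, hδ, (isGood_iff (g := restrict hδσ.le g) hδ hW).2 fun θ hθ l hl => ?_⟩
  have := (hP θ hθ).2
  rw [RH.restr_apply _ _ hθ, iter_restrict hδσ.le g hθ fun j hj => subset_closure (this j (by omega))]
  exact this l hl

/-- The restrictions to a narrower band of curves of maps that converge have a limit. -/
theorem exists_limitCurve {ι : Type*} (U : Ultrafilter ι) (hτ : 0 < τ) (hτσ : τ < σ) (hW : IsOpen W)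
    (hWb : Bornology.IsBounded W) {G : ι → Maps σ W} {y : ι → ℂ → ℂ}
    (hy : ∀ i, IsAttractingCurve K₀ ω n (G i) (y i)) :
    ∃ (u : ι → RH τ) (ψ : RH τ), Tendsto u U (𝓝 ψ) ∧ ∀ i, (∀ θ ∈ closure (strip τ), u i θ = y i θ) ∧
      IsGood (2 ^ n) ω (restrict hτσ.le (G i)) (u i) ∧
      defect (2 ^ n) ω (restrict hτσ.le (G i), u i) = 0 ∧
      ∀ θ ∈ strip τ, multiplier (2 ^ n) ω (restrict hτσ.le (G i)) (u i) θ
        = slope (G i) ω n θ (y i θ) := by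
  obtain ⟨μ, hτμ, hμσ⟩ := exists_between hτσ
  choose φ hφ _ _ _ using fun i => (hy i).exists_restrict (hτ.trans hτμ) hμσ hW hWb
  choose u hu hgood hd hm using fun i => (hy i).exists_restrict hτ hτσ hW hWb
  obtain ⟨K, hK⟩ := hWb.exists_norm_le
  have hsub : strip μ ⊆ strip σ := strip_mono hμσ.le
  have hK0 : 0 ≤ |K| := abs_nonneg K
  obtain ⟨ψ, hψ⟩ := RH.exists_tendsto_restr U hτ hτμ (φ := φ) (K := |K|) fun i =>
    RH.norm_le_of_forall hK0 fun θ hθ => by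
      rw [hφ i θ (subset_closure hθ)]
      exact (hK _ ((hy i).mem θ (hsub hθ) 0 (by positivity))).trans (le_abs_self K)
  refine ⟨u, ψ, hψ.congr fun i => RH.ext_of_strip fun θ hθ => ?_, fun i =>
    ⟨hu i, hgood i, hd i, hm i⟩⟩
  have hθ := subset_closure hθ
  rw [RH.restr_apply _ _ hθ, hφ i θ (closure_mono (strip_mono hτμ.le) hθ), hu i θ hθ]

end LimitCurves

/-! ### Properties of a limit curve. -/

section Global

variable {τ σ ρ : ℝ} {W : Set ℂ} {ω K₀ : ℝ} {n : ℕ}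

theorem tendsto_of_continuousAt_pair {A B C : Type*} [TopologicalSpace A] [TopologicalSpace B]
    [TopologicalSpace C] {M : A → B → C} {a : A} {b : B}
    (h : ContinuousAt (fun p : A × B => M p.1 p.2) (a, b)) {ι : Type*} {l : Filter ι} {G : ι → A}
    {u : ι → B} (hG : Tendsto G l (𝓝 a)) (hu : Tendsto u l (𝓝 b)) :
    Tendsto (fun i => M (G i) (u i)) l (𝓝 (M a b)) :=
  h.tendsto.comp (hG.prodMk_nhds hu)

theorem tendsto_multiplier (hσ : 0 < σ) {N : ℕ} {ι : Type*} {l : Filter ι} {G : ι → Maps σ W}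
    {g : Maps σ W} {u : ι → RH σ} {φ : RH σ} (h : IsGood N ω g φ) (hG : Tendsto G l (𝓝 g))
    (hu : Tendsto u l (𝓝 φ)) :
    Tendsto (fun i => multiplier N ω (G i) (u i)) l (𝓝 (multiplier N ω g φ)) := by
  exact tendsto_of_continuousAt_pair (M := fun g φ => multiplier N ω g φ)
    (contDiffAt_multiplier hσ h).continuousAt hG hu

/-- A limit of attracting curves with extremal slope `0` has exponent at most `-K₀` and extremal
slope `0`, provided that its iterates over the real axis stay in `W`. -/
theorem limitCurve_conditions {ι : Type*} (U : Ultrafilter ι) (hτ : 0 < τ) (hτσ : τ < σ)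
    (hσρ : σ ≤ ρ) (hW : IsOpen W) (hWb : Bornology.IsBounded W) (hω : Irrational ω) {f : Maps ρ W}
    {G : ι → Maps σ W} (hG : Tendsto G U (𝓝 (restrict hσρ f))) {y : ι → ℂ → ℂ} {s : ℝ} (hs : s ≠ 0)
    (hy : ∀ i, IsAttractingCurve K₀ ω n (G i) (y i)) (hext : ∀ i, ExtSlopeZero s ω n (G i) (y i))
    {u : ι → RH τ} {ψ : RH τ} (hu : ∀ i, ∀ θ ∈ closure (strip τ), u i θ = y i θ)
    (hψ : Tendsto u U (𝓝 ψ)) (hmem : ∀ t : ℝ, ∀ l < 2 ^ n, iter f ω l t (ψ t) ∈ W) {η : ℂ → ℂ}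
    (hη : ∀ t : ℝ, η t = ψ t) : ExponentLe K₀ ω n f η ∧ ExtSlopeZero s ω n f η := by
  have hτρ : τ ≤ ρ := hτσ.le.trans hσρ
  have hiter : ∀ t : ℝ, ∀ l ≤ 2 ^ n, iter (restrict hτρ f) ω l t (ψ t) = iter f ω l t (ψ t) :=
    fun t l hl => iter_restrict hτρ f (subset_closure (ofReal_mem_strip hτ t))
      fun j hj => subset_closure (hmem t j (by omega))
  -- Only the real orbit of the limit is known to stay in W. On a still narrower band the whole
  -- orbit does, and there the multipliers converge.
  obtain ⟨δ, hδτ, hδ, hgood⟩ := exists_isGood_restrict (ω := ω) (N := 2 ^ n) hτ hW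
    (restrict hτρ f : Maps τ W) ψ fun t l hl => by
      rw [hiter t l hl.le]
      exact hmem t l hl
  rw [restrict_restrict] at hgood
  set Fδ : Maps δ W := restrict (hδτ.le.trans hτρ) f with hFδ
  set ψδ : RH δ := RH.restr hδτ.le ψ with hψδ
  choose v hv _ _ hm using fun i => (hy i).exists_restrict hδ (hδτ.trans hτσ) hW hWb
  have hGδ : Tendsto (fun i => (restrict (hδτ.trans hτσ).le (G i) : Maps δ W)) U (𝓝 Fδ) :=
    tendsto_restrict _ hG
  have hvδ : Tendsto v U (𝓝 ψδ) := (RH.tendsto_restr hδτ.le hψ).congr fun i =>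
    RH.ext_of_strip fun θ hθ => by
      have hθ := subset_closure hθ
      rw [RH.restr_apply _ _ hθ, hu i θ (closure_mono (strip_mono hδτ.le) hθ), hv i θ hθ]
  have hmul := tendsto_multiplier hδ hgood hGδ hvδ
  have hψδt : ∀ t : ℝ, ψδ t = η t := fun t => by
    rw [hη, hψδ, RH.restr_apply _ _ (subset_closure (ofReal_mem_strip hδ t))]
  have hslope : ∀ t : ℝ, multiplier (2 ^ n) ω Fδ ψδ t = slope f ω n t (η t) := fun t => by
    rw [multiplier_eq_slope hδ hW hgood (ofReal_mem_strip hδ t), hψδt]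
    exact slope_restrict (hδτ.le.trans hτρ) hW f (ofReal_mem_strip hδ t) fun l hl => by
      rw [hη]
      exact hmem t l hl
  constructor
  · have h1 := logIntegral_le_of_tendsto (c := -K₀) hω hδ hmul (Eventually.of_forall fun i => by
      simp only [hm i _ (ofReal_mem_strip hδ _)]
      exact (hy i).exponent)
    simp only [hslope] at h1
    exact h1
  · have h1 := isLeast_of_tendsto hδ hmul hs (Eventually.of_forall fun i =>
      (hext i).multiplier_isLeast hδ (hm i))
    simpa only [ExtSlopeZero, reEval, hslope] using h1

/-- A limit of invariant curves is an invariant curve. -/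
theorem limitCurve_isRealPeriodicCurve {ι : Type*} (U : Ultrafilter ι) (hτ : 0 < τ) (hτσ : τ < σ)
    (hσρ : σ ≤ ρ) {f : Maps ρ W}
    {G : ι → Maps σ W} (hG : Tendsto G U (𝓝 (restrict hσρ f)))
    {u : ι → RH τ} {ψ : RH τ} (hψ : Tendsto u U (𝓝 ψ))
    (hgood : ∀ i, IsGood (2 ^ n) ω (restrict hτσ.le (G i)) (u i))
    (hd : ∀ i, defect (2 ^ n) ω (restrict hτσ.le (G i), u i) = 0) :
    IsRealPeriodicCurve ω n f fun t => (ψ t).re := by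
  have hτρ : τ ≤ ρ := hτσ.le.trans hσρ
  have hGτ : Tendsto (fun i => (restrict hτσ.le (G i) : Maps τ W)) U (𝓝 (restrict hτρ f)) :=
    tendsto_restrict _ hG
  have hcl : ∀ t : ℝ, (t : ℂ) ∈ closure (strip τ) := fun t => subset_closure (ofReal_mem_strip hτ t)
  have hlim : ∀ t : ℝ, ∀ l ≤ 2 ^ n, Tendsto
      (fun i => iter (restrict hτσ.le (G i)) ω l t (u i t)) U
        (𝓝 (iter (restrict hτρ f) ω l t (ψ t))) := fun t l hl =>
    tendsto_iter hGτ (RH.tendsto_apply hψ t) (hcl t) fun j hj i =>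
      subset_closure ((hgood i).mem (g := restrict hτσ.le (G i)) hτ (by omega) (hcl t))
  have hmem : ∀ t : ℝ, ∀ l < 2 ^ n, iter (restrict hτρ f) ω l t (ψ t) ∈ closure W := fun t l hl =>
    isClosed_closure.mem_of_tendsto (hlim t l hl.le) (Eventually.of_forall fun i =>
      subset_closure ((hgood i).mem (g := restrict hτσ.le (G i)) hτ hl (hcl t)))
  have hiter : ∀ t : ℝ, ∀ l ≤ 2 ^ n, iter f ω l t (ψ t) = iter (restrict hτρ f) ω l t (ψ t) :=
    fun t l hl => iter_restrict_of_mem hτρ f (hcl t) fun j hj => hmem t j (by omega)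
  refine ⟨fun t _ => ?_, fun t => ?_, fun t j hj => ?_, fun t => ?_⟩
  · have h1 := analyticOnNhd_onLine ψ (s := 0) (by simpa using hτ) t (mem_univ t)
    have h2 := (Complex.reCLM.analyticAt (onLine ψ 0 t)).comp h1
    refine h2.congr (Eventually.of_forall fun t => ?_)
    simp [onLine_zero]
  · have := ψ.apply_add_one (hcl t)
    push_cast
    rw [this]
  · rw [ψ.ofReal_re_apply, hiter t j hj.le]
    exact hmem t j hj
  · rw [ψ.ofReal_re_apply, ψ.ofReal_re_apply, hiter t _ le_rfl]
    refine tendsto_nhds_unique (RH.tendsto_apply hψ _) ((hlim t _ le_rfl).congr fun i => ?_)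
    rw [iter_invariant (g := restrict hτσ.le (G i)) hτ (hgood i) (hd i) (hcl t)]
    push_cast
    rfl

end Global

/-! ### Limit curves that are iterates of the given one. -/

section Iterates

variable {τ σ ρ : ℝ} {W : Set ℂ} {ω K₀ : ℝ} {n : ℕ}

theorem ExtSlopeZero.exists_zero (hσ : 0 < σ) {f : Maps ρ W} {x : ℂ → ℂ} {s : ℝ} (hs : s ≠ 0)
    (h0 : ExtSlopeZero s ω n f x)
    (h : HasUniqueNondegExt s fun θ : ℝ => (slope f ω n θ (x θ)).re) {a : RH σ}
    (ha : ∀ θ ∈ strip σ, a θ = slope f ω n θ (x θ)) :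
    ∃ θ₀, reEval (a, θ₀) = 0 ∧ (∀ t, 0 ≤ s * reEval (a, t)) ∧
      (∀ t, reEval (a, t) = 0 → ∃ k : ℤ, t = θ₀ + k) ∧
      0 < s * partialSnd (partialSnd reEval) (a, θ₀) := by
  refine HasUniqueNondegExt.exists_zero hσ hs ?_ (h0.multiplier_isLeast hσ ha)
  simpa only [reEval, ha _ (ofReal_mem_strip hσ _)] using h

/-- For invariant curves `w` of maps near `F`, close to a curve with a unique non-degenerate
extremal slope `0`, the extremal slope along `w` is `0` as soon as it is along an iterate. -/
theorem eventually_isLeast_of_shiftCurve (hσ : 0 < σ) (hW : IsOpen W) (hω : Irrational ω) {N j : ℕ}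
    (hN : N ≠ 0) (hj : j ≤ N) {F : Maps σ W} {φ : RH σ} (h : IsGood N ω F φ)
    (hd : defect N ω (F, φ) = 0) {s θ₀ : ℝ} (hs : s ≠ 0)
    (huniq : ∀ t, reEval (multiplier N ω F φ, t) = 0 → ∃ k : ℤ, t = θ₀ + k)
    (h2 : 0 < s * partialSnd (partialSnd reEval) (multiplier N ω F φ, θ₀)) {ι : Type*} {l : Filter ι}
    [NeBot l] {G : ι → Maps σ W} (hG : Tendsto G l (𝓝 F)) {w : ι → RH σ} (hw : Tendsto w l (𝓝 φ))
    (hgood : ∀ i, IsGood N ω (G i) (w i)) (hdw : ∀ i, defect N ω (G i, w i) = 0)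
    (hleast : ∀ i, IsLeast (range fun t =>
      s * reEval (multiplier N ω (G i) (shiftCurve (G i) ω (w i) j), t)) 0) :
    ∀ᶠ i in l, IsLeast (range fun t => s * reEval (multiplier N ω (G i) (w i), t)) 0 := by
  have hrot : ∀ (g : Maps σ W) (v : RH σ), IsGood N ω g v → defect N ω (g, v) = 0 → ∀ t : ℝ,
      reEval (multiplier N ω g (shiftCurve g ω v j), t + j * ω)
        = reEval (tailFactor N j ω g v, t) * reEval (headFactor j ω g v, t + N * ω) := by
    intro g v hg hv t
    have := multiplier_shiftCurve hσ hW hg hv hj (ofReal_mem_strip hσ t)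
    apply Complex.ofReal_injective
    rw [Complex.ofReal_mul, ofReal_reEval, ofReal_reEval, ofReal_reEval]
    push_cast
    exact this
  have hshift := tendsto_shiftCurve (j := j) hσ h hG hw hj
  have hmul := tendsto_multiplier hσ (h.shiftCurve hσ hW hd hj) hG hshift
  have hlim := isLeast_of_tendsto hσ hmul hs (Eventually.of_forall hleast)
  have hev := eventually_isLeast_of_rotated hσ (hω.natCast_mul hN)
    (P₀ := headFactor j ω F φ) (Q₀ := tailFactor N j ω F φ) (θ₀ := θ₀) hs
    (by rwa [← multiplier_eq_head_mul_tail hj])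
    (by rw [← multiplier_eq_head_mul_tail hj]; exact fun h => by simp [h] at h2)
    (fun t => by
      rw [← hrot F φ h hd]
      exact (isLeast_range_zero_iff.1 hlim).1 _)
  have hP := tendsto_of_continuousAt_pair (M := fun g φ => headFactor j ω g φ)
    (continuousAt_headFactor hσ h hj) hG hw
  have hQ := tendsto_of_continuousAt_pair (M := fun g φ => tailFactor N j ω g φ)
    (continuousAt_tailFactor hσ h j) hG hw
  filter_upwards [(hP.prodMk hQ).eventually hev] with i hi
  rw [multiplier_eq_head_mul_tail hj]
  refine hi ?_
  have := (isLeast_range_shift (j * ω)).2 (hleast i)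
  simpa only [hrot _ _ (hgood i) (hdw i)] using this

/-- If the limit curve is an iterate of `x`, then the curves of the maps near the limit are
iterates of the local ones, and the latter have extremal slope `0`, too. -/
theorem eventually_isLeast_of_iterate {ι : Type*} (U : Ultrafilter ι) (hτ : 0 < τ) (hτσ : τ < σ)
    (hσρ : σ < ρ) (hW : IsOpen W) (hWb : Bornology.IsBounded W) (hω : Irrational ω) {f : Maps ρ W}
    {x : ℂ → ℂ} (hx : IsAttractingCurve K₀ ω n f x) {s : ℝ} (hs : s ≠ 0)
    (hx0 : ExtSlopeZero s ω n f x)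
    (hnd : HasUniqueNondegExt s fun θ : ℝ => (slope f ω n θ (x θ)).re)
    (hc : ∀ a : RH τ, (∀ θ ∈ strip τ, a θ = slope f ω n θ (x θ)) →
      IsContracting ((2 ^ n : ℕ) * ω) a) {φ : RH σ} (hφ : ∀ θ ∈ closure (strip σ), φ θ = x θ)
    {X : Maps σ W → RH σ} (hX : IsLocalCurve K₀ ω n (restrict hσρ.le f) φ X)
    {G : ι → Maps σ W} (hG : Tendsto G U (𝓝 (restrict hσρ.le f))) {y : ι → ℂ → ℂ}
    (hext : ∀ i, ExtSlopeZero s ω n (G i) (y i)) {u : ι → RH τ} {ψ : RH τ}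
    (hψ : Tendsto u U (𝓝 ψ))
    (hgood : ∀ i, IsGood (2 ^ n) ω (restrict hτσ.le (G i)) (u i))
    (hd : ∀ i, defect (2 ^ n) ω (restrict hτσ.le (G i), u i) = 0)
    (hm : ∀ i, ∀ θ ∈ strip τ, multiplier (2 ^ n) ω (restrict hτσ.le (G i)) (u i) θ
      = slope (G i) ω n θ (y i θ)) {j : ℕ} (hj : j < 2 ^ n)
    (hψj : ∀ t : ℝ, ψ ((t + j * ω : ℝ) : ℂ) = iter f ω j t (x t)) :
    ∀ᶠ i in (U : Filter ι), IsLeast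
      (range fun t : ℝ => s * reEval (multiplier (2 ^ n) ω (G i) (X (G i)), t)) 0 := by
  have hσ := hτ.trans hτσ
  have hτρ := hτσ.trans hσρ
  obtain ⟨xτ, hxτ, hxgood, hxd, hxm⟩ := hx.exists_restrict hτ hτρ hW hWb
  set F : Maps τ W := restrict hτρ.le f with hF
  set H : ι → Maps τ W := fun i => restrict hτσ.le (G i) with hH
  have hHF : Tendsto H U (𝓝 F) := tendsto_restrict _ hG
  -- Both sides are holomorphic and agree on the real axis.
  have hψx : ψ = shiftCurve F ω xτ j := by
    refine RH.ext_of_real hτ fun t => ?_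
    have ht := subset_closure (ofReal_mem_strip hτ (t - j * ω))
    have h1 := shiftCurve_apply hτ hxgood hj.le ht
    have h2 := hψj (t - j * ω)
    have h3 : iter F ω j ((t - j * ω : ℝ) : ℂ) (x ((t - j * ω : ℝ) : ℂ))
        = iter f ω j ((t - j * ω : ℝ) : ℂ) (x ((t - j * ω : ℝ) : ℂ)) :=
      iter_restrict hτρ.le f ht fun l hl => subset_closure
        (hx.mem _ (strip_mono hτρ.le (ofReal_mem_strip hτ _)) l (by omega))
    rw [hxτ _ ht, h3, ← h2] at h1
    push_cast at h1
    simpa only [sub_add_cancel] using h1.symm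
  have hψgood : IsGood (2 ^ n) ω F ψ := hψx ▸ hxgood.shiftCurve hτ hW hxd hj.le
  -- The remaining 2^n - j iterations complete the period, so these curves converge to x itself.
  set w : ι → RH τ := fun i => shiftCurve (H i) ω (u i) (2 ^ n - j) with hw
  have hle : 2 ^ n - j ≤ 2 ^ n := Nat.sub_le _ _
  have hwx : Tendsto w U (𝓝 xτ) := by
    have h1 := tendsto_shiftCurve (j := 2 ^ n - j) hτ hψgood hHF hψ hle
    rwa [hψx, shiftCurve_shiftCurve hτ hW hxgood hxd (by omega), Nat.sub_add_cancel hj.le,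
      shiftCurve_period hτ hxgood hxd] at h1
  have hwgood : ∀ i, IsGood (2 ^ n) ω (H i) (w i) := fun i =>
    IsGood.shiftCurve hτ hW (hgood i) (hd i) hle
  have hwd : ∀ i, defect (2 ^ n) ω (H i, w i) = 0 := fun i =>
    defect_shiftCurve hτ hW (hgood i) (hd i) hle
  have hwu : ∀ i, shiftCurve (H i) ω (w i) j = u i := fun i => by
    rw [hw, shiftCurve_shiftCurve hτ hW (hgood i) (hd i) (by omega), Nat.add_sub_cancel' hj.le,
      shiftCurve_period hτ (hgood i) (hd i)]
  obtain ⟨θ₀, -, -, huniq, h2⟩ := hx0.exists_zero hτ hs hnd hxm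
  have hleast := eventually_isLeast_of_shiftCurve hτ hW hω (by positivity) hj.le hxgood hxd hs huniq h2
    hHF hwx hwgood hwd fun i => by
      rw [hwu]
      exact (hext i).multiplier_isLeast hτ (hm i)
  obtain ⟨Y, hY⟩ := exists_isLocalCurve (K₀ := K₀) hτ hW hxgood hxd (hc _ hxm) (by
    simp only [hxm _ (ofReal_mem_strip hτ _)]
    exact hx.exponent)
  have hzx : Tendsto (fun i => RH.restr hτσ.le (X (G i))) U (𝓝 xτ) := by
    have h1 : Tendsto (fun i => X (G i)) U (𝓝 φ) := by
      rw [← hX.apply_self]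
      exact hX.contDiffAt.continuousAt.tendsto.comp hG
    have h3 : RH.restr hτσ.le φ = xτ := RH.ext_of_strip fun θ hθ => by
      have hθ := subset_closure hθ
      rw [RH.restr_apply _ _ hθ, hxτ θ hθ, hφ θ (closure_mono (strip_mono hτσ.le) hθ)]
    rw [← h3]
    exact RH.tendsto_restr _ h1
  filter_upwards [hleast, hG.eventually hX.isGood, hG.eventually hX.defect_eq_zero,
    hG.eventually hX.exponent, (hHF.prodMk_nhds hwx).eventually hY.unique,
    (hHF.prodMk_nhds hzx).eventually hY.unique] with i h1 h3 h4 h5 h6 h7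
  obtain ⟨z, hz, hzgood, hzd, hzm⟩ :=
    (h3.isAttractingCurve hσ hW h4 h5).exists_restrict hτ hτσ hW hWb
  have hzr : RH.restr hτσ.le (X (G i)) = z := RH.ext_of_strip fun θ hθ => by
    have hθ := subset_closure hθ
    rw [RH.restr_apply _ _ hθ, hz θ hθ]
  rw [hzr] at h7
  -- Both are invariant curves near x on the narrower band, hence equal by local uniqueness there;
  -- extremum 0 passes from w i to X(G i).
  have hwz : w i = z := (h6 (hwd i)).trans (h7 hzd).symm
  rw [hwz] at h1
  have hmz : ∀ t : ℝ, reEval (multiplier (2 ^ n) ω (H i) z, t)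
      = reEval (multiplier (2 ^ n) ω (G i) (X (G i)), t) := fun t => by
    simp only [reEval]
    rw [hzm _ (ofReal_mem_strip hτ t), multiplier_eq_slope hσ hW h3 (ofReal_mem_strip hσ t)]
  simpa only [hmz] using h1

end Iterates

/-! ### Assembly of the two claims. -/

section Main

variable {τ σ ρ : ℝ} {W : Set ℂ} {ω K₀ : ℝ} {n : ℕ}

/-- If `x` is the only periodic curve of `f` with extremal slope `0`, then the attracting curves
with extremal slope `0` of the maps near `f` are iterates of the local ones. -/
theorem IsLocalCurve.eventually_upsilon (hσ : 0 < σ) (hσρ : σ < ρ) (hW : IsOpen W)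
    (hWb : Bornology.IsBounded W) (hω : Irrational ω) {f : Maps ρ W}
    {x : ℂ → ℂ} (hx : IsAttractingCurve K₀ ω n f x) {s : ℝ} (hs : s ≠ 0)
    (hx0 : ExtSlopeZero s ω n f x)
    (hnd : HasUniqueNondegExt s fun θ : ℝ => (slope f ω n θ (x θ)).re)
    (hc : ∀ a : RH (σ / 2), (∀ θ ∈ strip (σ / 2), a θ = slope f ω n θ (x θ)) →
      IsContracting ((2 ^ n : ℕ) * ω) a) {φ : RH σ} (hφ : ∀ θ ∈ closure (strip σ), φ θ = x θ)
    {X : Maps σ W → RH σ} (hX : IsLocalCurve K₀ ω n (restrict hσρ.le f) φ X)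
    (honly : IsOnlyCurve ω n f x fun y => ExponentLe K₀ ω n f y ∧ ExtSlopeZero s ω n f y) :
    ∀ᶠ g in 𝓝 (restrict hσρ.le f : Maps σ W), (g ∈ Upsilon s K₀ ω n ↔
      IsLeast (range fun t : ℝ => s * reEval (multiplier (2 ^ n) ω g (X g), t)) 0) := by
  have hforward : ∀ᶠ g in 𝓝 (restrict hσρ.le f : Maps σ W), g ∈ Upsilon s K₀ ω n →
      IsLeast (range fun t : ℝ => s * reEval (multiplier (2 ^ n) ω g (X g), t)) 0 := by
    by_contra hcon
    -- The maps violating the implication accumulate at f, and an ultrafilter on them replaces a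
    -- sequence of counterexamples.
    set ι := {g : Maps σ W // ¬(g ∈ Upsilon s K₀ ω n →
      IsLeast (range fun t : ℝ => s * reEval (multiplier (2 ^ n) ω g (X g), t)) 0)}
    have : NeBot (comap (Subtype.val : ι → Maps σ W) (𝓝 (restrict hσρ.le f))) := by
      rw [comap_neBot_iff_frequently]
      exact (not_eventually.1 hcon).mono fun g hg => ⟨⟨g, hg⟩, rfl⟩
    set U : Ultrafilter ι := Ultrafilter.of (comap Subtype.val (𝓝 (restrict hσρ.le f)))
    have hG : Tendsto (Subtype.val : ι → Maps σ W) U (𝓝 (restrict hσρ.le f)) :=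
      tendsto_comap.mono_left (Ultrafilter.of_le _)
    have hbad : ∀ i : ι, i.1 ∈ Upsilon s K₀ ω n ∧
        ¬IsLeast (range fun t : ℝ => s * reEval (multiplier (2 ^ n) ω i.1 (X i.1), t)) 0 :=
      fun i => Classical.not_imp.1 i.2
    choose y hy hext using fun i => (hbad i).1
    have hτ := half_pos hσ
    obtain ⟨u, ψ, hψ, hu⟩ := exists_limitCurve U hτ (half_lt_self hσ) hW hWb hy
    rcases honly _ (limitCurve_isRealPeriodicCurve U hτ (half_lt_self hσ) hσρ.le hG hψ
      (fun i => (hu i).2.1) fun i => (hu i).2.2.1) with ⟨j, hj, hjx⟩ | ⟨hmem, hnot⟩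
    · obtain ⟨i, hi⟩ := (eventually_isLeast_of_iterate U hτ (half_lt_self hσ) hσρ hW hWb hω hx hs hx0
        hnd hc hφ hX hG hext hψ (fun i => (hu i).2.1) (fun i => (hu i).2.2.1)
        (fun i => (hu i).2.2.2) hj fun t => by
          rw [← hjx t, ψ.ofReal_re_apply]).exists
      exact (hbad i).2 hi
    · refine hnot (limitCurve_conditions U hτ (half_lt_self hσ) hσρ.le hW hWb hω hG hs hy hext
        (fun i => (hu i).1) hψ (fun t l hl => ?_) fun t => ?_)
      · rw [← ψ.ofReal_re_apply]
        exact hmem t l hl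
      · rw [Complex.ofReal_re, ψ.ofReal_re_apply]
  filter_upwards [hforward, hX.isGood, hX.defect_eq_zero, hX.exponent] with g h1 h2 h3 h4
  refine ⟨h1, fun h => ⟨X g, h2.isAttractingCurve hσ hW h3 h4, ?_⟩⟩
  exact (h2.extSlopeZero_iff hσ hW).2 h

theorem upsilonNear_congr {x x' : ℂ → ℂ} (h : ∀ θ ∈ strip σ, x θ = x' θ) (s ε : ℝ) :
    (UpsilonNear s K₀ ω n x ε : Set (Maps σ W)) = UpsilonNear s K₀ ω n x' ε := by
  ext g
  refine exists_congr fun y => and_congr_right fun _ => and_congr_right fun _ =>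
    exists_congr fun ε' => and_congr_right fun _ => forall₂_congr fun θ hθ => ?_
  rw [h θ hθ]

/-- Both sets agree near f with the set where the multiplier along X(g) has extremum 0, which is the
zero set of Φ. -/
theorem isCodimOneManifoldNear_upsilon {r M : ℝ} (hK : 0 < K₀) (hr : 0 < r) (hW : IsOpen W)
    (hWb : Bornology.IsBounded W) (hω : Irrational ω) (hrρ : r ≤ ρ) {f : Maps ρ W} {x : ℂ → ℂ}
    (hx : IsAttractingCurve K₀ ω n f x) (hM : ∀ θ ∈ strip r, ‖slope f ω n θ (x θ)‖ ≤ M)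
    (hσρ : σ ≤ ρ) (hσ : 0 < σ) (hσb : σ ≤ bandWidth K₀ r M) {s : ℝ} (hs : s ≠ 0)
    (hx0 : ExtSlopeZero s ω n f x)
    (hnd : HasUniqueNondegExt s fun θ : ℝ => (slope f ω n θ (x θ)).re) :
    (∃ ε₀ > 0, ∀ ε : ℝ, 0 < ε → ε ≤ ε₀ →
      IsCodimOneManifoldNear (UpsilonNear s K₀ ω n x ε) (restrict hσρ f : Maps σ W)) ∧
    (IsOnlyCurve ω n f x (fun y => ExponentLe K₀ ω n f y ∧ ExtSlopeZero s ω n f y) →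
      IsCodimOneManifoldNear (Upsilon s K₀ ω n) (restrict hσρ f : Maps σ W)) := by
  have hlt : σ < ρ := by
    have := bandWidth_lt (K₀ := K₀) (r := r) (M := M) hK hr
    linarith
  obtain ⟨φ, hφ, hgood, hd, hm⟩ := hx.exists_restrict hσ hlt hW hWb
  have hc := fun (σ' : ℝ) (h : σ' ≤ σ) (a : RH σ') =>
    hx.isContracting hK hr hrρ hW hWb hω hM (a := a) (h.trans hσb)
  obtain ⟨X, hX⟩ := exists_isLocalCurve (K₀ := K₀) hσ hW hgood hd (hc σ le_rfl _ hm) (by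
    simp only [hm _ (ofReal_mem_strip hσ _)]
    exact hx.exponent)
  obtain ⟨θ₀, hz, hnn, huniq, h2⟩ := hx0.exists_zero hσ hs hnd hm
  obtain ⟨Φ, hΦ, hΦ', hiff⟩ := exists_definingFunction_multiplier hσ hW hWb hω hgood hd hX.contDiffAt
    hX.apply_self hX.unique hs hnn hz huniq h2
  have hself : IsLeast (range fun t : ℝ => s * reEval (multiplier (2 ^ n) ω
      (restrict hσρ f : Maps σ W) (X (restrict hσρ f)), t)) 0 := by
    rw [hX.apply_self]
    exact hx0.multiplier_isLeast hσ hm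
  have hcodim : ∀ S : Set (Maps σ W), (∀ᶠ g in 𝓝 (restrict hσρ f : Maps σ W), (g ∈ S ↔
      IsLeast (range fun t : ℝ => s * reEval (multiplier (2 ^ n) ω g (X g), t)) 0)) →
      IsCodimOneManifoldNear S (restrict hσρ f : Maps σ W) := fun S hS => by
    refine isCodimOneManifoldNear_of_eventually hΦ hΦ' (hS.self_of_nhds.2 hself) ?_
    filter_upwards [hS, hiff] with g h1 h2
    exact h1.trans h2.symm
  constructor
  · obtain ⟨ε₀, hε₀, h⟩ := hX.upsilonNear hσ hW hWb s
    refine ⟨ε₀, hε₀, fun ε hε hle => ?_⟩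
    rw [← upsilonNear_congr fun θ hθ => hφ θ (subset_closure hθ)]
    exact hcodim _ (h ε hε hle)
  · intro honly
    exact hcodim _ (hX.eventually_upsilon hσ hlt hW hWb hω hx hs hx0 hnd
      (hc _ (half_le_self hσ.le)) hφ honly)

end Main

end QPForced

end

theorem mainTheorem10 (K₀ r M : ℝ) (hK₀ : 0 < K₀) (hr : 0 < r) :
    ∃ ρ₀ : ℝ, 0 < ρ₀ ∧ ρ₀ ≤ r ∧
      ∀ (W : Set ℂ), IsOpen W → Bornology.IsBounded W →
      ∀ (ω : ℝ), QPForced.IsDiophantine ω → ∀ (n : ℕ) (ρ : ℝ), r ≤ ρ →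
      ∀ (f : QPForced.𝓑 ρ W) (x : ℂ → ℂ), QPForced.IsAttractingCurve K₀ ω n f x →
      (∀ θ ∈ QPForced.strip r, ‖QPForced.slope f ω n θ (x θ)‖ ≤ M) →
      ∀ (ρ' : ℝ) (hρ' : ρ' ≤ ρ), 0 < ρ' → ρ' ≤ ρ₀ →
        (QPForced.MinSlopeZero ω n f x →
          QPForced.HasUniqueNondegMin (fun θ : ℝ => (QPForced.slope f ω n θ (x θ)).re) →
          (∃ ε₀ > 0, ∀ ε : ℝ, 0 < ε → ε ≤ ε₀ →
            QPForced.IsCodimOneManifoldNear (QPForced.UpsilonPlusNear ρ' W K₀ ω n x ε)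
              (QPForced.restrict hρ' f)) ∧
          (QPForced.IsOnlyCurve ω n f x
              (fun y => QPForced.ExponentLe K₀ ω n f y ∧ QPForced.MinSlopeZero ω n f y) →
            QPForced.IsCodimOneManifoldNear (QPForced.UpsilonPlus ρ' W K₀ ω n)
              (QPForced.restrict hρ' f))) ∧
        (QPForced.MaxSlopeZero ω n f x →
          QPForced.HasUniqueNondegMax (fun θ : ℝ => (QPForced.slope f ω n θ (x θ)).re) →
          (∃ ε₀ > 0, ∀ ε : ℝ, 0 < ε → ε ≤ ε₀ →
            QPForced.IsCodimOneManifoldNear (QPForced.UpsilonMinusNear ρ' W K₀ ω n x ε)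
              (QPForced.restrict hρ' f)) ∧
          (QPForced.IsOnlyCurve ω n f x
              (fun y => QPForced.ExponentLe K₀ ω n f y ∧ QPForced.MaxSlopeZero ω n f y) →
            QPForced.IsCodimOneManifoldNear (QPForced.UpsilonMinus ρ' W K₀ ω n)
              (QPForced.restrict hρ' f))) := by
  refine ⟨QPForced.bandWidth K₀ r M, QPForced.bandWidth_pos hK₀ hr,
    (QPForced.bandWidth_lt hK₀ hr).le.trans (half_le_self hr.le), ?_⟩
  intro W hW hWb ω hω n ρ hrρ f x hx hM ρ' hρ' hρ'0 hρ'b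
  -- The sign s = 1 gives the minimum and s = -1 the maximum.
  have hmain := fun (s : ℝ) (hs : s ≠ 0) => QPForced.isCodimOneManifoldNear_upsilon hK₀ hr hW hWb
    (QPForced.irrational_of_isDiophantine hω) hrρ (f := f) hx hM hρ' hρ'0 hρ'b hs
  refine ⟨fun hmin hnd => ?_, fun hmax hnd => ?_⟩
  · have h := hmain 1 one_ne_zero (QPForced.minSlopeZero_iff.1 hmin) hnd.ext
    simp only [QPForced.UpsilonNear, QPForced.Upsilon, ← QPForced.minSlopeZero_iff] at h
    exact ⟨h.1, fun ho => h.2 fun y hy => (ho y hy).imp_right fun hh =>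
      ⟨hh.1, fun hp => hh.2 ⟨hp.1, QPForced.minSlopeZero_iff.2 hp.2⟩⟩⟩
  · have h := hmain (-1) (by norm_num) (QPForced.maxSlopeZero_iff.1 hmax) hnd.ext
    simp only [QPForced.UpsilonNear, QPForced.Upsilon, ← QPForced.maxSlopeZero_iff] at h
    exact ⟨h.1, fun ho => h.2 fun y hy => (ho y hy).imp_right fun hh =>
      ⟨hh.1, fun hp => hh.2 ⟨hp.1, QPForced.maxSlopeZero_iff.2 hp.2⟩⟩⟩
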